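/- All digraphs are finite and loopless, without parallel arcs. Let $D=(V,A)$ be a digraph with $n$ vertices. A *comparability ordering* of $D$ is a linear order $\prec$ on $V$ such that for all $x\prec y\prec z$: $xy,yz\in A$ implies $xz\in A$, and $zy,yx\in A$ implies $zx\in A$; $D$ is a *comparability digraph* if it has one. $D$ is *semicomplete* if any two distinct vertices are joined by at least one arc. Let $Z_D=\{(x,y): xy\in A\text{ or }yx\in A\}$. For $(x,y),(x',y')\in Z_D$ write $(x,y)\,\Gamma\,(x',y')$ if one of the following holds: (i) $(x,y)=(x',y')$; (ii) $x=x'$, $y\ne y'$, and either $yx,x'y'\in A$, $yy'\notin A$, or $y'x',xy\in A$, $y'y\notin A$; (iii) $y=y'$, $x\neq x'$, and either $xy,y'x'\in A$, $xx'\notin A$, or $x'y',yx\in A$, $x'x\notin A$. The equivalence classes of the transitive closure of $\Gamma$ on $Z_D$ are the *implication classes* of $D$; put $I^{-1}=\{(y,x):(x,y)\in I\}$. **Algorithm 1.** Input: a semicomplete digraph $D$. 1. If $I=I^{-1}$ for some implication class $I$ of $D$, return "$D$ is not a comparability digraph". 2. Otherwise let $T=\emptyset$ and let $\mathcal I$ be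 the set of implication classes $I$ of $D$ with $|I|>1$. 3. While $\mathcal I\ne\emptyset$: if there are $(x,y),(y,z)\in T$ and $I\in\mathcal I$ with $(x,z)\in I$, choose such an $I$; otherwise choose an arbitrary $I\in\mathcal I$. Replace $T$ by $T\cup I$ and $\mathcal I$ by $\mathcal I\setminus\{I,I^{-1}\}$. 4. Return a vertex ordering $\prec$ such that $(x,y)\in T$ implies $x\prec y$. **Theorem.** Algorithm 1 can be implemented to run in $\mathcal O(n^3)$ time. This gives an $\mathcal O(n^3)$ recognition algorithm for semicomplete comparability digraphs. Precisely: there is a single program for a random access machine (unit cost per instruction, all numbers occurring in the computation polynomially bounded in $n$, i.e. of $\mathcal O(\log n)$ bits) that, given the adjacency lists of any digraph $D$ with $n$ vertices, halts after $\mathcal O(n^3)$ steps, and such that - if $D$ is semicomplete, then the computation carries out Algorithm 1 on $D$: it answers no if the test in step 1 succeeds; otherwise its memory holds, at successive times and in the form of an $n\times n$ matrix at an address depending only on $n$, the successive sets $T$ of an execution of Algorithm 1, and it answers yes and returns a vertex ordering that extends the final set $T$; moreover, an ordering returned is a comparability ordering of $D$; - for every $D$, it answers yes if $D$ is a semicomplete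 comparability digraph, and no otherwise. -/

import Mathlib

/-! ### Comparability digraphs, implication classes -/

namespace ComparabilityDigraph

variable {V : Type*}

/-- Digraphs here have no loops. -/
def IsLoopless (D : Digraph V) : Prop := ∀ x, ¬ D.Adj x x

/-- Any two distinct vertices are joined by at least one arc. -/
def IsSemicomplete (D : Digraph V) : Prop := ∀ x y, x ≠ y → D.Adj x y ∨ D.Adj y x

/-- `r` is a vertex ordering (a strict linear order on the vertices) such that for all
`x ≺ y ≺ z`, arcs `xy, yz` imply an arc `xz`, and arcs `zy, yx` imply an arc `zx`. -/
def IsComparabilityOrdering (D : Digraph V) (r : V → V → Prop) : Prop :=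
  IsStrictTotalOrder V r ∧
    ∀ x y z, r x y → r y z →
      (D.Adj x y → D.Adj y z → D.Adj x z) ∧ (D.Adj z y → D.Adj y x → D.Adj z x)

/-- A comparability digraph: a digraph with a comparability ordering. -/
def IsComparability (D : Digraph V) : Prop := ∃ r : V → V → Prop, IsComparabilityOrdering D r

/-- The set `Z_D` of ordered pairs of adjacent vertices. -/
def pairs (D : Digraph V) : Set (V × V) := {p | D.Adj p.1 p.2 ∨ D.Adj p.2 p.1}

/-- The relation `Γ` on `Z_D`: `(x, y)` directly forces `(x', y')`. -/
def DirectlyForces (D : Digraph V) (p q : V × V) : Prop :=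
  p ∈ pairs D ∧ q ∈ pairs D ∧
    ((p.1 = q.1 ∧ p.2 = q.2) ∨
     (p.1 = q.1 ∧ p.2 ≠ q.2 ∧
        ((D.Adj p.2 p.1 ∧ D.Adj q.1 q.2 ∧ ¬ D.Adj p.2 q.2) ∨
         (D.Adj q.2 q.1 ∧ D.Adj p.1 p.2 ∧ ¬ D.Adj q.2 p.2))) ∨
     (p.2 = q.2 ∧ p.1 ≠ q.1 ∧
        ((D.Adj p.1 p.2 ∧ D.Adj q.2 q.1 ∧ ¬ D.Adj p.1 q.1) ∨
         (D.Adj q.1 q.2 ∧ D.Adj p.2 p.1 ∧ ¬ D.Adj q.1 p.1))))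

/-- The implication class containing `p`: its class under the transitive closure of `Γ`. -/
def implicationClass (D : Digraph V) (p : V × V) : Set (V × V) :=
  {q | Relation.TransGen (DirectlyForces D) p q}

/-- The set of all implication classes of `D`. -/
def implicationClasses (D : Digraph V) : Set (Set (V × V)) :=
  {I | ∃ p ∈ pairs D, I = implicationClass D p}

/-- The inverse of a set of pairs. -/
def inverse (I : Set (V × V)) : Set (V × V) := {p | (p.2, p.1) ∈ I}

/-! ### The algorithm, as a nondeterministic procedure

If some implication class equals its inverse, the algorithm answers that the digraph is not a
comparability digraph. Otherwise it runs the loop below until the collection of remaining classes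
is empty, and then returns any vertex ordering that extends the set `T` of collected pairs. -/

/-- The two variables of the loop. -/
structure LoopState (V : Type*) where
  /-- the set `T` of collected pairs -/
  T : Set (V × V)
  /-- the collection of remaining implication classes -/
  remaining : Set (Set (V × V))

/-- The first test of the algorithm succeeds: some implication class equals its inverse. -/
def FirstTest (D : Digraph V) : Prop := ∃ I ∈ implicationClasses D, I = inverse I

/-- Initially `T = ∅` and all implication classes with more than one element remain. -/
def LoopState.init (D : Digraph V) : LoopState V where
  T := ∅
  remaining := {I ∈ implicationClasses D | 1 < I.encard}

/-- The class `I` contains a pair `(x, z)` with `(x, y), (y, z) ∈ T`. -/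
def HasPriority (T I : Set (V × V)) : Prop :=
  ∃ x y z, (x, y) ∈ T ∧ (y, z) ∈ T ∧ (x, z) ∈ I

/-- One pass through the loop body: choose a remaining class that has priority if there is one,
and an arbitrary remaining class otherwise; add it to `T`, and discard it and its inverse. -/
def LoopStep (s s' : LoopState V) : Prop :=
  ∃ I ∈ s.remaining,
    (HasPriority s.T I ∨ ¬ ∃ J ∈ s.remaining, HasPriority s.T J) ∧
    s' = { T := s.T ∪ I, remaining := s.remaining \ {I, inverse I} }

/-- `S 0, …, S k` is a complete execution of the loop. -/
def IsLoopExecution (D : Digraph V) (k : ℕ) (S : ℕ → LoopState V) : Prop :=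
  S 0 = LoopState.init D ∧ (∀ i < k, LoopStep (S i) (S (i + 1))) ∧ (S k).remaining = ∅

/-- The vertex ordering `p 0 ≺ p 1 ≺ ⋯ ≺ p (n - 1)`. -/
def listingOrder {n : ℕ} (p : Equiv.Perm (Fin n)) (x y : Fin n) : Prop := p.symm x < p.symm y

end ComparabilityDigraph

/-! ### Random access machines

Programs for a random access machine with registers and an addressable memory, both holding
natural numbers, with structured control flow. Every elementary instruction and every evaluation
of a test costs one step. -/

namespace RAM

/-- Tests compare two registers. -/
inductive Test where
  | lt (a b : ℕ)
  | eq (a b : ℕ)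

inductive Stmt where
  /-- do nothing -/
  | skip
  /-- `reg r := k` -/
  | const (r k : ℕ)
  /-- `reg r := reg a` -/
  | move (r a : ℕ)
  /-- `reg r := reg a + reg b` -/
  | add (r a b : ℕ)
  /-- `reg r := reg a - reg b`, truncated at zero -/
  | sub (r a b : ℕ)
  /-- `reg r := reg a * reg b` -/
  | mul (r a b : ℕ)
  /-- `reg r := mem (reg a)` -/
  | load (r a : ℕ)
  /-- `mem (reg a) := reg b` -/
  | store (a b : ℕ)
  | seq (s₁ s₂ : Stmt)
  | ite (t : Test) (s₁ s₂ : Stmt)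
  | loop (t : Test) (s : Stmt)

structure Store where
  reg : ℕ → ℕ
  mem : ℕ → ℕ

/-- The result of a test. -/
def Test.eval (σ : Store) : Test → Bool
  | .lt a b => decide (σ.reg a < σ.reg b)
  | .eq a b => decide (σ.reg a = σ.reg b)

def Store.setReg (σ : Store) (r v : ℕ) : Store := { σ with reg := Function.update σ.reg r v }

def Store.setMem (σ : Store) (i v : ℕ) : Store := { σ with mem := Function.update σ.mem i v }

/-- A configuration: the statements still to be executed, in order, and the store. -/
structure Config where
  todo : List Stmt
  store : Store

/-- The machine has halted when nothing is left to be executed. -/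
def Config.Halted (c : Config) : Prop := c.todo = []

/-- One step of the machine; a halted configuration does not change. -/
def step : Config → Config
  | ⟨[], σ⟩ => ⟨[], σ⟩
  | ⟨.skip :: K, σ⟩ => ⟨K, σ⟩
  | ⟨.const r k :: K, σ⟩ => ⟨K, σ.setReg r k⟩
  | ⟨.move r a :: K, σ⟩ => ⟨K, σ.setReg r (σ.reg a)⟩
  | ⟨.add r a b :: K, σ⟩ => ⟨K, σ.setReg r (σ.reg a + σ.reg b)⟩
  | ⟨.sub r a b :: K, σ⟩ => ⟨K, σ.setReg r (σ.reg a - σ.reg b)⟩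
  | ⟨.mul r a b :: K, σ⟩ => ⟨K, σ.setReg r (σ.reg a * σ.reg b)⟩
  | ⟨.load r a :: K, σ⟩ => ⟨K, σ.setReg r (σ.mem (σ.reg a))⟩
  | ⟨.store a b :: K, σ⟩ => ⟨K, σ.setMem (σ.reg a) (σ.reg b)⟩
  | ⟨.seq s₁ s₂ :: K, σ⟩ => ⟨s₁ :: s₂ :: K, σ⟩
  | ⟨.ite t s₁ s₂ :: K, σ⟩ => ⟨(if t.eval σ then s₁ else s₂) :: K, σ⟩
  | ⟨.loop t s :: K, σ⟩ => ⟨if t.eval σ then s :: .loop t s :: K else K, σ⟩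

/-- Initially the registers are zero and the memory holds the input word, followed by zeros. -/
def initial (P : Stmt) (w : List ℕ) : Config :=
  ⟨[P], { reg := fun _ => 0, mem := fun i => w.getD i 0 }⟩

/-- The configuration of the program `P` on the input word `w` after `t` steps. -/
def run (P : Stmt) (w : List ℕ) (t : ℕ) : Config := step^[t] (initial P w)

end RAM

/-! ### Input, output, and implementations of the algorithm -/

namespace ComparabilityDigraph

/-- `L` is a system of adjacency lists of `D`: `L x` lists, in any order and without
repetition, the out-neighbours of `x`. -/
def IsAdjacencyLists {n : ℕ} (D : Digraph (Fin n)) (L : Fin n → List (Fin n)) : Prop :=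
  ∀ x, (L x).Nodup ∧ ∀ y, y ∈ L x ↔ D.Adj x y

/-- The input word: the number `n` of vertices, followed, for each vertex `x = 0, …, n - 1`,
by the length of the adjacency list of `x` and the entries of this list. -/
def inputWord {n : ℕ} (L : Fin n → List (Fin n)) : List ℕ :=
  n :: (List.finRange n).flatMap fun x => (L x).length :: (L x).map Fin.val

/-- The answer no: 0 in register 0. -/
def AnswersNo (σ : RAM.Store) : Prop := σ.reg 0 = 0

/-- The answer yes: 1 in register 0. -/
def AnswersYes (σ : RAM.Store) : Prop := σ.reg 0 = 1

/-- The ordering `p 0 ≺ p 1 ≺ ⋯` is returned in consecutive memory cells, starting from the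
address in register 1. -/
def ReturnsOrdering {n : ℕ} (σ : RAM.Store) (p : Equiv.Perm (Fin n)) : Prop :=
  ∀ i : Fin n, σ.mem (σ.reg 1 + i) = p i

/-- The memory holds the set `T` of pairs as an `n × n` matrix, row by row from address `b`. -/
def HoldsPairs {n : ℕ} (σ : RAM.Store) (b : ℕ) (T : Set (Fin n × Fin n)) : Prop :=
  ∀ x y : Fin n, σ.mem (b + (x * n + y)) ≠ 0 ↔ (x, y) ∈ T

/-- The first `N` steps of the computation of `P` on the input word `w` carry out the algorithm
on `D`. Either the first test succeeds and the answer is no; or it fails, there is a complete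
execution `S 0, …, S k` of the loop such that at successive times `t 0 < ⋯ < t k ≤ N` the
memory holds the sets `T` of `S 0, …, S k` as matrices at address `b`, and the answer is yes
together with a vertex ordering that extends the final `T`. -/
def CarriesOut {n : ℕ} (P : RAM.Stmt) (w : List ℕ) (N b : ℕ) (D : Digraph (Fin n)) : Prop :=
  (FirstTest D ∧ AnswersNo (RAM.run P w N).store) ∨
  (¬ FirstTest D ∧ AnswersYes (RAM.run P w N).store ∧
    ∃ (k : ℕ) (S : ℕ → LoopState (Fin n)) (t : ℕ → ℕ),
      IsLoopExecution D k S ∧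
      (∀ i < k, t i < t (i + 1)) ∧ t k ≤ N ∧
      (∀ i ≤ k, HoldsPairs (RAM.run P w (t i)).store b (S i).T) ∧
      ∃ p : Equiv.Perm (Fin n), ReturnsOrdering (RAM.run P w N).store p ∧
        ∀ x y, (x, y) ∈ (S k).T → listingOrder p x y)

end ComparabilityDigraph

open ComparabilityDigraph

/-!
Let `D` be semicomplete. A pair `(x, y)` lies in an implication class with several elements as soon
as some third vertex `u` distinguishes the ends of the pair, which is a local condition; the set `T`
of the algorithm is at all times an acyclic, asymmetric union of such classes. Three facts keep it
acyclic when a class `I` is added.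

* If `(x, y)` and `(y, z)` are collected, and `(x, z)` is in a class with several elements neither
  of whose orientations is collected, then all six arcs between `x`, `y`, `z` are present. The
  triangle lemma then says that every `(a, b) ∈ I` has `(a, y)` and `(y, b)` in `T`, so a class with
  priority adds nothing to the transitive closure of `T`.
* On a shortest cycle of an asymmetric union of classes, all arcs between any two vertices are
  present. If no class has priority, then by the triangle lemma such a cycle in `T ∪ I` has only one
  pair in `I`, and two chords of length two which lie in singleton classes. The ends of such a chord
  have the same neighbours, and this forces a pair of the cycle and its inverse into `T`.
* When no class remains, every linear extension of `T` is a comparability ordering, since a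
  violated transitivity condition would exhibit two pairs that force each other, oriented
  differently.

The time bound rests on the observation that, for each pair `(x, y)`, the pairs directly forced by
it are found by one scan over the vertices. As a class is collected by a breadth-first search that
marks its pairs, all searches together take `O(n³)` steps. In order to find a class that has
priority, each newly collected pair `(x, y)` scans for the pairs `(x, z)` with `(y, z) ∈ T` and
`(z, y)` with `(z, x) ∈ T`, so that the pairs having priority are gathered in `O(n³)` steps too.
-/

namespace ComparabilityDigraph

section LinkedPairs

variable {V : Type*} {D : Digraph V} {T : V → V → Prop} {a b c u x y z : V}

/-- The pairs `(x, y)` and `(x, z)` are distinct and directly force each other; so do then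
`(y, x)` and `(z, x)`. -/
def Link (D : Digraph V) (x y z : V) : Prop :=
  y ≠ z ∧ ((D.Adj y x ∧ D.Adj x z ∧ ¬ D.Adj y z) ∨ (D.Adj z x ∧ D.Adj x y ∧ ¬ D.Adj z y))

/-- The arc `xy` is present, the arc `yx` is not. -/
def Single (D : Digraph V) (x y : V) : Prop := D.Adj x y ∧ ¬ D.Adj y x

/-- Both arcs `xy` and `yx` are present. -/
def Double (D : Digraph V) (x y : V) : Prop := D.Adj x y ∧ D.Adj y x

/-- The pair `(x, y)` directly forces some other pair; equivalently, its implication class has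
more than one element. -/
def Linked (D : Digraph V) (x y : V) : Prop := ∃ u, Link D x y u ∨ Link D y x u

/-- No three vertices form a cycle of single arcs. -/
def NoSingleTriangle (D : Digraph V) : Prop :=
  ∀ a b c, Single D a b → Single D b c → ¬ Single D c a

/-- The digraph with all arcs reversed. It has the same links, which halves many case
distinctions. -/
def reverse (D : Digraph V) : Digraph V := ⟨fun x y => D.Adj y x⟩

theorem Link.symm (h : Link D x y z) : Link D x z y := ⟨h.1.symm, h.2.symm⟩

theorem Linked.symm (h : Linked D x y) : Linked D y x := h.imp fun _ => Or.symm

theorem Double.symm (h : Double D x y) : Double D y x := ⟨h.2, h.1⟩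

theorem Single.ne (h : Single D x y) : x ≠ y := by
  rintro rfl
  exact h.2 h.1

theorem IsSemicomplete.single_or_single_or_double (hS : IsSemicomplete D) (h : x ≠ y) :
    Single D x y ∨ Single D y x ∨ Double D x y := by
  have := hS x y h
  unfold Single Double
  tauto

theorem Link.single_or_single (hS : IsSemicomplete D) (h : Link D x y z) :
    Single D y z ∨ Single D z y := by
  have := hS y z h.1
  have := h.2
  unfold Single
  tauto

theorem Link.of_double (hab : Double D b a) (hbc : Double D b c)
    (h : Single D a c ∨ Single D c a) : Link D b a c := by
  rcases h with h | h
  · exact ⟨h.ne, Or.inr ⟨hbc.2, hab.1, h.2⟩⟩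
  · exact ⟨h.ne.symm, Or.inl ⟨hab.2, hbc.1, h.2⟩⟩

theorem Link.of_path (hbc : Double D b c) (hca : Single D c a) (hab : Single D a b) :
    Link D b a c ∧ Link D c a b :=
  ⟨⟨hca.ne.symm, Or.inl ⟨hab.1, hbc.1, hca.2⟩⟩, ⟨hab.ne, Or.inr ⟨hbc.1, hca.1, hab.2⟩⟩⟩

theorem single_reverse : Single (reverse D) x y ↔ Single D y x := Iff.rfl

theorem link_reverse : Link (reverse D) x y z ↔ Link D x y z := by
  simp only [Link, reverse]
  tauto

theorem linked_reverse : Linked (reverse D) x y ↔ Linked D x y := by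
  simp only [Linked, link_reverse]

theorem IsSemicomplete.reverse (h : IsSemicomplete D) : IsSemicomplete (reverse D) :=
  fun x y hxy => (h x y hxy).symm

theorem NoSingleTriangle.reverse (h : NoSingleTriangle D) : NoSingleTriangle (reverse D) :=
  fun a b c hab hbc hca => h c b a hbc hab hca

theorem Linked.single_cases (hS : IsSemicomplete D) (hC : NoSingleTriangle D)
    (hl : Linked D x y) (hxy : Single D x y) :
    (∃ u, Double D x u ∧ Single D y u) ∨ (∃ u, Double D u y ∧ Single D u x) := by
  obtain ⟨u, ⟨hne, h | ⟨hux, -, huy⟩⟩ | ⟨hne, ⟨-, hyu, hxu⟩ | h⟩⟩ := hl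
  · exact absurd h.1 hxy.2
  · have hyu : Single D y u := ⟨(hS y u hne).resolve_right huy, huy⟩
    exact Or.inl ⟨u, ⟨by_contra fun hxu => hC x y u hxy hyu ⟨hux, hxu⟩, hux⟩, hyu⟩
  · have hux : Single D u x := ⟨(hS x u hne).resolve_left hxu, hxu⟩
    exact Or.inr ⟨u, ⟨by_contra fun huy => hC x y u hxy ⟨hyu, huy⟩ hux, hyu⟩, hux⟩
  · exact absurd h.2.1 hxy.2

/-- `T`, as a set of pairs, is closed under direct forcing. -/
structure ForcingClosed (D : Digraph V) (T : V → V → Prop) : Prop where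
  left : ∀ {x y z}, Link D x y z → T x y → T x z
  right : ∀ {x y z}, Link D x y z → T y x → T z x

namespace ForcingClosed

theorem linked (D : Digraph V) : ForcingClosed D (Linked D) :=
  ⟨fun hl _ => ⟨_, Or.inl hl.symm⟩, fun hl _ => ⟨_, Or.inr hl.symm⟩⟩

theorem swap (hT : ForcingClosed D T) : ForcingClosed D (fun x y => T y x) :=
  ⟨hT.right, hT.left⟩

theorem reverse (hT : ForcingClosed D T) : ForcingClosed (reverse D) T :=
  ⟨fun hl => hT.left (link_reverse.1 hl), fun hl => hT.right (link_reverse.1 hl)⟩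

theorem iff_of_link (hT : ForcingClosed D T) (hl : Link D x y z) :
    (T x y ↔ T x z) ∧ (T y x ↔ T z x) :=
  ⟨⟨hT.left hl, hT.left hl.symm⟩, ⟨hT.right hl, hT.right hl.symm⟩⟩

theorem iff_of_double (hT : ForcingClosed D T) (hab : Double D b a) (hbc : Double D b c)
    (h : Single D a c ∨ Single D c a) : (T b a ↔ T b c) ∧ (T a b ↔ T c b) :=
  hT.iff_of_link (Link.of_double hab hbc h)

theorem iff_of_path (hT : ForcingClosed D T) (hbc : Double D b c) (hca : Single D c a)
    (hab : Single D a b) :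
    ((T b a ↔ T b c) ∧ (T a b ↔ T c b)) ∧ (T c a ↔ T c b) ∧ (T a c ↔ T b c) :=
  (Link.of_path hbc hca hab).imp hT.iff_of_link hT.iff_of_link

end ForcingClosed

/-- An asymmetric union of implication classes with several elements, in a semicomplete digraph
without cyclic triangles of single arcs. The collected pairs are always of this form. -/
structure PartialOrientation (D : Digraph V) (T : V → V → Prop) : Prop
    extends ForcingClosed D T where
  semicomplete : IsSemicomplete D
  noSingleTriangle : NoSingleTriangle D
  asymm : ∀ {x y}, T x y → ¬ T y x
  linked : ∀ {x y}, T x y → Linked D x y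

/-- The linked pair `(x, y)` is in `T` in neither orientation. -/
structure Uncollected (D : Digraph V) (T : V → V → Prop) (x y : V) : Prop where
  linked : Linked D x y
  not_forward : ¬ T x y
  not_backward : ¬ T y x

/-- Two consecutive pairs of `T` that imply, by transitivity, an uncollected pair `(x, z)`. -/
structure OpenPath (D : Digraph V) (T : V → V → Prop) (x y z : V) : Prop
    extends Uncollected D T x z where
  first : T x y
  second : T y z

namespace OpenPath

theorem swap (h : OpenPath D T x y z) : OpenPath D (fun x y => T y x) z y x :=
  ⟨⟨h.linked.symm, h.not_forward, h.not_backward⟩, h.second, h.first⟩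

theorem reverse (h : OpenPath D T x y z) : OpenPath (reverse D) T x y z :=
  ⟨⟨linked_reverse.2 h.linked, h.not_forward, h.not_backward⟩, h.first, h.second⟩

end OpenPath

namespace PartialOrientation

theorem swap (hT : PartialOrientation D T) : PartialOrientation D (fun x y => T y x) where
  toForcingClosed := hT.toForcingClosed.swap
  semicomplete := hT.semicomplete
  noSingleTriangle := hT.noSingleTriangle
  asymm := hT.asymm
  linked h := (hT.linked h).symm

theorem reverse (hT : PartialOrientation D T) : PartialOrientation (reverse D) T where
  toForcingClosed := hT.toForcingClosed.reverse
  semicomplete := hT.semicomplete.reverse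
  noSingleTriangle := hT.noSingleTriangle.reverse
  asymm := hT.asymm
  linked h := linked_reverse.2 (hT.linked h)

theorem ne (hT : PartialOrientation D T) (h : T x y) : x ≠ y := by
  rintro rfl
  exact hT.asymm h h

theorem cases_of_ne (hT : PartialOrientation D T) (h : x ≠ y) :
    Single D x y ∨ Single D y x ∨ Double D x y :=
  hT.semicomplete.single_or_single_or_double h

theorem single_of_double_left (hT : PartialOrientation D T) (hxy : Single D x y)
    (hzy : Single D z y) (hne : x ≠ z) (h : T x y) (hzy' : ¬ T z y) (hxz' : ¬ T x z)
    (hxu : Double D x u) (hyu : Single D y u) : Single D z x := by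
  have hxyu := hT.iff_of_path hxu.symm hxy hyu
  have hzu : z ≠ u := by
    rintro rfl
    exact hzy.2 hyu.1
  rcases hT.cases_of_ne hzu with hz | hz | hz
  · rcases hT.cases_of_ne hne with hx | hx | hx
    · have := hT.iff_of_path hxu.symm hx hz
      grind
    · exact hx
    · have := hT.iff_of_double hx hxu (Or.inl hz)
      grind
  · exact (hT.noSingleTriangle z y u hzy hyu hz).elim
  · have := hT.iff_of_path hz.symm hzy hyu
    grind

theorem single_or_path_of_double_right (hT : PartialOrientation D T) (hxy : Single D x y)
    (hzy : Single D z y) (hne : x ≠ z) (h : T x y) (hzy' : ¬ T z y) (hxz' : ¬ T x z)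
    (huy : Double D u y) (hux : Single D u x) :
    Single D z x ∨ (Double D x z ∧ Single D z u ∧ T z u ∧ T u x) := by
  have huxy := hT.iff_of_path huy.symm hux hxy
  have hzu : z ≠ u := by
    rintro rfl
    exact hzy.2 huy.2
  rcases hT.cases_of_ne hzu with hz | hz | hz
  · rcases hT.cases_of_ne hne with hx | hx | hx
    · exact (hT.noSingleTriangle x z u hx hz hux).elim
    · exact Or.inl hx
    · have := hT.iff_of_path hx hz hux
      grind
  · have := hT.iff_of_path huy.symm hz hzy
    grind
  · have := hT.iff_of_double huy hz.symm (Or.inr hzy)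
    rcases hT.cases_of_ne hne with hx | hx | hx
    · have := hT.iff_of_path hz hux hx
      grind
    · exact Or.inl hx
    · have := hT.iff_of_double hz hx.symm (Or.inl hux)
      have := hT.asymm h
      grind

theorem single_or_detour (hT : PartialOrientation D T) (hxy : Single D x y)
    (hzy : Single D z y) (hne : x ≠ z) (h : T x y) (hzy' : ¬ T z y) (hxz' : ¬ T x z) :
    Single D z x ∨ (Double D x z ∧ ∃ u, Single D z u ∧ Single D u x ∧ T z u ∧ T u x) := by
  rcases (hT.linked h).single_cases hT.semicomplete hT.noSingleTriangle hxy with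
    ⟨u, hxu, hyu⟩ | ⟨u, huy, hux⟩
  · exact Or.inl (hT.single_of_double_left hxy hzy hne h hzy' hxz' hxu hyu)
  · exact (hT.single_or_path_of_double_right hxy hzy hne h hzy' hxz' huy hux).imp_right
      fun ⟨hxz, hzu, tzu, tux⟩ => ⟨hxz, u, hzu, hux, tzu, tux⟩

/-- With `y = y'`, this says that an open path cannot run along single arcs `xy` and `zy`. -/
theorem not_opposite_single (hT : PartialOrientation D T) {y' : V} (hxy : Single D x y)
    (hzy : Single D z y) (hxy' : Single D x y') (hzy' : Single D z y') (hne : x ≠ z) (h : T x y)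
    (h' : T y' z) (hzy_not : ¬ T z y) (hxy'_not : ¬ T y' x) : T x z := by
  by_contra hxz
  rcases hT.single_or_detour hxy hzy hne h hzy_not hxz with
    hzx | ⟨dxz, u, hzu, hux, tzu, -⟩ <;>
  rcases hT.swap.single_or_detour hzy' hxy' hne.symm h' hxy'_not hxz with
    hxz' | ⟨dzx, v, hxv, hvz, -, tzv⟩
  · exact hzx.2 hxz'.1
  · exact hzx.2 dzx.2
  · exact hxz'.2 dxz.2
  · have huv : u ≠ v := by
      rintro rfl
      exact hux.2 hxv.1
    rcases hT.cases_of_ne huv with huv | hvu | huv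
    · exact hT.noSingleTriangle _ _ _ huv hvz hzu
    · exact hT.noSingleTriangle _ _ _ hvu hux hxv
    · have := hT.iff_of_path huv hvz hzu
      have := hT.asymm tzu
      have := hT.asymm tzv
      grind

end PartialOrientation

namespace OpenPath

variable {p q r : V}

theorem ne (h : OpenPath D T p q r) (hT : PartialOrientation D T) : p ≠ r := by
  rintro rfl
  exact hT.asymm h.first h.second

theorem false_of_double_start (h : OpenPath D T p q r) (hT : PartialOrientation D T)
    (hpq : Single D p q) (hqr : Single D q r ∨ Double D q r) (hpr : Single D p r)
    (hpu : Double D p u) (hru : Single D r u) : False := by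
  obtain ⟨⟨-, npr, _⟩, tpq, tqr⟩ := h
  have := hT.iff_of_path hpu.symm hpr hru
  have hqu : q ≠ u := by
    rintro rfl
    exact hpq.2 hpu.2
  rcases hT.cases_of_ne hqu with hqu | huq | hqu
  · have := hT.iff_of_path hpu.symm hpq hqu
    grind
  · rcases hqr with hqr | hqr
    · exact hT.noSingleTriangle _ _ _ huq hqr hru
    · have := hT.iff_of_path hqr hru huq
      grind
  · have := hT.iff_of_double hpu.symm hqu.symm (Or.inl hpq)
    rcases hqr with hqr | hqr
    · have := hT.iff_of_path hqu.symm hqr hru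
      grind
    · have := hT.iff_of_double hqr hqu (Or.inl hru)
      grind

theorem false_of_double_end (h : OpenPath D T p q r) (hT : PartialOrientation D T)
    (hpq : Single D p q) (hqr : Single D q r ∨ Double D q r) (hpr : Single D p r)
    (hur : Double D u r) (hup : Single D u p) : False := by
  obtain ⟨⟨-, npr, _⟩, tpq, tqr⟩ := h
  have := hT.iff_of_path hur.symm hup hpr
  have hqu : q ≠ u := by
    rintro rfl
    exact hpq.2 hup.1
  rcases hT.cases_of_ne hqu with hqu | huq | hqu
  · exact hT.noSingleTriangle _ _ _ hqu hup hpq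
  · rcases hqr with hqr | hqr
    · have := hT.iff_of_path hur.symm huq hqr
      grind
    · have := hT.iff_of_double hur.symm hqr.symm (Or.inl huq)
      grind
  · have := hT.iff_of_path hqu hup hpq
    grind

theorem not_single (h : OpenPath D T p q r) (hT : PartialOrientation D T) (hpq : Single D p q)
    (hqr : Single D q r ∨ Double D q r) : ¬ Single D p r := by
  intro hpr
  rcases h.linked.single_cases hT.semicomplete hT.noSingleTriangle hpr with
    ⟨u, hpu, hru⟩ | ⟨u, hur, hup⟩
  · exact h.false_of_double_start hT hpq hqr hpr hpu hru
  · exact h.false_of_double_end hT hpq hqr hpr hur hup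

theorem not_single_first (h : OpenPath D T p q r) (hT : PartialOrientation D T) :
    ¬ Single D p q := by
  intro hpq
  obtain ⟨⟨-, npr, _⟩, tpq, tqr⟩ := id h
  rcases hT.cases_of_ne (hT.ne tqr) with hqr | hrq | hqr
  · rcases hT.cases_of_ne (h.ne hT) with hpr | hrp | hpr
    · exact h.not_single hT hpq (Or.inl hqr) hpr
    · exact hT.noSingleTriangle _ _ _ hpq hqr hrp
    · have := hT.iff_of_path hpr.symm hpq hqr
      grind
  · exact npr (hT.not_opposite_single hpq hrq hpq hrq (h.ne hT) tpq tqr (hT.asymm tqr)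
      (hT.asymm tpq))
  · rcases hT.cases_of_ne (h.ne hT) with hpr | hrp | hpr
    · exact h.not_single hT hpq (Or.inr hqr) hpr
    · have := hT.iff_of_path hqr hrp hpq
      grind
    · have := hT.iff_of_double hpr.symm hqr.symm (Or.inl hpq)
      grind

theorem double_first (h : OpenPath D T p q r) (hT : PartialOrientation D T) : Double D p q := by
  rcases hT.cases_of_ne (hT.ne h.first) with hpq | hqp | hpq
  · exact (h.not_single_first hT hpq).elim
  · exact (h.reverse.not_single_first hT.reverse hqp).elim
  · exact hpq

theorem double_second (h : OpenPath D T p q r) (hT : PartialOrientation D T) : Double D q r :=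
  (h.swap.double_first hT.swap).symm

theorem double (h : OpenPath D T p q r) (hT : PartialOrientation D T) : Double D p r := by
  have hpq := (h.double_first hT).symm
  have hqr := h.double_second hT
  have := hT.asymm h.first
  have := h.second
  rcases hT.cases_of_ne (h.ne hT) with hpr | hrp | hpr
  · have := hT.iff_of_double hpq hqr (Or.inl hpr)
    grind
  · have := hT.iff_of_double hpq hqr (Or.inr hrp)
    grind
  · exact hpr

end OpenPath

end LinkedPairs

section ImplicationClasses

variable {V : Type*} {D : Digraph V} {T : V → V → Prop} {p q : V × V} {a b c x y x' y' z : V}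

/-- The pairs `p` and `q` lie in the same implication class. -/
abbrev SameClass (D : Digraph V) (p q : V × V) : Prop := Relation.TransGen (DirectlyForces D) p q

/-- No implication class contains a pair together with its inverse. -/
def NoSelfInverse (D : Digraph V) : Prop := ∀ x y, ¬ SameClass D (x, y) (y, x)

theorem directlyForces_iff :
    DirectlyForces D p q ↔ (p = q ∧ p ∈ pairs D) ∨ (p.1 = q.1 ∧ Link D p.1 p.2 q.2) ∨
      (p.2 = q.2 ∧ Link D p.2 p.1 q.1) := by
  obtain ⟨x, y⟩ := p
  obtain ⟨x', y'⟩ := q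
  simp only [DirectlyForces, Link, pairs, Set.mem_ofPred_eq, Prod.mk.injEq]
  constructor
  · rintro ⟨hp, -, ⟨rfl, rfl⟩ | ⟨rfl, hne, h⟩ | ⟨rfl, hne, h⟩⟩
    · exact Or.inl ⟨⟨rfl, rfl⟩, hp⟩
    · exact Or.inr (Or.inl ⟨rfl, hne, by tauto⟩)
    · exact Or.inr (Or.inr ⟨rfl, hne, by tauto⟩)
  · rintro (⟨⟨rfl, rfl⟩, hp⟩ | ⟨rfl, hne, h⟩ | ⟨rfl, hne, h⟩)
    · exact ⟨hp, hp, Or.inl ⟨rfl, rfl⟩⟩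
    · exact ⟨by tauto, by tauto, Or.inr (Or.inl ⟨rfl, hne, by tauto⟩)⟩
    · exact ⟨by tauto, by tauto, Or.inr (Or.inr ⟨rfl, hne, by tauto⟩)⟩

theorem Link.sameClass_left (h : Link D x y z) : SameClass D (x, y) (x, z) :=
  .single (directlyForces_iff.2 (Or.inr (Or.inl ⟨rfl, h⟩)))

theorem Link.sameClass_right (h : Link D x y z) : SameClass D (y, x) (z, x) :=
  .single (directlyForces_iff.2 (Or.inr (Or.inr ⟨rfl, h⟩)))

theorem SameClass.refl (hp : p ∈ pairs D) : SameClass D p p :=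
  .single (directlyForces_iff.2 (Or.inl ⟨rfl, hp⟩))

theorem SameClass.mem_pairs_left (h : SameClass D p q) : p ∈ pairs D :=
  (Relation.TransGen.head'_iff.1 h).elim fun _ h => h.1.1

theorem ForcingClosed.of_sameClass (hT : ForcingClosed D T) (h : SameClass D p q)
    (hp : T p.1 p.2) : T q.1 q.2 := by
  have step : ∀ {p q : V × V}, DirectlyForces D p q → T p.1 p.2 → T q.1 q.2 := by
    rintro ⟨x, y⟩ ⟨x', y'⟩ h hp
    rcases directlyForces_iff.1 h with ⟨⟨⟩, -⟩ | ⟨rfl, hl⟩ | ⟨rfl, hl⟩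
    · exact hp
    · exact hT.left hl hp
    · exact hT.right hl hp
  induction h with
  | single h => exact step h hp
  | tail _ h ih => exact step h ih

theorem ForcingClosed.sameClass (D : Digraph V) (p : V × V) :
    ForcingClosed D fun x y => SameClass D p (x, y) :=
  ⟨fun hl h => h.trans hl.sameClass_left, fun hl h => h.trans hl.sameClass_right⟩

theorem ForcingClosed.or {T' : V → V → Prop} (hT : ForcingClosed D T)
    (hT' : ForcingClosed D T') : ForcingClosed D fun x y => T x y ∨ T' x y :=
  ⟨fun hl => Or.imp (hT.left hl) (hT'.left hl), fun hl => Or.imp (hT.right hl) (hT'.right hl)⟩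

theorem SameClass.swap (h : SameClass D p q) : SameClass D p.swap q.swap :=
  (ForcingClosed.sameClass D p.swap).swap.of_sameClass h (.refl (Or.symm h.mem_pairs_left))

theorem SameClass.flip (h : SameClass D (x, y) (x', y')) : SameClass D (y, x) (y', x') := h.swap

theorem SameClass.symm (h : SameClass D p q) : SameClass D q p :=
  ForcingClosed.of_sameClass (T := fun x y => SameClass D (x, y) p)
    ⟨fun hl h => hl.symm.sameClass_left.trans h, fun hl h => hl.symm.sameClass_right.trans h⟩
    h (.refl h.mem_pairs_left)

theorem ForcingClosed.iff_of_sameClass (hT : ForcingClosed D T) (h : SameClass D p q) :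
    T p.1 p.2 ↔ T q.1 q.2 :=
  ⟨hT.of_sameClass h, hT.of_sameClass h.symm⟩

theorem NoSelfInverse.noSingleTriangle (h : NoSelfInverse D) : NoSingleTriangle D := by
  intro a b c hab hbc hca
  have habc : Link D a b c := ⟨hbc.ne, Or.inr ⟨hca.1, hab.1, hbc.2⟩⟩
  have hcab : Link D c a b := ⟨hab.ne, Or.inr ⟨hbc.1, hca.1, hab.2⟩⟩
  have hbca : Link D b c a := ⟨hca.ne, Or.inr ⟨hab.1, hbc.1, hca.2⟩⟩
  exact h a b
    (habc.sameClass_left.trans (hcab.sameClass_right.trans hbca.sameClass_left))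

/-- All arcs between `a`, `b`, `c` are present, and the only coincidences among the classes of
`(b, c)`, `(a, b)`, `(a, c)` and their inverses that are allowed are those of `(a, b)` with `(b, c)`
and of `(a, c)` with `(c, b)`. This is the hypothesis of the triangle lemma. -/
structure Rainbow (D : Digraph V) (a b c : V) : Prop where
  bc : Double D b c
  ab : Double D a b
  ac : Double D a c
  bc_ac : ¬ SameClass D (b, c) (a, c)
  ab_ac : ¬ SameClass D (a, b) (a, c)
  bc_ba : ¬ SameClass D (b, c) (b, a)

namespace Rainbow

variable {b' : V}

theorem swap (h : Rainbow D a b c) : Rainbow D a c b where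
  bc := h.bc.symm
  ab := h.ac
  ac := h.ab
  bc_ac e := h.bc_ba e.flip
  ab_ac e := h.ab_ac e.symm
  bc_ba e := h.bc_ac e.flip

theorem ne_of_link (hS : IsSemicomplete D) (h : Rainbow D a b c) (hl : Link D c b b') :
    a ≠ b' := by
  rintro rfl
  rcases hl.single_or_single hS with hs | hs
  · exact hs.2 h.ab.1
  · exact hs.2 h.ab.2

theorem double_bc_of_link (hS : IsSemicomplete D) (h : Rainbow D a b c) (hl : Link D c b b') :
    Double D b' c := by
  by_contra hd
  have hpath : (Single D c b' ∧ Single D b' b) ∨ (Single D b b' ∧ Single D b' c) := by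
    have := hl.single_or_single hS
    have := h.bc
    have := hl.2
    unfold Double at *
    unfold Single at *
    tauto
  have hab' := hS.single_or_single_or_double (h.ne_of_link hS hl)
  rcases hpath with ⟨hcb', hb'b⟩ | ⟨hbb', hb'c⟩
  · rcases hab' with hab' | hb'a | hab'
    · have hbc := (Link.of_path h.bc hcb' hb'b).1
      have hba := (Link.of_path h.ab.symm hab' hb'b).1
      exact h.bc_ba (hbc.symm.sameClass_left.trans hba.sameClass_left)
    · have hca := (Link.of_path h.ac hcb' hb'a).2
      exact h.bc_ac (hl.sameClass_right.trans hca.sameClass_right)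
    · have habb' := Link.of_double h.ab hab' (Or.inr hb'b)
      have hab'c := Link.of_double hab' h.ac (Or.inr hcb')
      exact h.ab_ac (habb'.sameClass_left.trans hab'c.sameClass_left)
  · rcases hab' with hab' | hb'a | hab'
    · have hca := (Link.of_path h.ac.symm hab' hb'c).1
      exact h.bc_ac (hl.sameClass_right.trans hca.sameClass_right)
    · have hbc := (Link.of_path h.bc.symm hbb' hb'c).2
      have hba := (Link.of_path h.ab hbb' hb'a).2
      exact h.bc_ba (hbc.symm.sameClass_left.trans hba.sameClass_left)
    · have habb' := Link.of_double h.ab hab' (Or.inl hbb')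
      have hab'c := Link.of_double hab' h.ac (Or.inl hb'c)
      exact h.ab_ac (habb'.sameClass_left.trans hab'c.sameClass_left)

theorem double_ab_of_link (hS : IsSemicomplete D) (h : Rainbow D a b c) (hl : Link D c b b') :
    Double D a b' := by
  have not_single : ¬ (Single D a b' ∨ Single D b' a) := by
    intro hab'
    have hd := h.double_bc_of_link hS hl
    have hca := Link.of_double hd.symm h.ac.symm hab'.symm
    exact h.bc_ac (hl.sameClass_right.trans hca.sameClass_right)
  have := hS.single_or_single_or_double (h.ne_of_link hS hl)
  tauto

theorem link_of_link (hS : IsSemicomplete D) (h : Rainbow D a b c) (hl : Link D c b b') :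
    Link D a b b' :=
  Link.of_double h.ab (h.double_ab_of_link hS hl) (hl.single_or_single hS)

theorem of_link (hS : IsSemicomplete D) (h : Rainbow D a b c) (hl : Link D c b b') :
    Rainbow D a b' c where
  bc := h.double_bc_of_link hS hl
  ab := h.double_ab_of_link hS hl
  ac := h.ac
  bc_ac e := h.bc_ac (hl.sameClass_right.trans e)
  ab_ac e := h.ab_ac ((h.link_of_link hS hl).sameClass_left.trans e)
  bc_ba e := h.bc_ba
    (hl.sameClass_right.trans (e.trans (h.link_of_link hS hl).symm.sameClass_right))

/-- The analogue of Golumbic's triangle lemma for comparability graphs. -/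
theorem of_sameClass (hS : IsSemicomplete D) (h : Rainbow D a b c)
    (hq : SameClass D (b, c) q) :
    SameClass D (a, b) (a, q.1) ∧ SameClass D (a, c) (a, q.2) := by
  have closed : ForcingClosed D fun x y =>
      Rainbow D a x y ∧ SameClass D (a, b) (a, x) ∧ SameClass D (a, c) (a, y) :=
    ⟨fun hl ⟨h, hab, hac⟩ => ⟨(h.swap.of_link hS hl).swap, hab,
        hac.trans (h.swap.link_of_link hS hl).sameClass_left⟩,
      fun hl ⟨h, hab, hac⟩ => ⟨h.of_link hS hl,
        hab.trans (h.link_of_link hS hl).sameClass_left, hac⟩⟩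
  exact (closed.of_sameClass hq ⟨h, .refl (Or.inl h.ab.1), .refl (Or.inl h.ac.1)⟩).2

end Rainbow

end ImplicationClasses

section ClosedWalks

variable {V : Type*} {D : Digraph V} {T : V → V → Prop} {k : ℕ} {c : ℤ → V} {i j : ℤ}

/-- `T` has no cycles. -/
def Acyclic (T : V → V → Prop) : Prop := ∀ x, ¬ Relation.TransGen T x x

/-- `c 0, …, c k = c 0` is a closed walk of length `k`. The sequence is continued periodically over
the integers, so that a walk can be started anywhere and traversed backwards. -/
structure IsClosedWalk (T : V → V → Prop) (k : ℕ) (c : ℤ → V) : Prop where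
  pos : 0 < k
  periodic : Function.Periodic c k
  step : ∀ i, T (c i) (c (i + 1))

/-- A closed walk of minimal length. -/
structure IsShortest (T : V → V → Prop) (k : ℕ) (c : ℤ → V) : Prop
    extends IsClosedWalk T k c where
  min : ∀ m c', IsClosedWalk T m c' → k ≤ m

theorem isClosedWalk_of_segment (h : ∀ i : ℤ, 0 ≤ i → i < k → T (c i) (c (i + 1)))
    (h' : T (c k) (c 0)) : IsClosedWalk T (k + 1) fun i => c (i % (k + 1)) := by
  refine ⟨k.succ_pos, fun i => by simp, fun i => ?_⟩
  have hpos : (0 : ℤ) < k + 1 := by omega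
  have hnonneg := Int.emod_nonneg i hpos.ne'
  have hlt := Int.emod_lt_of_pos i hpos
  rcases eq_or_lt_of_le (Int.le_of_lt_add_one hlt) with hi | hi
  · have : (i + 1) % (k + 1) = 0 := by rw [← Int.emod_add_emod, hi, Int.emod_self]
    simpa only [this, hi] using h'
  · have : (i + 1) % (k + 1) = i % (k + 1) + 1 := by
      rw [← Int.emod_add_emod, Int.emod_eq_of_lt (by omega) (by omega)]
    simpa only [this] using h _ hnonneg hi

theorem exists_walk_of_reflTransGen {x y : V} (h : Relation.ReflTransGen T x y) :
    ∃ (k : ℕ) (c : ℤ → V), c 0 = x ∧ c k = y ∧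
      ∀ i : ℤ, 0 ≤ i → i < k → T (c i) (c (i + 1)) := by
  induction h with
  | refl => exact ⟨0, fun _ => x, rfl, rfl, fun i hi hi' => by omega⟩
  | @tail y z _ hyz ih =>
    obtain ⟨k, c, rfl, rfl, hc⟩ := ih
    refine ⟨k + 1, Function.update c (k + 1) z, Function.update_of_ne (by omega) _ _,
      by simp, fun i hi hik => ?_⟩
    rw [Function.update_of_ne (by omega)]
    rcases eq_or_ne i k with rfl | hne
    · simpa using hyz
    · rw [Function.update_of_ne (by omega)]
      exact hc i hi (by omega)

theorem exists_isShortest (h : ¬ Acyclic T) : ∃ k c, IsShortest T k c := by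
  classical
  have closed : ∃ k c, IsClosedWalk T k c := by
    simp only [Acyclic, not_forall, not_not] at h
    obtain ⟨x, h⟩ := h
    obtain ⟨y, hxy, hyx⟩ := Relation.TransGen.tail'_iff.1 h
    obtain ⟨k, c, rfl, rfl, hc⟩ := exists_walk_of_reflTransGen hxy
    exact ⟨k + 1, _, isClosedWalk_of_segment hc hyx⟩
  obtain ⟨c, hc⟩ := Nat.find_spec closed
  exact ⟨_, c, hc, fun m c' h' => Nat.find_min' closed ⟨c', h'⟩⟩

theorem IsClosedWalk.shift (h : IsClosedWalk T k c) (m : ℤ) :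
    IsClosedWalk T k fun i => c (m + i) :=
  ⟨h.pos, fun i => by simpa [add_assoc] using h.periodic (m + i),
    fun i => by simpa [add_assoc] using h.step (m + i)⟩

theorem IsClosedWalk.swap (h : IsClosedWalk T k c) :
    IsClosedWalk (fun x y => T y x) k fun i => c (-i) :=
  ⟨h.pos, fun i => by simpa [sub_eq_add_neg, add_comm] using h.periodic.sub_eq (-i),
    fun i => by simpa using h.step (-(i + 1))⟩

theorem IsClosedWalk.apply_add_emod (h : IsClosedWalk T k c) (i j : ℤ) :
    c (i + (j - i) % k) = c j := by
  rw [← h.periodic.int_mul ((j - i) / k), add_assoc, Int.cast_id, Int.emod_add_ediv_mul,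
    add_sub_cancel]

theorem IsClosedWalk.not_acyclic (h : IsClosedWalk T k c) : ¬ Acyclic T := by
  intro hA
  have walk : ∀ m : ℕ, Relation.TransGen T (c 0) (c (m + 1)) := by
    intro m
    induction m with
    | zero => exact .single (by simpa using h.step 0)
    | succ m ih => exact ih.tail (by simpa using h.step (m + 1))
  obtain ⟨m, rfl⟩ := Nat.exists_eq_add_one.2 h.pos
  have hper := h.periodic 0
  rw [zero_add, Nat.cast_add_one] at hper
  exact hA (c 0) (by simpa only [hper] using walk m)

namespace IsShortest

theorem shift (h : IsShortest T k c) (m : ℤ) : IsShortest T k fun i => c (m + i) :=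
  ⟨h.toIsClosedWalk.shift m, h.min⟩

theorem swap (h : IsShortest T k c) : IsShortest (fun x y => T y x) k fun i => c (-i) :=
  ⟨h.toIsClosedWalk.swap, fun m _ h' => h.min m _ h'.swap⟩

theorem not_back (h : IsShortest T k c) (hij : i ≤ j) (hk : j + 1 < i + k) :
    ¬ T (c j) (c i) := by
  intro hji
  obtain ⟨d, rfl⟩ := Int.le.dest hij
  have := h.min (d + 1) _ (isClosedWalk_of_segment (c := fun m => c (i + m))
    (fun m _ _ => (h.shift i).step m) (by simpa using hji))
  omega

theorem not_chord (h : IsShortest T k c) (hij : i + 2 ≤ j) (hk : j ≤ i + k) :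
    ¬ T (c i) (c j) := by
  rw [← h.periodic i]
  exact h.not_back hk (by omega)

theorem ne (h : IsShortest T k c) (hij : i < j) (hk : j < i + k) : c i ≠ c j := by
  intro e
  have hstep := h.step j
  rw [← e] at hstep
  rcases (show j + 1 ≤ i + k by omega).lt_or_eq with hlt | heq
  · exact h.not_chord (by omega) hlt.le hstep
  · rw [heq, h.periodic] at hstep
    have := h.min 1 (fun _ => c i) ⟨one_pos, fun _ => rfl, fun _ => hstep⟩
    omega

theorem three_le (h : IsShortest T k c) (hT : ∀ {x y}, T x y → ¬ T y x) : 3 ≤ k := by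
  have hpos := h.pos
  have h01 := h.step 0
  by_contra hlt
  obtain rfl | rfl : k = 1 ∨ k = 2 := by omega
  · have h10 := h.periodic 0
    simp only [Nat.cast_one, zero_add] at h01 h10
    rw [h10] at h01
    exact hT h01 h01
  · have h12 := h.step 1
    have h20 := h.periodic 0
    simp only [Nat.cast_ofNat, zero_add] at h01 h20
    rw [one_add_one_eq_two, h20] at h12
    exact hT h01 h12

theorem single_zero (h : IsShortest T k c) (hT : PartialOrientation D T)
    (h01 : Single D (c 0) (c 1)) {n : ℤ} (hnk : n < k)
    (hback : ∀ i, 1 ≤ i → i < n → ¬ Single D (c (i + 1)) (c i)) (hi : 1 ≤ i) (hin : i ≤ n) :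
    Single D (c 0) (c i) := by
  induction i, hi using Int.leInduction with
  | base => exact h01
  | succ i hi ih =>
    have h0i := ih (by omega)
    have hstep := h.step i
    have hchord : ¬ T (c 0) (c (i + 1)) := h.not_chord (by omega) (by omega)
    have := hT.asymm hstep
    have hnb := hback i hi (by omega)
    have hcases := (hT.cases_of_ne (hT.ne hstep)).imp_right (Or.resolve_left · hnb)
    rcases hT.cases_of_ne (h.ne (show 0 < i + 1 by omega) (by omega)) with h0 | h0 | h0
    · exact h0
    · rcases hcases with hs | hs
      · exact (hT.noSingleTriangle _ _ _ h0i hs h0).elim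
      · have := hT.iff_of_path hs h0 h0i
        grind
    · rcases hcases with hs | hs
      · have := hT.iff_of_path h0.symm h0i hs
        grind
      · have := hT.iff_of_double h0.symm hs.symm (Or.inl h0i)
        grind

theorem not_single_turn (h : IsShortest T k c) (hT : PartialOrientation D T) (hj : 1 ≤ j)
    (hjk : j + 1 < k) (h01 : Single D (c 0) (c 1))
    (hdouble : ∀ i, 1 ≤ i → i < j → Double D (c i) (c (i + 1))) :
    ¬ Single D (c (j + 1)) (c j) := by
  intro hback
  have h0j : Single D (c 0) (c j) :=
    h.single_zero hT h01 (show j < k by omega)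
      (fun i hi hij hs => hs.2 (hdouble i hi hij).1) hj le_rfl
  have hback' : Single D (c (j + 1)) (c 1) := by
    have hrev := h.swap.shift (-(j + 1))
    have := hrev.single_zero hT.swap (n := j) (i := j) (by simpa [add_comm] using hback)
      (by omega) (fun i hi hij hs => ?_) hj le_rfl
    · simpa [add_comm] using this
    · simp only [show -(-(j + 1) + i) = j - i + 1 by ring,
        show -(-(j + 1) + (i + 1)) = j - i by ring] at hs
      exact hs.2 (hdouble (j - i) (by omega) (by omega)).2
  have hstep : T (c 0) (c 1) := by simpa using h.step 0
  exact h.not_chord (by omega) (by omega) (hT.not_opposite_single h01 hback' h0j hback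
    (h.ne (by omega) (by omega)) hstep (h.step j) (h.not_back (by omega) (by omega))
    (h.not_back (by omega) (by omega)))

theorem exists_single_turn (h : IsShortest T k c) (hT : PartialOrientation D T)
    (hi : Single D (c i) (c (i + 1))) (hj : Single D (c (j + 1)) (c j)) :
    ∃ i d : ℤ, 1 ≤ d ∧ d < k ∧ Single D (c i) (c (i + 1)) ∧
      Single D (c (i + (d + 1))) (c (i + d)) ∧
      ∀ e, 1 ≤ e → e < d → Double D (c (i + e)) (c (i + (e + 1))) := by
  classical
  have hk := h.pos
  have hmod := Int.emod_nonneg (j - i) (show (k : ℤ) ≠ 0 by omega)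
  have turn : Single D (c (i + ((j - i) % k + 1))) (c (i + (j - i) % k)) := by
    have hsucc := (h.shift 1).apply_add_emod i j
    rwa [h.apply_add_emod, ← add_assoc, add_comm _ 1, hsucc, add_comm]
  have hex : ∃ (d : ℕ) (i : ℤ), Single D (c i) (c (i + 1)) ∧
      Single D (c (i + (d + 1))) (c (i + d)) :=
    ⟨((j - i) % k).toNat, i, hi, by rwa [Int.toNat_of_nonneg hmod]⟩
  have hmin : ∀ e < Nat.find hex, ∀ i, Single D (c i) (c (i + 1)) →
      ¬ Single D (c (i + (e + 1))) (c (i + e)) :=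
    fun e he i hf hb => Nat.find_min hex he ⟨i, hf, hb⟩
  obtain ⟨i', hfwd, hbwd⟩ := Nat.find_spec hex
  refine ⟨i', Nat.find hex, ?_, ?_, hfwd, hbwd, fun e he hed => ?_⟩
  · by_contra! hlt
    rw [show (Nat.find hex : ℤ) = 0 by omega, zero_add, add_zero] at hbwd
    exact hfwd.2 hbwd.1
  · have hle : Nat.find hex ≤ ((j - i) % k).toNat :=
      Nat.find_min' hex ⟨i, hi, by rwa [Int.toNat_of_nonneg hmod]⟩
    have := Int.emod_lt_of_pos (j - i) (show (0 : ℤ) < k by omega)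
    omega
  · lift e to ℕ using (by omega)
    rw [← add_assoc]
    rcases hT.cases_of_ne (hT.ne (h.step (i' + e))) with hs | hs | hs
    · refine (hmin (Nat.find hex - e) (by omega) (i' + e) hs ?_).elim
      rw [Nat.cast_sub (by omega)]
      convert hbwd using 2 <;> ring
    · exact (hmin e (by omega) i' hfwd (by rwa [← add_assoc])).elim
    · exact hs

/-- If a forward and the next backward single arc are at distance `k - 1`, then they are
consecutive in the opposite order, which is the case of distance `1` for the reversed digraph. -/
theorem not_single_and_reverse (h : IsShortest T k c) (hT : PartialOrientation D T)
    (hi : Single D (c i) (c (i + 1))) : ¬ Single D (c (j + 1)) (c j) := by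
  intro hj
  have hk := h.three_le hT.asymm
  obtain ⟨i, d, hd, hdk, hfwd, hbwd, hdouble⟩ := h.exists_single_turn hT hi hj
  rcases (Int.add_one_le_of_lt hdk).lt_or_eq with hlt | heq
  · exact (h.shift i).not_single_turn hT hd hlt (by simpa using hfwd) hdouble hbwd
  · have hprev : Single D (c i) (c (i - 1)) := by
      rw [heq, h.periodic, show i + d = i - 1 + k by omega, h.periodic] at hbwd
      exact hbwd
    have hfwd' : Single (reverse D) (c (i - 1 + (1 + 1))) (c (i - 1 + 1)) := by
      rw [sub_add_cancel, ← add_assoc, sub_add_cancel]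
      exact hfwd
    exact (h.shift (i - 1)).not_single_turn hT.reverse le_rfl (by omega)
      (by rw [single_reverse, sub_add_cancel, add_zero]; exact hprev) (by omega) hfwd'

theorem not_single (h : IsShortest T k c) (hT : PartialOrientation D T) :
    ¬ Single D (c 0) (c 1) := by
  intro h01
  have hback (j : ℤ) : ¬ Single D (c (j + 1)) (c j) :=
    h.not_single_and_reverse hT (i := 0) (by simpa using h01)
  have hk := h.three_le hT.asymm
  have hlast := h.single_zero hT h01 (n := k - 1) (i := k - 1) (by omega)
    (fun j _ _ => hback j) (by omega) le_rfl
  have hper := h.periodic (-1)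
  rw [neg_add_eq_sub] at hper
  rw [hper] at hlast
  exact hback (-1) (by simpa using hlast)

theorem double_succ (h : IsShortest T k c) (hT : PartialOrientation D T) (i : ℤ) :
    Double D (c i) (c (i + 1)) := by
  rcases hT.cases_of_ne (hT.ne (h.step i)) with hs | hs | hs
  · exact ((h.shift i).not_single hT (by simpa using hs)).elim
  · exact ((h.shift i).not_single hT.reverse (by simpa [single_reverse] using hs)).elim
  · exact hs

theorem double (h : IsShortest T k c) (hT : PartialOrientation D T) (hij : i < j)
    (hjk : j < i + k) : Double D (c i) (c j) := by
  induction j, Int.add_one_le_of_lt hij using Int.leInduction with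
  | base => exact h.double_succ hT i
  | succ j hj ih =>
    have hdij := (ih (by omega) (by omega)).symm
    have hdj := h.double_succ hT j
    have hback : ¬ T (c j) (c i) := h.not_back (by omega) (by omega)
    have hstep := h.step j
    rcases hT.cases_of_ne (h.ne hij hjk) with hs | hs | hs
    · have := hT.iff_of_double hdij hdj (Or.inl hs)
      grind
    · have := hT.iff_of_double hdij hdj (Or.inr hs)
      grind
    · exact hs

end IsShortest

end ClosedWalks

section Extension

variable {V : Type*} {D : Digraph V} {T : V → V → Prop} {p : V × V} {a b c u x y z : V}

/-- The set `T` of pairs together with the implication class of `p`. -/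
def addClass (D : Digraph V) (T : V → V → Prop) (p : V × V) (x y : V) : Prop :=
  T x y ∨ SameClass D p (x, y)

/-- Transitivity of the collected pairs implies no uncollected pair, so no class has priority. -/
def Stable (D : Digraph V) (T : V → V → Prop) : Prop := ∀ x y z, ¬ OpenPath D T x y z

theorem ForcingClosed.addClass (hT : ForcingClosed D T) (p : V × V) :
    ForcingClosed D (addClass D T p) :=
  hT.or (.sameClass D p)

theorem Uncollected.of_sameClass {q : V × V} (h : Uncollected D T p.1 p.2)
    (hT : ForcingClosed D T) (hpq : SameClass D p q) : Uncollected D T q.1 q.2 where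
  linked := (ForcingClosed.linked D).of_sameClass hpq h.linked
  not_forward := mt (hT.iff_of_sameClass hpq).2 h.not_forward
  not_backward := mt (hT.iff_of_sameClass hpq.swap).2 h.not_backward

theorem PartialOrientation.addClass (hT : PartialOrientation D T) (hD : NoSelfInverse D)
    (hp : Uncollected D T p.1 p.2) : PartialOrientation D (addClass D T p) where
  toForcingClosed := hT.toForcingClosed.addClass p
  semicomplete := hT.semicomplete
  noSingleTriangle := hT.noSingleTriangle
  asymm := by
    rintro x y (h | h) (h' | h')
    · exact hT.asymm h h'
    · exact (hp.of_sameClass hT.toForcingClosed h').not_backward h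
    · exact (hp.of_sameClass hT.toForcingClosed h).not_backward h'
    · exact hD x y (h.symm.trans h')
  linked := by
    rintro x y (h | h)
    · exact hT.linked h
    · exact (hp.of_sameClass hT.toForcingClosed h).linked

theorem OpenPath.rainbow (h : OpenPath D T x y z) (hT : PartialOrientation D T) :
    Rainbow D y x z where
  bc := h.double hT
  ab := (h.double_first hT).symm
  ac := h.double_second hT
  bc_ac e := h.not_forward ((hT.iff_of_sameClass e).2 h.second)
  ab_ac e := hT.asymm h.second ((hT.iff_of_sameClass e.flip).1 h.first)
  bc_ba e := h.not_forward ((hT.iff_of_sameClass e).2 h.first)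

theorem OpenPath.acyclic_addClass (h : OpenPath D T x y z) (hT : PartialOrientation D T)
    (hA : Acyclic T) : Acyclic (addClass D T (x, z)) := by
  have transGen_of_addClass (a b) (hab : addClass D T (x, z) a b) : Relation.TransGen T a b := by
    rcases hab with hab | hab
    · exact .single hab
    · obtain ⟨hyx, hyz⟩ := (h.rainbow hT).of_sameClass hT.semicomplete hab
      have hay : T a y := hT.of_sameClass hyx.flip h.first
      have hyb : T y b := hT.of_sameClass hyz h.second
      exact .tail (.single hay) hyb
  exact fun v hv => hA v (Relation.TransGen.lift' id transGen_of_addClass v v hv)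

theorem Link.of_double_not_linked (hl : Link D b c u) (hab : Double D a b) (hac : Double D a c)
    (hn : ¬ Linked D a c) : Link D b a u := by
  have hau : a ≠ u := by
    rintro rfl
    rcases hl.2 with h | h
    · exact h.2.2 hac.2
    · exact h.2.2 hac.1
  refine ⟨hau, hl.2.imp (fun h => ⟨hab.1, h.2.1, fun hau => ?_⟩)
    fun h => ⟨h.1, hab.2, fun hua => ?_⟩⟩
  · exact hn ⟨u, Or.inl ⟨hl.1, Or.inl ⟨hac.2, hau, h.2.2⟩⟩⟩
  · exact hn ⟨u, Or.inl ⟨hl.1, Or.inr ⟨hua, hac.1, h.2.2⟩⟩⟩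

theorem PartialOrientation.not_link_of_path (hT : PartialOrientation D T) (hab : T a b)
    (hbc : T b c) (hab' : Double D a b) (hac : Double D a c) (hn : ¬ Linked D a c) :
    ¬ Link D b c u := by
  intro hl
  have hba : T b a := hT.left (hl.of_double_not_linked hab' hac hn).symm (hT.left hl hbc)
  exact hT.asymm hab hba

namespace IsShortest

variable {k : ℕ} {c : ℤ → V} {j : ℤ}

theorem rainbow (h : IsShortest T k c) (hT : PartialOrientation D T) :
    Rainbow D (c 2) (c 0) (c 1) := by
  have hk := h.three_le hT.asymm
  have h01 : T (c 0) (c 1) := h.step 0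
  have h12 : T (c 1) (c 2) := h.step 1
  have h02 : ¬ T (c 0) (c 2) := h.not_chord (by omega) (by omega)
  exact {
    bc := h.double hT (by omega) (by omega)
    ab := (h.double hT (by omega) (by omega)).symm
    ac := (h.double hT (by omega) (by omega)).symm
    bc_ac := fun e => hT.asymm h12 (hT.of_sameClass e h01)
    ab_ac := fun e => h02 ((hT.iff_of_sameClass e.flip).2 h12)
    bc_ba := fun e => h02 (hT.of_sameClass e h01) }

theorem not_sameClass (h : IsShortest T k c) (hT : PartialOrientation D T) (hj : 1 ≤ j)
    (hjk : j < k) : ¬ SameClass D (c 0, c 1) (c j, c (j + 1)) := by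
  intro e
  have := h.three_le hT.asymm
  have h21 := ((h.rainbow hT).of_sameClass hT.semicomplete e).2
  have h12 : T (c 1) (c 2) := h.step 1
  have hback : T (c (j + 1)) (c 2) := hT.of_sameClass h21.flip h12
  rcases hj.eq_or_lt with rfl | hlt
  · exact hT.asymm hback hback
  · exact h.not_back (by omega) (by omega) hback

theorem linked_chord (h : IsShortest T k c) (hT : PartialOrientation D T) (hk : 4 ≤ k) :
    Linked D (c 1) (c 3) ∨ Linked D (c 2) (c 4) := by
  by_contra! ⟨h13, h24⟩
  have hdouble {i j : ℤ} (hij : i < j) (hji : j < i + 4) : Double D (c i) (c j) :=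
    h.double hT hij (by omega)
  have h12 : T (c 1) (c 2) := h.step 1
  have h23 : T (c 2) (c 3) := h.step 2
  have h34 : T (c 3) (c 4) := h.step 3
  obtain ⟨u, hu | hu⟩ := hT.linked h23
  · exact hT.not_link_of_path h12 h23 (hdouble (by omega) (by omega))
      (hdouble (by omega) (by omega)) h13 hu
  · exact hT.swap.not_link_of_path h34 h23 (hdouble (by omega) (by omega)).symm
      (hdouble (by omega) (by omega)).symm (mt Linked.symm h24) hu

end IsShortest

theorem Stable.acyclic_addClass (hs : Stable D T) (hT : PartialOrientation D T)
    (hD : NoSelfInverse D) (hA : Acyclic T) (hp : Uncollected D T p.1 p.2) :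
    Acyclic (addClass D T p) := by
  by_contra hcyc
  have hT' := hT.addClass hD hp
  obtain ⟨k, c, h, h01⟩ : ∃ k c, IsShortest (addClass D T p) k c ∧ SameClass D p (c 0, c 1) := by
    obtain ⟨k, c, h⟩ := exists_isShortest hcyc
    have hnew : ∃ i, SameClass D p (c i, c (i + 1)) := by
      by_contra! hno
      have hT_walk : IsClosedWalk T k c :=
        ⟨h.pos, h.periodic, fun i => (h.step i).resolve_right (hno i)⟩
      exact hT_walk.not_acyclic hA
    obtain ⟨i, hi⟩ := hnew
    exact ⟨k, _, h.shift i, by simpa using hi⟩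
  have hk := h.three_le hT'.asymm
  have hstep {j : ℤ} (hj : 1 ≤ j) (hjk : j < k) : T (c j) (c (j + 1)) :=
    (h.step j).resolve_right fun e => h.not_sameClass hT' hj hjk (h01.symm.trans e)
  have h12 : T (c 1) (c 2) := hstep le_rfl (by omega)
  have h23 : T (c 2) (c 3) := hstep (by omega) (by omega)
  obtain rfl | hk : k = 3 ∨ 4 ≤ k := by omega
  · have h30 : c 3 = c 0 := h.periodic 0
    have h01' := hp.of_sameClass hT.toForcingClosed h01
    exact hs _ _ _ ⟨⟨h01'.linked.symm, h01'.not_backward, h01'.not_forward⟩, h12, h30 ▸ h23⟩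
  have hopen {j : ℤ} (hj : 1 ≤ j) (hjk : j + 1 < k) : ¬ Linked D (c j) (c (j + 2)) := by
    intro hl
    have hnext : T (c (j + 1)) (c (j + 2)) := by
      simpa only [add_assoc, one_add_one_eq_two] using hstep (j := j + 1) (by omega) hjk
    exact hs _ _ _ ⟨⟨hl, fun e => h.not_chord le_rfl (by omega) (Or.inl e),
      fun e => h.not_back (by omega) (by omega) (Or.inl e)⟩, hstep hj (by omega), hnext⟩
  exact (h.linked_chord hT' hk).elim (hopen le_rfl (by omega)) (hopen (by omega) (by omega))

end Extension

section ComparabilityOrderings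

variable {V : Type*} {D : Digraph V} {T r : V → V → Prop} {x y z : V}

theorem Link.ne (hL : IsLoopless D) (h : Link D x y z) : x ≠ y := by
  rintro rfl
  have := hL x
  have := h.2
  tauto

theorem IsComparabilityOrdering.forcingClosed (h : IsComparabilityOrdering D r)
    (hL : IsLoopless D) : ForcingClosed D r := by
  have := h.1
  have hlink : ∀ {x y z}, Link D x y z → (r x y → r x z) ∧ (r y x → r z x) := by
    intro x y z hl
    have hyxz := h.2 y x z
    have hzxy := h.2 z x y
    have hxz : r x z ∨ r z x := by
      have := trichotomous_of r x z
      have := hl.symm.ne hL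
      tauto
    have := hl.2
    tauto
  exact ⟨fun hl => (hlink hl).1, fun hl => (hlink hl).2⟩

theorem SameClass.ne (hL : IsLoopless D) {p q : V × V} (h : SameClass D p q) : p.1 ≠ p.2 := by
  intro e
  rcases h.mem_pairs_left with h | h <;> rw [e] at h <;> exact hL _ h

theorem IsComparability.noSelfInverse (h : IsComparability D) (hL : IsLoopless D) :
    NoSelfInverse D := by
  obtain ⟨r, hr⟩ := h
  intro x y e
  have := hr.1
  have hiff : r x y ↔ r y x := (hr.forcingClosed hL).iff_of_sameClass e
  rcases trichotomous_of r x y with h | h | h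
  · exact asymm_of r h (hiff.1 h)
  · exact e.ne hL h
  · exact asymm_of r h (hiff.2 h)

theorem isComparabilityOrdering_of_extends (hT : ForcingClosed D T)
    (hr : IsStrictTotalOrder V r) (hTr : ∀ x y, T x y → r x y)
    (hmax : ∀ x y, Linked D x y → T x y ∨ T y x) : IsComparabilityOrdering D r := by
  have not_link : ∀ x y z, r x y → r y z → ¬ Link D y x z := by
    intro x y z hxy hyz hl
    rcases hmax y x ⟨z, Or.inl hl⟩ with h | h
    · exact asymm_of r hxy (hTr _ _ h)
    · exact asymm_of r hyz (hTr _ _ (hT.right hl h))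
  refine ⟨hr, fun x y z hxy hyz => ?_⟩
  have hxz : x ≠ z := by
    rintro rfl
    exact asymm_of r hxy hyz
  exact ⟨fun h h' => by_contra fun hn => not_link x y z hxy hyz ⟨hxz, Or.inl ⟨h, h', hn⟩⟩,
    fun h h' => by_contra fun hn => not_link x y z hxy hyz ⟨hxz, Or.inr ⟨h, h', hn⟩⟩⟩

end ComparabilityOrderings

section Execution

variable {V : Type*} {D : Digraph V} {T T' : V → V → Prop} {p q : V × V} {x y : V}

theorem SameClass.eq_of_not_linked (e : SameClass D p q) (h : ¬ Linked D p.1 p.2) : p = q := by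
  have closed : ForcingClosed D fun x y => p = (x, y) :=
    ⟨fun hl => by rintro rfl; exact (h ⟨_, Or.inl hl⟩).elim,
      fun hl => by rintro rfl; exact (h ⟨_, Or.inr hl⟩).elim⟩
  exact closed.of_sameClass e rfl

theorem Linked.mem_pairs (h : Linked D x y) : (x, y) ∈ pairs D := by
  obtain ⟨u, h | h⟩ := h
  · exact h.sameClass_left.mem_pairs_left
  · exact h.sameClass_right.mem_pairs_left

theorem one_lt_encard_implicationClass (hp : p ∈ pairs D) :
    1 < (implicationClass D p).encard ↔ Linked D p.1 p.2 := by
  rw [Set.one_lt_encard_iff]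
  constructor
  · rintro ⟨a, b, ha, hb, hab⟩
    by_contra h
    exact hab ((SameClass.eq_of_not_linked ha h).symm.trans (SameClass.eq_of_not_linked hb h))
  · rintro ⟨u, h | h⟩
    · exact ⟨p, (p.1, u), SameClass.refl hp, h.sameClass_left, fun e => h.1 (congrArg Prod.snd e)⟩
    · exact ⟨p, (u, p.2), SameClass.refl hp, h.sameClass_right, fun e => h.1 (congrArg Prod.fst e)⟩

theorem SameClass.implicationClass_eq (h : SameClass D p q) :
    implicationClass D p = implicationClass D q :=
  Set.ext fun _ => ⟨fun e => h.symm.trans e, fun e => h.trans e⟩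

theorem inverse_implicationClass (p : V × V) :
    inverse (implicationClass D p) = implicationClass D p.swap :=
  Set.ext fun q => ⟨fun e => SameClass.swap (q := q.swap) e, fun e => SameClass.swap e⟩

theorem firstTest_iff : FirstTest D ↔ ∃ x y, SameClass D (x, y) (y, x) := by
  constructor
  · rintro ⟨I, ⟨p, hp, rfl⟩, h⟩
    have : p ∈ inverse (implicationClass D p) := h ▸ SameClass.refl hp
    exact ⟨p.1, p.2, this⟩
  · rintro ⟨x, y, h⟩
    refine ⟨_, ⟨(x, y), h.mem_pairs_left, rfl⟩, ?_⟩
    rw [inverse_implicationClass]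
    exact h.implicationClass_eq

theorem not_firstTest_iff : ¬ FirstTest D ↔ NoSelfInverse D := by
  simp only [firstTest_iff, not_exists, NoSelfInverse]

/-- The state of the loop when the set `T` has been collected. -/
def stateOf (D : Digraph V) (T : V → V → Prop) : LoopState V where
  T := {p | T p.1 p.2}
  remaining := {I | ∃ p : V × V, Uncollected D T p.1 p.2 ∧ I = implicationClass D p}

theorem init_eq_stateOf : LoopState.init D = stateOf D fun _ _ => False := by
  have : {I ∈ implicationClasses D | 1 < I.encard} = (stateOf D fun _ _ => False).remaining := by
    ext I
    constructor
    · rintro ⟨⟨p, hp, rfl⟩, h⟩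
      exact ⟨p, ⟨(one_lt_encard_implicationClass hp).1 h, id, id⟩, rfl⟩
    · rintro ⟨p, h, rfl⟩
      have hp := h.linked.mem_pairs
      exact ⟨⟨p, hp, rfl⟩, (one_lt_encard_implicationClass hp).2 h.linked⟩
  rw [LoopState.init, this]
  rfl

/-- The properties of the set of collected pairs that the loop maintains. The first test need not
have been carried out: a class that equals its inverse makes both orientations of its pairs appear
in `T`. -/
structure LoopInvariant (D : Digraph V) (T : V → V → Prop) : Prop
    extends ForcingClosed D T where
  linked : ∀ {x y}, T x y → Linked D x y
  conflict : ∀ {x y}, T x y → T y x → SameClass D (x, y) (y, x)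
  acyclic : NoSelfInverse D → Acyclic T

/-- One pass through the loop body, in terms of the collected pairs: the class of an uncollected
pair is added, and this pair is implied by transitivity if some uncollected pair is. -/
def CollectStep (D : Digraph V) (T T' : V → V → Prop) : Prop :=
  ∃ p : V × V, Uncollected D T p.1 p.2 ∧ ((∃ y, T p.1 y ∧ T y p.2) ∨ Stable D T) ∧
    T' = addClass D T p

theorem loopInvariant_empty : LoopInvariant D fun _ _ => False where
  left _ := id
  right _ := id
  linked := False.elim
  conflict := False.elim
  acyclic _ _ h := (Relation.TransGen.head'_iff.1 h).elim fun _ h => h.1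

theorem LoopInvariant.partialOrientation (hT : LoopInvariant D T) (hS : IsSemicomplete D)
    (hD : NoSelfInverse D) : PartialOrientation D T where
  toForcingClosed := hT.toForcingClosed
  semicomplete := hS
  noSingleTriangle := hD.noSingleTriangle
  asymm h h' := hD _ _ (hT.conflict h h')
  linked := hT.linked

theorem LoopInvariant.collectStep (hT : LoopInvariant D T) (hS : IsSemicomplete D)
    (h : CollectStep D T T') : LoopInvariant D T' := by
  obtain ⟨p, hp, hchoice, rfl⟩ := h
  refine ⟨hT.toForcingClosed.addClass p, ?_, ?_, fun hD => ?_⟩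
  · rintro x y (h | h)
    · exact hT.linked h
    · exact (hp.of_sameClass hT.toForcingClosed h).linked
  · rintro x y (h | h) (h' | h')
    · exact hT.conflict h h'
    · exact ((hp.of_sameClass hT.toForcingClosed h').not_backward h).elim
    · exact ((hp.of_sameClass hT.toForcingClosed h).not_backward h').elim
    · exact h.symm.trans h'
  · have hT' := hT.partialOrientation hS hD
    rcases hchoice with ⟨y, hfirst, hsecond⟩ | hs
    · exact (OpenPath.mk hp hfirst hsecond).acyclic_addClass hT' (hT.acyclic hD)
    · exact hs.acyclic_addClass hT' hD (hT.acyclic hD) hp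

theorem Stable.not_hasPriority (hs : Stable D T) (hT : ForcingClosed D T)
    {I : Set (V × V)} (hI : I ∈ (stateOf D T).remaining) : ¬ HasPriority (stateOf D T).T I := by
  obtain ⟨p, hp, rfl⟩ := hI
  rintro ⟨x, y, z, hxy, hyz, e⟩
  exact hs x y z ⟨hp.of_sameClass hT e, hxy, hyz⟩

theorem remaining_stateOf_addClass (p : V × V) :
    (stateOf D (addClass D T p)).remaining =
      (stateOf D T).remaining \ {implicationClass D p, inverse (implicationClass D p)} := by
  ext J
  rw [inverse_implicationClass]
  constructor
  · rintro ⟨q, ⟨hl, hfwd, hbwd⟩, rfl⟩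
    refine ⟨⟨q, ⟨hl, fun h => hfwd (Or.inl h), fun h => hbwd (Or.inl h)⟩, rfl⟩, ?_⟩
    have hq : q ∈ implicationClass D q := SameClass.refl hl.mem_pairs
    rintro (e | e)
    · rw [e] at hq
      exact hfwd (Or.inr hq)
    · rw [e] at hq
      exact hbwd (Or.inr (SameClass.swap hq))
  · rintro ⟨⟨q, ⟨hl, hfwd, hbwd⟩, rfl⟩, hne⟩
    refine ⟨q, ⟨hl, not_or_intro hfwd fun h => ?_, not_or_intro hbwd fun h => ?_⟩, rfl⟩
    · exact hne (Or.inl h.symm.implicationClass_eq)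
    · exact hne (Or.inr h.swap.symm.implicationClass_eq)

theorem CollectStep.loopStep (h : CollectStep D T T') (hT : ForcingClosed D T) :
    LoopStep (stateOf D T) (stateOf D T') := by
  obtain ⟨p, hp, hchoice, rfl⟩ := h
  refine ⟨implicationClass D p, ⟨p, hp, rfl⟩, ?_, ?_⟩
  · rcases hchoice with ⟨y, hfirst, hsecond⟩ | hs
    · exact Or.inl ⟨p.1, y, p.2, hfirst, hsecond, SameClass.refl hp.linked.mem_pairs⟩
    · exact Or.inr fun ⟨J, hJ, hprio⟩ => hs.not_hasPriority hT hJ hprio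
  · rw [← remaining_stateOf_addClass]
    rfl

theorem LoopInvariant.conflict_iff (hT : LoopInvariant D T) (hL : IsLoopless D)
    (hmax : ∀ x y, Linked D x y → T x y ∨ T y x) :
    (∃ x y, T x y ∧ T y x) ↔ FirstTest D := by
  rw [firstTest_iff]
  constructor
  · rintro ⟨x, y, h, h'⟩
    exact ⟨x, y, hT.conflict h h'⟩
  · rintro ⟨x, y, e⟩
    have hl : Linked D x y := by
      by_contra hl
      exact e.ne hL (Prod.mk.inj (e.eq_of_not_linked hl)).1
    have hiff : T x y ↔ T y x := hT.iff_of_sameClass e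
    exact ⟨x, y, by have := hmax x y hl; tauto⟩

theorem loopInvariant_of_collectStep (hS : IsSemicomplete D) {k : ℕ} {S : ℕ → V → V → Prop}
    (hinit : S 0 = fun _ _ => False) (hstep : ∀ i < k, CollectStep D (S i) (S (i + 1))) {i : ℕ}
    (hi : i ≤ k) : LoopInvariant D (S i) := by
  induction i with
  | zero => exact hinit ▸ loopInvariant_empty
  | succ i ih => exact (ih (by omega)).collectStep hS (hstep i (by omega))

theorem isLoopExecution_of_collectStep (hS : IsSemicomplete D) {k : ℕ} {S : ℕ → V → V → Prop}
    (hinit : S 0 = fun _ _ => False) (hstep : ∀ i < k, CollectStep D (S i) (S (i + 1)))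
    (hmax : ∀ x y, Linked D x y → S k x y ∨ S k y x) :
    IsLoopExecution D k fun i => stateOf D (S i) := by
  refine ⟨?_, fun i hi => (hstep i hi).loopStep
    (loopInvariant_of_collectStep hS hinit hstep hi.le).toForcingClosed, ?_⟩
  · simp only [hinit, init_eq_stateOf]
  · rw [Set.eq_empty_iff_forall_notMem]
    rintro I ⟨p, hp, -⟩
    exact (hmax p.1 p.2 hp.linked).elim hp.not_forward hp.not_backward

end Execution

end ComparabilityDigraph

namespace RAM

/-! ### Total correctness of programs, with time bounds -/

section Reaches

variable {B t t₁ t₂ : ℕ} {σ σ' : Store} {c c₁ c₂ : Config}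

/-- All registers and memory cells hold numbers up to `B`. -/
def Store.Bounded (B : ℕ) (σ : Store) : Prop := (∀ i, σ.reg i ≤ B) ∧ ∀ i, σ.mem i ≤ B

@[simp] theorem Store.setReg_reg (σ : Store) (r v i : ℕ) :
    (σ.setReg r v).reg i = if i = r then v else σ.reg i :=
  Function.update_apply ..

@[simp] theorem Store.setReg_mem (σ : Store) (r v : ℕ) : (σ.setReg r v).mem = σ.mem := rfl

@[simp] theorem Store.setMem_reg (σ : Store) (a v : ℕ) : (σ.setMem a v).reg = σ.reg := rfl

@[simp] theorem Store.setMem_mem (σ : Store) (a v : ℕ) :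
    (σ.setMem a v).mem = Function.update σ.mem a v := rfl

theorem Store.Bounded.setReg (h : σ.Bounded B) {r v : ℕ} (hv : v ≤ B) :
    (σ.setReg r v).Bounded B := by
  refine ⟨fun i => ?_, h.2⟩
  rw [Store.setReg_reg]
  split_ifs
  exacts [hv, h.1 i]

theorem Store.Bounded.setMem (h : σ.Bounded B) {a v : ℕ} (hv : v ≤ B) :
    (σ.setMem a v).Bounded B := by
  refine ⟨h.1, fun i => ?_⟩
  rw [Store.setMem_mem, Function.update_apply]
  split_ifs
  exacts [hv, h.2 i]

/-- The machine gets from the configuration `c` to `c'` in exactly `t` steps, and all stores on the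
way are bounded by `B`. -/
def Reaches (B : ℕ) (c : Config) (t : ℕ) (c' : Config) : Prop :=
  step^[t] c = c' ∧ ∀ u ≤ t, (step^[u] c).store.Bounded B

theorem Reaches.refl (h : c.store.Bounded B) : Reaches B c 0 c :=
  ⟨rfl, fun u hu => by rwa [Nat.le_zero.1 hu]⟩

theorem Reaches.bounded (h : Reaches B c t c₁) : c₁.store.Bounded B := h.1 ▸ h.2 t le_rfl

theorem Reaches.trans (h₁ : Reaches B c t₁ c₁) (h₂ : Reaches B c₁ t₂ c₂) :
    Reaches B c (t₁ + t₂) c₂ := by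
  have hadd : ∀ u, step^[t₁ + u] c = step^[u] c₁ := fun u => by
    rw [add_comm, Function.iterate_add_apply, h₁.1]
  refine ⟨(hadd t₂).trans h₂.1, fun u hu => ?_⟩
  rcases le_total u t₁ with h | h
  · exact h₁.2 u h
  · obtain ⟨v, rfl⟩ := Nat.exists_eq_add_of_le h
    exact hadd v ▸ h₂.2 v (Nat.le_of_add_le_add_left hu)

theorem Reaches.of_step (hc : c.store.Bounded B) (h : step c = c₁) (hc₁ : c₁.store.Bounded B) :
    Reaches B c 1 c₁ := by
  refine ⟨h, fun u hu => ?_⟩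
  rcases Nat.le_one_iff_eq_zero_or_eq_one.1 hu with rfl | rfl
  exacts [hc, (congrArg Config.store h).symm ▸ hc₁]

theorem Reaches.bounded_of_halted (h : Reaches B c t c₁) (hc₁ : c₁.Halted) (u : ℕ) :
    (step^[u] c).store.Bounded B := by
  rcases le_total u t with hu | hu
  · exact h.2 u hu
  · obtain ⟨todo, σ⟩ := c₁
    obtain rfl : todo = [] := hc₁
    obtain ⟨v, rfl⟩ := Nat.exists_eq_add_of_le hu
    rw [add_comm, Function.iterate_add_apply, h.1, Function.iterate_fixed rfl]
    exact h.bounded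

/-- From the store `σ`, the statement `s` takes `t` steps to the store `σ'`, whatever is to be
executed afterwards. -/
def Exec (B : ℕ) (s : Stmt) (σ : Store) (t : ℕ) (σ' : Store) : Prop :=
  ∀ K, Reaches B ⟨s :: K, σ⟩ t ⟨K, σ'⟩

theorem Exec.bounded {s : Stmt} (h : Exec B s σ t σ') : σ'.Bounded B := (h []).bounded

theorem Exec.atomic {s : Stmt} (hσ : σ.Bounded B) (hσ' : σ'.Bounded B)
    (h : ∀ K, step ⟨s :: K, σ⟩ = ⟨K, σ'⟩) : Exec B s σ 1 σ' :=
  fun K => .of_step hσ (h K) hσ'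

theorem Exec.seq {s₁ s₂ : Stmt} {σ₁ : Store} (hσ : σ.Bounded B) (h₁ : Exec B s₁ σ t₁ σ₁)
    (h₂ : Exec B s₂ σ₁ t₂ σ') : Exec B (.seq s₁ s₂) σ (1 + t₁ + t₂) σ' :=
  fun K => ((Reaches.of_step hσ rfl hσ).trans (h₁ (s₂ :: K))).trans (h₂ K)

theorem Exec.of_step {s s' : Stmt} (hσ : σ.Bounded B) (h : Exec B s σ t σ')
    (hs : ∀ K, step ⟨s' :: K, σ⟩ = ⟨s :: K, σ⟩) : Exec B s' σ (1 + t) σ' :=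
  fun K => (Reaches.of_step hσ (hs K) hσ).trans (h K)

end Reaches

section Frame

variable {B t r : ℕ} {σ σ' : Store}

/-- The registers that a statement may change. -/
def Stmt.writes : Stmt → List ℕ
  | .skip => []
  | .const r _ => [r]
  | .move r _ => [r]
  | .add r _ _ => [r]
  | .sub r _ _ => [r]
  | .mul r _ _ => [r]
  | .load r _ => [r]
  | .store _ _ => []
  | .seq s₁ s₂ => s₁.writes ++ s₂.writes
  | .ite _ s₁ s₂ => s₁.writes ++ s₂.writes
  | .loop _ s => s.writes

theorem step_todo_of_notMem_writes {c : Config} (h : ∀ s ∈ c.todo, r ∉ s.writes) :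
    ∀ s ∈ (step c).todo, r ∉ s.writes := by
  obtain ⟨_ | ⟨s, K⟩, σ⟩ := c
  · exact h
  have ⟨hs, hK⟩ := List.forall_mem_cons.1 h
  cases s with
  | seq s₁ s₂ =>
    rw [Stmt.writes, List.mem_append, not_or] at hs
    exact List.forall_mem_cons.2 ⟨hs.1, List.forall_mem_cons.2 ⟨hs.2, hK⟩⟩
  | ite t s₁ s₂ =>
    rw [Stmt.writes, List.mem_append, not_or] at hs
    refine List.forall_mem_cons.2 ⟨?_, hK⟩
    split_ifs
    exacts [hs.1, hs.2]
  | loop t s =>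
    rw [step]
    split_ifs
    exacts [List.forall_mem_cons.2 ⟨hs, h⟩, hK]
  | _ => exact hK

theorem step_reg_of_notMem_writes {c : Config} (h : ∀ s ∈ c.todo, r ∉ s.writes) :
    (step c).store.reg r = c.store.reg r := by
  obtain ⟨_ | ⟨s, K⟩, σ⟩ := c
  · rfl
  have hs : r ∉ s.writes := h s List.mem_cons_self
  cases s with
  | skip | store _ _ | seq _ _ | ite _ _ _ | loop _ _ => rfl
  | _ =>
    rw [Stmt.writes, List.mem_singleton] at hs
    exact (Store.setReg_reg ..).trans (if_neg hs)

theorem Exec.frame {s : Stmt} (h : Exec B s σ t σ') (hr : r ∉ s.writes) : σ'.reg r = σ.reg r := by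
  have hiter : ∀ u, (∀ s' ∈ (step^[u] ⟨[s], σ⟩).todo, r ∉ s'.writes) ∧
      (step^[u] ⟨[s], σ⟩).store.reg r = σ.reg r := by
    intro u
    induction u with
    | zero => exact ⟨List.forall_mem_singleton.2 hr, rfl⟩
    | succ u ih =>
      rw [Function.iterate_succ_apply']
      exact ⟨step_todo_of_notMem_writes ih.1, (step_reg_of_notMem_writes ih.1).trans ih.2⟩
  have := (hiter t).2
  rwa [(h []).1] at this

end Frame

section Hoare

variable {B : ℕ} {b : Test} {s s₁ s₂ : Stmt} {σ : Store} {Q Q' : ℕ → Store → Prop}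

/-- Total correctness with a time bound: started in the store `σ`, the statement `s` terminates
after some number `t` of steps in a store `σ'` with `Q t σ'`, and all numbers stay at most `B`. -/
def Ok (B : ℕ) (s : Stmt) (σ : Store) (Q : ℕ → Store → Prop) : Prop :=
  σ.Bounded B → ∃ t σ', Q t σ' ∧ Exec B s σ t σ'

theorem Ok.imp (h : Ok B s σ Q)
    (hQ : ∀ t σ', σ'.Bounded B → (∀ r, r ∉ s.writes → σ'.reg r = σ.reg r) → Q t σ' → Q' t σ') :
    Ok B s σ Q' := by
  intro hσ
  obtain ⟨t, σ', hQt, hexec⟩ := h hσ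
  exact ⟨t, σ', hQ t σ' hexec.bounded (fun _ => hexec.frame) hQt, hexec⟩

theorem Ok.skip (h : Q 1 σ) : Ok B .skip σ Q :=
  fun hσ => ⟨1, σ, h, .atomic hσ hσ fun _ => rfl⟩

theorem Ok.seq (h : Ok B s₁ σ fun t₁ σ₁ => Ok B s₂ σ₁ fun t₂ σ₂ => Q (1 + t₁ + t₂) σ₂) :
    Ok B (.seq s₁ s₂) σ Q := by
  intro hσ
  obtain ⟨t₁, σ₁, h₁, hexec₁⟩ := h hσ
  obtain ⟨t₂, σ₂, h₂, hexec₂⟩ := h₁ hexec₁.bounded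
  exact ⟨_, σ₂, h₂, hexec₁.seq hσ hexec₂⟩

theorem Ok.ite (htrue : b.eval σ = true → Ok B s₁ σ fun t σ' => Q (1 + t) σ')
    (hfalse : b.eval σ = false → Ok B s₂ σ fun t σ' => Q (1 + t) σ') : Ok B (.ite b s₁ s₂) σ Q := by
  intro hσ
  cases hb : b.eval σ with
  | true =>
    obtain ⟨t, σ', hQ, hexec⟩ := htrue hb hσ
    exact ⟨_, σ', hQ, hexec.of_step hσ fun K => by rw [step, if_pos hb]⟩
  | false =>
    obtain ⟨t, σ', hQ, hexec⟩ := hfalse hb hσ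
    exact ⟨_, σ', hQ, hexec.of_step hσ fun K => by rw [step, if_neg (by rw [hb]; decide)]⟩

/-- A precondition that makes `s` terminate with postcondition `Q`, computed by recursion on `s`;
at a loop, the recursion stops. -/
def wp (B : ℕ) : Stmt → (ℕ → Store → Prop) → Store → Prop
  | .skip, Q, σ => Q 1 σ
  | .const r k, Q, σ => k ≤ B ∧ Q 1 (σ.setReg r k)
  | .move r a, Q, σ => Q 1 (σ.setReg r (σ.reg a))
  | .add r a b, Q, σ => σ.reg a + σ.reg b ≤ B ∧ Q 1 (σ.setReg r (σ.reg a + σ.reg b))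
  | .sub r a b, Q, σ => Q 1 (σ.setReg r (σ.reg a - σ.reg b))
  | .mul r a b, Q, σ => σ.reg a * σ.reg b ≤ B ∧ Q 1 (σ.setReg r (σ.reg a * σ.reg b))
  | .load r a, Q, σ => Q 1 (σ.setReg r (σ.mem (σ.reg a)))
  | .store a b, Q, σ => Q 1 (σ.setMem (σ.reg a) (σ.reg b))
  | .seq s₁ s₂, Q, σ => wp B s₁ (fun t₁ σ₁ => wp B s₂ (fun t₂ σ₂ => Q (1 + t₁ + t₂) σ₂) σ₁) σ
  | .ite b s₁ s₂, Q, σ => (b.eval σ = true → wp B s₁ (fun t σ' => Q (1 + t) σ') σ) ∧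
      (b.eval σ = false → wp B s₂ (fun t σ' => Q (1 + t) σ') σ)
  | .loop b s, Q, σ => Ok B (.loop b s) σ Q

theorem Ok.of_wp (h : wp B s Q σ) : Ok B s σ Q := by
  induction s generalizing Q σ with
  | skip => exact .skip h
  | const r k => exact fun hσ => ⟨1, _, h.2, .atomic hσ (hσ.setReg h.1) fun _ => rfl⟩
  | move r a => exact fun hσ => ⟨1, _, h, .atomic hσ (hσ.setReg (hσ.1 a)) fun _ => rfl⟩
  | add r a b => exact fun hσ => ⟨1, _, h.2, .atomic hσ (hσ.setReg h.1) fun _ => rfl⟩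
  | sub r a b =>
    exact fun hσ => ⟨1, _, h, .atomic hσ (hσ.setReg ((Nat.sub_le _ _).trans (hσ.1 a))) fun _ => rfl⟩
  | mul r a b => exact fun hσ => ⟨1, _, h.2, .atomic hσ (hσ.setReg h.1) fun _ => rfl⟩
  | load r a => exact fun hσ => ⟨1, _, h, .atomic hσ (hσ.setReg (hσ.2 _)) fun _ => rfl⟩
  | store a b => exact fun hσ => ⟨1, _, h, .atomic hσ (hσ.setMem (hσ.1 b)) fun _ => rfl⟩
  | seq s₁ s₂ ih₁ ih₂ => exact .seq ((ih₁ h).imp fun _ _ _ _ h => ih₂ h)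
  | ite b s₁ s₂ ih₁ ih₂ => exact .ite (fun hb => ih₁ (h.1 hb)) fun hb => ih₂ (h.2 hb)
  | loop b s => exact h

end Hoare

section Loops

variable {B : ℕ} {b : Test} {s : Stmt} {σ : Store}

/-- The first `m` passes of a loop lead through the stores `ss 0, …, ss m`, where the loop is left;
the store `ss i` is reached after `time i` steps. -/
structure LoopTrace (B : ℕ) (b : Test) (s : Stmt) (m : ℕ) (ss : ℕ → Store) (time : ℕ → ℕ) :
    Prop where
  reaches : ∀ i ≤ m, ∀ K, Reaches B ⟨.loop b s :: K, ss 0⟩ (time i) ⟨.loop b s :: K, ss i⟩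
  time_lt : ∀ i < m, time i < time (i + 1)
  exit : b.eval (ss m) = false

theorem LoopTrace.bounded {m : ℕ} {ss : ℕ → Store} {time : ℕ → ℕ}
    (h : LoopTrace B b s m ss time) : (ss m).Bounded B :=
  (h.reaches m le_rfl []).bounded

theorem LoopTrace.exec {m : ℕ} {ss : ℕ → Store} {time : ℕ → ℕ} (h : LoopTrace B b s m ss time) :
    Exec B (.loop b s) (ss 0) (time m + 1) (ss m) := fun K =>
  (h.reaches m le_rfl K).trans <|
    .of_step h.bounded (by rw [step, if_neg (by rw [h.exit]; decide)]) h.bounded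

theorem LoopTrace.of_passes {m : ℕ} {ss : ℕ → Store} {duration : ℕ → ℕ} (h0 : (ss 0).Bounded B)
    (hpass : ∀ i < m, b.eval (ss i) = true ∧ Exec B s (ss i) (duration i) (ss (i + 1)))
    (hexit : b.eval (ss m) = false) :
    LoopTrace B b s m ss fun i => ∑ j ∈ Finset.range i, (1 + duration j) where
  exit := hexit
  time_lt i _ := by
    rw [Finset.sum_range_succ]
    omega
  reaches i hi K := by
    induction i with
    | zero => exact .refl h0
    | succ i ih =>
      obtain ⟨hb, hexec⟩ := hpass i hi
      have hreach := ih (by omega)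
      have henter : step ⟨.loop b s :: K, ss i⟩ = ⟨s :: .loop b s :: K, ss i⟩ := by
        rw [step, if_pos hb]
      rw [Finset.sum_range_succ]
      exact hreach.trans <| .trans (.of_step hreach.bounded henter hreach.bounded) (hexec _)

theorem exists_iterate_exit {α : Type*} {done : α → Prop} {P : α → Prop} {next : α → α}
    {cost W : α → ℕ} {Wmax : ℕ} (hW : ∀ a, P a → W a ≤ Wmax)
    (hnext : ∀ a, P a → ¬ done a → P (next a) ∧ W a + cost a + 1 ≤ W (next a)) {a : α} (ha : P a) :
    ∃ m, done (next^[m] a) ∧ (∀ i < m, P (next^[i] a) ∧ ¬ done (next^[i] a)) ∧ P (next^[m] a) ∧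
      W a + ∑ j ∈ Finset.range m, (1 + cost (next^[j] a)) ≤ W (next^[m] a) := by
  induction hd : Wmax - W a using Nat.strong_induction_on generalizing a with
  | _ d ih =>
    by_cases hdone : done a
    · exact ⟨0, hdone, by simp, ha, by simp⟩
    · obtain ⟨hP, hle⟩ := hnext a ha hdone
      have hWnext := hW _ hP
      obtain ⟨m, hm, hbefore, hPm, hsum⟩ := ih _ (by omega) hP rfl
      refine ⟨m + 1, hm, fun i hi => ?_, hPm, ?_⟩
      · rcases i with _ | i
        exacts [⟨ha, hdone⟩, hbefore i (Nat.lt_of_succ_lt_succ hi)]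
      · rw [Finset.sum_range_succ']
        simp only [Function.iterate_succ_apply, Function.iterate_zero_apply]
        omega

/-- Each pass raises the potential `W` by at least its running time. -/
theorem exists_loopTrace (Inv : Store → Prop) (W : Store → ℕ) (R : Store → Store → Prop)
    (Wmax : ℕ) (hW : ∀ τ, Inv τ → W τ ≤ Wmax)
    (hstep : ∀ τ, Inv τ → b.eval τ = true →
      Ok B s τ fun t τ' => Inv τ' ∧ R τ τ' ∧ W τ + t + 1 ≤ W τ')
    (hσ : σ.Bounded B) (hinit : Inv σ) :
    ∃ (m : ℕ) (ss : ℕ → Store) (time : ℕ → ℕ), ss 0 = σ ∧ LoopTrace B b s m ss time ∧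
      (∀ i < m, R (ss i) (ss (i + 1))) ∧ Inv (ss m) ∧ W σ + time m ≤ W (ss m) := by
  have : Nonempty Store := ⟨σ⟩
  have hpass : ∀ τ, (Inv τ ∧ τ.Bounded B) ∧ b.eval τ ≠ false → ∃ t τ',
      (Inv τ' ∧ R τ τ' ∧ W τ + t + 1 ≤ W τ') ∧ Exec B s τ t τ' := fun τ h =>
    hstep τ h.1.1 (Bool.eq_true_of_not_eq_false h.2) h.1.2
  choose! duration next hnext hexec using hpass
  obtain ⟨m, hexit, hbefore, ⟨hInv, -⟩, hle⟩ := exists_iterate_exit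
    (done := fun τ => b.eval τ = false) (P := fun τ => Inv τ ∧ τ.Bounded B) (next := next)
    (cost := duration) (W := W) (fun τ h => hW τ h.1) (fun τ h hb =>
      ⟨⟨(hnext τ ⟨h, hb⟩).1, (hexec τ ⟨h, hb⟩).bounded⟩, (hnext τ ⟨h, hb⟩).2.2⟩) ⟨hinit, hσ⟩
  refine ⟨m, fun i => next^[i] σ, _, rfl, .of_passes hσ (fun i hi => ?_) hexit, fun i hi => ?_,
    hInv, hle⟩ <;> simp only [Function.iterate_succ_apply']
  · exact ⟨Bool.eq_true_of_not_eq_false (hbefore i hi).2, hexec _ (hbefore i hi)⟩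
  · exact (hnext _ (hbefore i hi)).2.1

theorem Ok.loop {Q : ℕ → Store → Prop} (Inv : Store → Prop) (W : Store → ℕ) (Wmax : ℕ)
    (hW : ∀ τ, Inv τ → W τ ≤ Wmax)
    (hstep : ∀ τ, Inv τ → b.eval τ = true → (∀ r, r ∉ s.writes → τ.reg r = σ.reg r) →
      Ok B s τ fun t τ' => Inv τ' ∧ W τ + t + 1 ≤ W τ')
    (hinit : Inv σ)
    (hQ : ∀ t τ, Inv τ → b.eval τ = false → (∀ r, r ∉ s.writes → τ.reg r = σ.reg r) →
      W σ + t ≤ W τ + 1 → Q t τ) : Ok B (.loop b s) σ Q := by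
  intro hσ
  obtain ⟨m, ss, time, rfl, htrace, -, hInv, hle⟩ := exists_loopTrace (B := B) (b := b) (s := s)
    (fun τ => Inv τ ∧ ∀ r, r ∉ s.writes → τ.reg r = σ.reg r) W (fun _ _ => True) Wmax
    (fun τ h => hW τ h.1)
    (fun τ h hb => (hstep τ h.1 hb h.2).imp fun _ _ _ hframe h' =>
      ⟨⟨h'.1, fun r hr => (hframe r hr).trans (h.2 r hr)⟩, trivial, h'.2⟩)
    hσ ⟨hinit, fun _ _ => rfl⟩
  exact ⟨time m + 1, ss m, hQ _ _ hInv.1 htrace.exit hInv.2 (by omega), htrace.exec⟩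

end Loops

end RAM

namespace ComparabilityDigraph

open RAM

/-! ### Memory layout -/

/- The registers up to 10 are set once and then only read; `address` is scratch space for computing
addresses, and the remaining registers are variables of the program. -/
namespace Reg

abbrev answer : ℕ := 0
abbrev size : ℕ := 2
abbrev one : ℕ := 3
abbrev zero : ℕ := 5
abbrev address : ℕ := 11
abbrev link : ℕ := 13
abbrev bit : ℕ := 14
abbrev bit' : ℕ := 15
abbrev x : ℕ := 20
abbrev y : ℕ := 21
abbrev z : ℕ := 22
abbrev index : ℕ := 23
abbrev entry : ℕ := 24
abbrev flag : ℕ := 25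
abbrev head : ℕ := 26
abbrev scan : ℕ := 27
abbrev row : ℕ := 28
abbrev tail : ℕ := 29
abbrev found : ℕ := 30
abbrev seedX : ℕ := 31
abbrev seedY : ℕ := 32
abbrev limit : ℕ := 33
abbrev minimal : ℕ := 34
abbrev vertex : ℕ := 35

attribute [simp] answer size one zero address link bit bit' x y z index entry flag head scan
  row tail found seedX seedY limit minimal vertex

end Reg

/-- The blocks of the memory. The input word is in the block `input`, the output in the block
`order`; the other blocks hold matrices or lists of pairs. -/
inductive Block
  | input
  | adj
  | collected
  | linked
  | first
  | second
  | marks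
  | order
  deriving DecidableEq

namespace Block

/-- The position of a block in the memory. -/
@[simp] def index : Block → ℕ
  | input => 0
  | adj => 1
  | collected => 2
  | linked => 3
  | first => 4
  | second => 5
  | marks => 6
  | order => 7

/-- The register that holds the address of the block. -/
@[simp] def base : Block → ℕ
  | input => Reg.zero
  | adj => 4
  | collected => 6
  | linked => 7
  | first => 8
  | second => 9
  | marks => 10
  | order => 1

theorem index_le (b : Block) : b.index ≤ 7 := by cases b <;> decide

theorem index_injective : Function.Injective index := by
  rintro (_ | _) (_ | _) h <;> first | rfl | cases h

theorem base_lt (b : Block) : b.base < Reg.address := by cases b <;> decide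

end Block

/-- The address of the `p`-th entry of a block; each block has `n * n + 1` cells. -/
def cell (n : ℕ) (b : Block) (p : ℕ) : ℕ := b.index * (n * n + 1) + p

/-- The numbers that occur in the computation are at most this. -/
def bound (n : ℕ) : ℕ := 8 * (n * n + 1)

section Cell

variable {n p p' : ℕ} {b b' : Block}

theorem index_lt (x y : Fin n) : (x : ℕ) * n + y < n * n :=
  calc (x : ℕ) * n + y < x * n + n := Nat.add_lt_add_left y.2 _
    _ = (x + 1) * n := (Nat.succ_mul ..).symm
    _ ≤ n * n := Nat.mul_le_mul_right n x.2

theorem index_inj {x y x' y' : Fin n} : (x : ℕ) * n + y = x' * n + y' ↔ x = x' ∧ y = y' := by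
  refine ⟨fun h => ?_, fun ⟨hx, hy⟩ => hx ▸ hy ▸ rfl⟩
  have hdiv := congrArg (· / n) h
  have hmod := congrArg (· % n) h
  simp only [mul_comm _ n, Nat.mul_add_div x.pos, Nat.mul_add_mod, Nat.div_eq_of_lt y.2,
    Nat.div_eq_of_lt y'.2, Nat.mod_eq_of_lt y.2, Nat.mod_eq_of_lt y'.2] at hdiv hmod
  exact ⟨Fin.ext hdiv, Fin.ext hmod⟩

theorem cell_inj (hp : p ≤ n * n) (hp' : p' ≤ n * n) :
    cell n b p = cell n b' p' ↔ b = b' ∧ p = p' := by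
  refine ⟨fun h => ?_, fun ⟨hb, hp⟩ => hb ▸ hp ▸ rfl⟩
  have hdiv := congrArg (· / (n * n + 1)) h
  have hmod := congrArg (· % (n * n + 1)) h
  simp only [cell, mul_comm _ (n * n + 1), Nat.mul_add_div (Nat.succ_pos _), Nat.mul_add_mod,
    Nat.div_eq_of_lt (Nat.lt_succ_of_le hp), Nat.div_eq_of_lt (Nat.lt_succ_of_le hp'),
    Nat.mod_eq_of_lt (Nat.lt_succ_of_le hp), Nat.mod_eq_of_lt (Nat.lt_succ_of_le hp')] at hdiv hmod
  exact ⟨Block.index_injective hdiv, hmod⟩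

theorem cell_input : cell n .input p = p := by simp [cell]

theorem cell_le_bound (hp : p ≤ n * n) : cell n b p ≤ bound n := by
  have := Nat.mul_le_mul_right (n * n + 1) b.index_le
  unfold cell bound
  omega

theorem update_cell (hp : p ≤ n * n) (hp' : p' ≤ n * n) (m : ℕ → ℕ) (v : ℕ) :
    Function.update m (cell n b p) v (cell n b' p') =
      if b' = b ∧ p' = p then v else m (cell n b' p') := by
  rw [Function.update_apply]
  simp only [cell_inj hp' hp]

end Cell

section Matrices

open Classical in
/-- The truth value of a proposition. -/
noncomputable def bit (p : Prop) : ℕ := if p then 1 else 0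

theorem bit_le_one (p : Prop) : bit p ≤ 1 := by
  unfold bit
  split_ifs <;> decide

@[simp] theorem bit_eq_zero {p : Prop} : bit p = 0 ↔ ¬ p := by simp [bit]

@[simp] theorem bit_eq_one {p : Prop} : bit p = 1 ↔ p := by simp [bit]

theorem bit_mul_bit (p q : Prop) : bit p * bit q = bit (p ∧ q) := by
  by_cases hp : p <;> by_cases hq : q <;> simp [bit, hp, hq]

theorem one_sub_bit (p : Prop) : 1 - bit p = bit (¬ p) := by
  by_cases p <;> simp [bit, *]

variable {n p v : ℕ} {m m' m'' : ℕ → ℕ} {b : Block} {bs : List Block}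

/-- The block `b` of the memory `m` holds the relation `R` as a matrix. -/
def IsMatrix (m : ℕ → ℕ) (b : Block) (R : Fin n → Fin n → Prop) : Prop :=
  ∀ x y : Fin n, m (cell n b (x * n + y)) = bit (R x y)

/-- The memories `m` and `m'` agree on all blocks that are not in the list `bs`. -/
def AgreeOff (n : ℕ) (bs : List Block) (m m' : ℕ → ℕ) : Prop :=
  ∀ b ∉ bs, ∀ p ≤ n * n, m' (cell n b p) = m (cell n b p)

theorem AgreeOff.refl : AgreeOff n bs m m := fun _ _ _ _ => rfl

theorem AgreeOff.trans (h : AgreeOff n bs m m') (h' : AgreeOff n bs m' m'') :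
    AgreeOff n bs m m'' :=
  fun b hb p hp => (h' b hb p hp).trans (h b hb p hp)

theorem AgreeOff.update (h : AgreeOff n bs m m') (hb : b ∈ bs) (hp : p ≤ n * n) (v : ℕ) :
    AgreeOff n bs m (Function.update m' (cell n b p) v) := fun b' hb' p' hp' => by
  have hne : b' ≠ b := fun heq => hb' (heq ▸ hb)
  rw [update_cell hp hp', if_neg fun heq => hne heq.1, h b' hb' p' hp']

variable {R R' : Fin n → Fin n → Prop}

theorem IsMatrix.congr (h : IsMatrix m b R) (hR : ∀ x y, R x y ↔ R' x y) : IsMatrix m b R' :=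
  fun x y => (h x y).trans (congrArg bit (propext (hR x y)))

theorem IsMatrix.agreeOff (h : IsMatrix m b R) (hm : AgreeOff n bs m m')
    (hb : b ∉ bs := by decide) : IsMatrix m' b R :=
  fun x y => (hm b hb _ (index_lt x y).le).trans (h x y)

theorem IsMatrix.update (h : IsMatrix m b R) (x y : Fin n) :
    IsMatrix (Function.update m (cell n b (x * n + y)) 1) b
      fun x' y' => R x' y' ∨ x' = x ∧ y' = y := by
  intro x' y'
  rw [update_cell (index_lt x y).le (index_lt x' y').le, h x' y']
  simp only [index_inj, true_and]
  by_cases hxy : x' = x ∧ y' = y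
  · simp [hxy, bit]
  · rw [if_neg hxy, or_iff_left hxy]

end Matrices

section Env

variable {n r v : ℕ} {σ τ : Store}

/-- The registers that are only read have their values; until the end, the answer is no. -/
structure Env (n : ℕ) (σ : Store) : Prop where
  answer : σ.reg Reg.answer = 0
  size : σ.reg Reg.size = n
  one : σ.reg Reg.one = 1
  base : ∀ b : Block, σ.reg b.base = b.index * (n * n + 1)

theorem Env.zero (h : Env n σ) : σ.reg Reg.zero = 0 := (h.base .input).trans (Nat.zero_mul _)

theorem Env.frame (h : Env n σ) {l : List ℕ} (hframe : ∀ r, r ∉ l → τ.reg r = σ.reg r)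
    (hl : ∀ r ∈ l, Reg.address ≤ r := by decide) : Env n τ := by
  have heq : ∀ r < Reg.address, τ.reg r = σ.reg r := fun r hr =>
    hframe r fun hmem => (hl r hmem).not_gt hr
  exact ⟨(heq _ (by decide)).trans h.answer, (heq _ (by decide)).trans h.size,
    (heq _ (by decide)).trans h.one, fun b => (heq _ b.base_lt).trans (h.base b)⟩

@[simp] theorem env_setReg (hr : Reg.address ≤ r) : Env n (σ.setReg r v) ↔ Env n σ := by
  have heq : ∀ r', r' ∉ [r] → (σ.setReg r v).reg r' = σ.reg r' := fun r' hr' =>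
    (Store.setReg_reg ..).trans (if_neg (by simpa using hr'))
  have hmem := List.forall_mem_singleton.2 hr
  exact ⟨fun h => h.frame (fun r' hr' => (heq r' hr').symm) hmem, fun h => h.frame heq hmem⟩

@[simp] theorem env_setMem {a : ℕ} : Env n (σ.setMem a v) ↔ Env n σ :=
  ⟨fun h => ⟨h.1, h.2, h.3, h.4⟩, fun h => ⟨h.1, h.2, h.3, h.4⟩⟩

end Env

/-! ### Loops over the vertices -/

/-- `for i = 0, …, reg limit - 1`; the limit is read before each pass. -/
def forLoop (i limit : ℕ) (s : Stmt) : Stmt :=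
  .seq (.const i 0) (.loop (.lt i limit) (.seq s (.add i i Reg.one)))

@[simp] theorem mem_writes_forLoop {r i limit : ℕ} {s : Stmt} :
    r ∈ (forLoop i limit s).writes ↔ r = i ∨ r ∈ s.writes := by
  simp only [forLoop, Stmt.writes, List.mem_append, List.mem_singleton]
  tauto

/-- A loop over all pairs of vertices, in the registers `x` and `y`. -/
def forPairs (s : Stmt) : Stmt := forLoop Reg.x Reg.size (forLoop Reg.y Reg.size s)

section ForLoop

variable {B n N c i limit : ℕ} {s : Stmt} {σ : Store} {Q : ℕ → Store → Prop}

/-- In a postcondition of the body, the loop counter is already increased. -/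
theorem ok_forLoop (N c : ℕ) (Inv : ℕ → Store → Prop)
    (hregs : i ∉ s.writes ∧ limit ∉ s.writes ∧ Reg.one ∉ s.writes ∧ limit ≠ i ∧ Reg.one ≠ i)
    (hone : σ.reg Reg.one = 1) (hlimit : σ.reg limit = N) (hinit : Inv 0 (σ.setReg i 0))
    (hstep : ∀ j < N, ∀ τ, Inv j τ → τ.reg i = j →
      (∀ r, r ∉ i :: s.writes → τ.reg r = σ.reg r) →
      Ok B s τ fun t τ' => t ≤ c ∧ Inv (j + 1) (τ'.setReg i (j + 1)))
    (hQ : ∀ t τ, Inv N τ → (∀ r, r ∉ i :: s.writes → τ.reg r = σ.reg r) →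
      t ≤ (c + 3) * N + 3 → Q t τ) : Ok B (forLoop i limit s) σ Q := by
  obtain ⟨hi, hlimit_writes, hone_writes, hlimit_ne, hone_ne⟩ := hregs
  intro hσ
  have hN : N ≤ B := hlimit ▸ hσ.1 limit
  revert hσ
  refine Ok.seq (.of_wp ⟨Nat.zero_le B, ?_⟩)
  refine Ok.loop (fun τ => τ.reg i ≤ N ∧ Inv (τ.reg i) τ ∧
    ∀ r, r ∉ i :: s.writes → τ.reg r = σ.reg r) (fun τ => (c + 3) * τ.reg i) ((c + 3) * N)
    (fun τ h => Nat.mul_le_mul_left _ h.1) ?_ ?_ ?_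
  · rintro τ ⟨-, hInv, hframe⟩ hlt -
    have hτlimit := (hframe limit (by simp [hlimit_writes, hlimit_ne])).trans hlimit
    have hτone := (hframe Reg.one (by simp_all)).trans hone
    rw [Test.eval, decide_eq_true_eq, hτlimit] at hlt
    refine .seq ((hstep _ hlt τ hInv rfl hframe).imp ?_)
    rintro t τ' - hframe' ⟨ht, hInv'⟩
    have hsum : τ'.reg i + τ'.reg Reg.one = τ.reg i + 1 := by
      rw [hframe' i hi, hframe' _ hone_writes, hτone]
    refine .of_wp ⟨by omega, ⟨?_, ?_, fun r hr => ?_⟩, ?_⟩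
    · simpa [hsum] using hlt
    · simpa [hsum] using hInv'
    · rw [List.mem_cons, not_or] at hr
      rw [Store.setReg_reg, if_neg hr.1, hframe' r hr.2, hframe r (by simp [hr])]
    · rw [Store.setReg_reg, if_pos rfl, hsum, Nat.mul_succ]
      omega
  · refine ⟨by simp, by simpa using hinit, fun r hr => ?_⟩
    rw [List.mem_cons, not_or] at hr
    rw [Store.setReg_reg, if_neg hr.1]
  · rintro t τ ⟨hle, hInv, hframe⟩ hlt - ht
    have hτlimit := (hframe limit (by simp [hlimit_writes, hlimit_ne])).trans hlimit
    rw [Test.eval, decide_eq_false_iff_not, hτlimit] at hlt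
    obtain rfl : τ.reg i = N := by omega
    refine hQ _ τ hInv hframe ?_
    rw [Store.setReg_reg, if_pos rfl] at ht
    omega

theorem ok_forFin (c : ℕ) (Inv : Set (Fin n) → Store → Prop)
    (hInv : ∀ P τ v, Inv P τ → Inv P (τ.setReg i v))
    (hregs : i ∉ s.writes ∧ Reg.size ∉ s.writes ∧ Reg.one ∉ s.writes ∧ Reg.size ≠ i ∧ Reg.one ≠ i)
    (hE : Env n σ) (hinit : Inv ∅ σ)
    (hstep : ∀ P (X : Fin n) τ, Inv P τ → τ.reg i = X →
      (∀ r, r ∉ i :: s.writes → τ.reg r = σ.reg r) →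
      Ok B s τ fun t τ' => t ≤ c ∧ Inv (insert X P) τ')
    (hQ : ∀ t τ, Inv Set.univ τ → (∀ r, r ∉ i :: s.writes → τ.reg r = σ.reg r) →
      t ≤ (c + 3) * n + 3 → Q t τ) : Ok B (forLoop i Reg.size s) σ Q := by
  refine ok_forLoop n c (fun j => Inv {x | x < j}) hregs hE.one hE.size ?_ ?_ ?_
  · simpa using hInv _ _ _ hinit
  · intro j hj τ hP hi hframe
    refine (hstep _ ⟨j, hj⟩ τ hP hi hframe).imp fun t τ' _ _ h => ⟨h.1, hInv _ _ _ ?_⟩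
    convert h.2 using 1
    ext x
    simp only [Set.mem_ofPred_eq, Set.mem_insert_iff, Fin.ext_iff]
    omega
  · simpa using hQ

theorem ok_forPairs (c : ℕ) (Inv : Set (Fin n × Fin n) → Store → Prop)
    (hInv : ∀ P τ r v, r = Reg.x ∨ r = Reg.y → Inv P τ → Inv P (τ.setReg r v)) (hE : Env n σ)
    (hwrites : ∀ r ∈ s.writes, Reg.address ≤ r ∧ r ≠ Reg.x ∧ r ≠ Reg.y)
    (hinit : Inv ∅ σ)
    (hstep : ∀ P (X Y : Fin n) τ, Inv P τ → Env n τ → τ.reg Reg.x = X → τ.reg Reg.y = Y →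
      (∀ r, r ∉ Reg.x :: Reg.y :: s.writes → τ.reg r = σ.reg r) →
      Ok B s τ fun t τ' => t ≤ c ∧ Inv (insert (X, Y) P) τ')
    (hQ : ∀ t τ, Inv Set.univ τ → t ≤ ((c + 3) * n + 6) * n + 3 → Q t τ) :
    Ok B (forPairs s) σ Q := by
  have hwrites' : ∀ r ∈ Reg.y :: s.writes, Reg.address ≤ r :=
    List.forall_mem_cons.2 ⟨by decide, fun r hr => (hwrites r hr).1⟩
  have hnot : ∀ r < Reg.address, r ∉ s.writes := fun r hr h => (hwrites r h).1.not_gt hr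
  have hx : Reg.x ∉ s.writes := fun h => (hwrites _ h).2.1 rfl
  have hy : Reg.y ∉ s.writes := fun h => (hwrites _ h).2.2 rfl
  refine ok_forFin ((c + 3) * n + 3) (fun P => Inv (P ×ˢ Set.univ))
    (fun P τ v => hInv _ τ _ v (.inl rfl)) ?_ hE (by simpa using hinit) ?_
    fun t τ h _ ht => hQ t τ (by simpa using h) ht
  · simp [hx, hnot]
  · intro P X τ hP hX hframe
    have hEτ : Env n τ := hE.frame hframe (by simpa using fun r hr => (hwrites r hr).1)
    refine ok_forFin c (fun P' => Inv (P ×ˢ Set.univ ∪ {X} ×ˢ P'))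
      (fun P τ v => hInv _ τ _ v (.inr rfl)) (by simp [hy, hnot]) hEτ (by simpa using hP)
      (fun P' Y ρ hP' hY hframe' => ?_) fun t ρ h _ ht => ⟨ht, ?_⟩
    · refine (hstep _ X Y ρ hP' (hEτ.frame hframe' hwrites')
        ((hframe' _ (by simp [hx])).trans hX) hY fun r hr => ?_).imp fun t ρ' _ _ h => ⟨h.1, ?_⟩
      · rw [List.mem_cons, not_or] at hr
        exact (hframe' r hr.2).trans (hframe r (by simpa using hr))
      · convert h.2 using 1
        ext ⟨x, y⟩
        simp only [Set.mem_union, Set.mem_prod, Set.mem_univ, Set.mem_singleton_iff,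
          Set.mem_insert_iff, Prod.mk.injEq]
        tauto
    · convert h using 1
      ext ⟨x, y⟩
      simp [or_comm]

end ForLoop

/-! ### Access to the blocks -/

section Access

/-- `reg r := entry (reg x, reg y) of the matrix b` -/
def getCell (r : ℕ) (b : Block) (x y : ℕ) : Stmt :=
  .seq (.mul Reg.address x Reg.size) <| .seq (.add Reg.address Reg.address y) <|
  .seq (.add Reg.address b.base Reg.address) (.load r Reg.address)

/-- `entry (reg x, reg y) of the matrix b := reg v` -/
def setCell (b : Block) (x y v : ℕ) : Stmt :=
  .seq (.mul Reg.address x Reg.size) <| .seq (.add Reg.address Reg.address y) <|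
  .seq (.add Reg.address b.base Reg.address) (.store Reg.address v)

/-- `reg r := entry number (reg i) of the block b` -/
def getAt (r : ℕ) (b : Block) (i : ℕ) : Stmt :=
  .seq (.add Reg.address b.base i) (.load r Reg.address)

/-- `entry number (reg i) of the block b := reg v` -/
def setAt (b : Block) (i v : ℕ) : Stmt :=
  .seq (.add Reg.address b.base i) (.store Reg.address v)

variable {n r x y v i p : ℕ} {b : Block} {σ : Store} {Q : ℕ → Store → Prop} {X Y Z : Fin n}
  {R : Fin n → Fin n → Prop}

theorem ok_getCell (hE : Env n σ) (hR : IsMatrix σ.mem b R) (hx : σ.reg x = X) (hy : σ.reg y = Y)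
    (hQ : Q 7 ((σ.setReg Reg.address (cell n b (X * n + Y))).setReg r (bit (R X Y))))
    (hy_ne : y ≠ Reg.address := by decide) : Ok (bound n) (getCell r b x y) σ Q := by
  have hcell := cell_le_bound (b := b) (index_lt X Y).le
  have hentry := hR X Y
  unfold cell at hcell hentry hQ
  apply Ok.of_wp
  simp only [getCell, wp, Store.setReg_reg, Store.setReg_mem, if_true, hy_ne, b.base_lt.ne,
    if_false, hE.size, hE.base, hx, hy, hentry]
  refine ⟨by omega, by omega, hcell, ?_⟩
  simpa only [Store.setReg, Function.update_idem] using hQ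

theorem ok_setCell (hE : Env n σ) (hx : σ.reg x = X) (hy : σ.reg y = Y)
    (hQ : Q 7 ((σ.setReg Reg.address (cell n b (X * n + Y))).setMem (cell n b (X * n + Y))
      (σ.reg v)))
    (hne : y ≠ Reg.address ∧ v ≠ Reg.address := by decide) :
    Ok (bound n) (setCell b x y v) σ Q := by
  have hcell := cell_le_bound (b := b) (index_lt X Y).le
  unfold cell at hcell hQ
  apply Ok.of_wp
  simp only [setCell, wp, Store.setReg_reg, if_true, hne.1, hne.2, b.base_lt.ne, if_false, hE.size,
    hE.base, hx, hy]
  refine ⟨by omega, by omega, hcell, ?_⟩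
  simpa only [Store.setReg, Store.setMem, Function.update_idem] using hQ

theorem ok_getAt (hE : Env n σ) (hi : σ.reg i = p) (hp : p ≤ n * n)
    (hQ : Q 3 ((σ.setReg Reg.address (cell n b p)).setReg r (σ.mem (cell n b p)))) :
    Ok (bound n) (getAt r b i) σ Q := by
  apply Ok.of_wp
  simp only [getAt, wp, Store.setReg_reg, Store.setReg_mem, if_true, hE.base, hi]
  exact ⟨cell_le_bound hp, hQ⟩

theorem ok_setAt (hE : Env n σ) (hi : σ.reg i = p) (hp : p ≤ n * n)
    (hQ : Q 3 ((σ.setReg Reg.address (cell n b p)).setMem (cell n b p) (σ.reg v)))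
    (hv : v ≠ Reg.address := by decide) : Ok (bound n) (setAt b i v) σ Q := by
  apply Ok.of_wp
  simp only [setAt, wp, Store.setReg_reg, if_true, hE.base, hi, hv, if_false]
  exact ⟨cell_le_bound hp, hQ⟩

/-- `reg r := 1` if `y → x → z` without an arc from `y` to `z`, and `reg r := 0` otherwise. -/
def detourTest (r x y z : ℕ) : Stmt :=
  .seq (getCell r .adj y x) <| .seq (getCell Reg.bit .adj x z) <| .seq (.mul r r Reg.bit) <|
  .seq (getCell Reg.bit .adj y z) <| .seq (.sub Reg.bit Reg.one Reg.bit) (.mul r r Reg.bit)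

/-- `reg link` becomes nonzero if and only if the pairs `(x, y)` and `(x, z)` directly force each
other. -/
def linkTest (x y z : ℕ) : Stmt :=
  .seq (detourTest Reg.link x y z) <| .seq (detourTest Reg.bit' x z y) <|
  .seq (.add Reg.link Reg.link Reg.bit') <| .ite (.eq y z) (.const Reg.link 0) .skip

variable {D : Digraph (Fin n)} {z : ℕ}

theorem ok_detourTest (hE : Env n σ) (hA : IsMatrix σ.mem .adj D.Adj) (hx : σ.reg x = X)
    (hy : σ.reg y = Y) (hz : σ.reg z = Z) (hr : Reg.address < r ∧ r < Reg.bit ∨ r = Reg.bit')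
    (hxyz : Reg.x ≤ x ∧ Reg.x ≤ y ∧ Reg.x ≤ z) :
    Ok (bound n) (detourTest r x y z) σ fun t τ => t ≤ 30 ∧ τ.mem = σ.mem ∧
      τ.reg r = bit ((D.Adj Y X ∧ D.Adj X Z) ∧ ¬ D.Adj Y Z) := by
  have hbound : ∀ p, bit p ≤ bound n := fun p => (bit_le_one p).trans (by unfold bound; omega)
  have hr_le : 11 ≤ r := by grind
  have hr_lt : r < 20 := by grind
  have hr_ne : r ≠ Reg.bit ∧ r ≠ Reg.address := by grind
  have hr_one : Reg.one ≠ r := by grind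
  have hne : ∀ i < 20, x ≠ i ∧ y ≠ i ∧ z ≠ i := by grind
  refine .seq (ok_getCell hE hA hy hx ?_ (hne _ (by decide)).1)
  refine .seq (ok_getCell (X := X) (Y := Z) (by simp [hE, hr_le]) hA (by simp [hne, hr_lt, hx])
    (by simp [hne, hr_lt, hz]) ?_ (hne _ (by decide)).2.2)
  refine .seq (.of_wp ⟨?_, ?_⟩)
  · simpa [hr_ne, bit_mul_bit] using hbound _
  refine .seq (ok_getCell (X := Y) (Y := Z) (by simp [hE, hr_le]) hA (by simp [hne, hr_lt, hy])
    (by simp [hne, hr_lt, hz]) ?_ (hne _ (by decide)).2.2)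
  apply Ok.of_wp
  simp_all [wp, hE.one, bit_mul_bit, one_sub_bit]

theorem mem_writes_detourTest {r' : ℕ} (h : r' ∈ (detourTest r x y z).writes) :
    r' = Reg.address ∨ r' = Reg.bit ∨ r' = r := by
  simp only [detourTest, getCell, Stmt.writes, List.cons_append, List.nil_append, List.mem_cons,
    List.not_mem_nil] at h
  tauto

theorem mem_writes_linkTest (h : r ∈ (linkTest x y z).writes) : Reg.address ≤ r ∧ r < Reg.x := by
  simp only [linkTest, Stmt.writes, List.mem_append, List.mem_singleton] at h
  have := @mem_writes_detourTest
  grind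

theorem ok_linkTest (hE : Env n σ) (hA : IsMatrix σ.mem .adj D.Adj) (hx : σ.reg x = X)
    (hy : σ.reg y = Y) (hz : σ.reg z = Z)
    (hxyz : Reg.x ≤ x ∧ Reg.x ≤ y ∧ Reg.x ≤ z := by decide) :
    Ok (bound n) (linkTest x y z) σ fun t τ => t ≤ 80 ∧ τ.mem = σ.mem ∧
      (τ.reg Reg.link = 0 ↔ ¬ Link D X Y Z) := by
  have hkeep : ∀ {x' y' z' r i}, r < Reg.x → Reg.x ≤ i → i ∉ (detourTest r x' y' z').writes := by
    intro x' y' z' r i hr hi hmem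
    have := mem_writes_detourTest hmem
    grind
  obtain ⟨hx_le, hy_le, hz_le⟩ := hxyz
  refine .seq ((ok_detourTest hE hA hx hy hz (.inl (by decide)) ⟨hx_le, hy_le, hz_le⟩).imp ?_)
  rintro t₁ τ₁ - hframe₁ ⟨ht₁, hmem₁, hlink⟩
  have hE₁ : Env n τ₁ := hE.frame hframe₁ fun r hr => by
    rcases mem_writes_detourTest hr with rfl | rfl | rfl <;> decide
  rw [← hframe₁ _ (hkeep (by decide) hx_le)] at hx
  rw [← hframe₁ _ (hkeep (by decide) hy_le)] at hy
  rw [← hframe₁ _ (hkeep (by decide) hz_le)] at hz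
  refine .seq ((ok_detourTest hE₁ (hmem₁ ▸ hA) hx hz hy (.inr rfl) ⟨hx_le, hz_le, hy_le⟩).imp ?_)
  rintro t₂ τ₂ - hframe₂ ⟨ht₂, hmem₂, hlink'⟩
  rw [← hframe₂ _ (hkeep (by decide) hy_le)] at hy
  rw [← hframe₂ _ (hkeep (by decide) hz_le)] at hz
  rw [← hframe₂ _ fun h => by simpa using mem_writes_detourTest h] at hlink
  have hsum : bit ((D.Adj Y X ∧ D.Adj X Z) ∧ ¬ D.Adj Y Z) +
      bit ((D.Adj Z X ∧ D.Adj X Y) ∧ ¬ D.Adj Z Y) ≤ bound n :=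
    (Nat.add_le_add (bit_le_one _) (bit_le_one _)).trans (by unfold bound; omega)
  have hne : y ≠ Reg.link ∧ z ≠ Reg.link := by grind
  refine .of_wp ⟨by rwa [hlink, hlink'], fun heq => ⟨Nat.zero_le _, ?_⟩, fun hYZ => ?_⟩
  · have hYZ : Y = Z := Fin.ext (by simpa [Test.eval, hne, hy, hz] using heq)
    exact ⟨by omega, hmem₂.trans hmem₁, by simp [hYZ, Link]⟩
  · have hYZ : Y ≠ Z := by simpa [Test.eval, hne, hy, hz, Fin.ext_iff] using hYZ
    refine ⟨by omega, hmem₂.trans hmem₁, ?_⟩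
    simp only [Store.setReg_reg, if_true, hlink, hlink', Nat.add_eq_zero_iff, bit_eq_zero, Link]
    tauto

end Access

/-! ### Preprocessing -/

section Preprocessing

variable {n : ℕ} {D : Digraph (Fin n)} {σ : Store}

/-- `reg flag := 1` if the digraph is semicomplete, and `reg flag := 0` otherwise. -/
def semicompleteTest : Stmt :=
  .seq (.const Reg.flag 1) <| forPairs <|
    .seq (getCell Reg.bit .adj Reg.x Reg.y) <| .seq (getCell Reg.bit' .adj Reg.y Reg.x) <|
    .seq (.add Reg.bit Reg.bit Reg.bit') <|
    .ite (.eq Reg.bit Reg.zero) (.ite (.eq Reg.x Reg.y) .skip (.const Reg.flag 0)) .skip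

theorem ok_semicompleteTest (hE : Env n σ) (hA : IsMatrix σ.mem .adj D.Adj) :
    Ok (bound n) semicompleteTest σ fun t τ => t ≤ (33 * n + 6) * n + 5 ∧ τ.mem = σ.mem ∧
      τ.reg Reg.flag = bit (IsSemicomplete D) := by
  let joined : Fin n × Fin n → Prop := fun p => p.1 ≠ p.2 → D.Adj p.1 p.2 ∨ D.Adj p.2 p.1
  refine .seq (.of_wp ⟨by unfold bound; omega, ?_⟩)
  refine ok_forPairs 30 (fun P τ => τ.mem = σ.mem ∧ τ.reg Reg.flag = bit (∀ p ∈ P, joined p)) ?_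
    (by simpa using hE) (by decide) ⟨rfl, by simp [bit]⟩ ?_ fun t τ h ht => ⟨by linarith, h.1, ?_⟩
  · rintro P τ r v (rfl | rfl) ⟨hmem, hflag⟩ <;> exact ⟨hmem, by simpa using hflag⟩
  · rintro P X Y τ ⟨hmem, hflag⟩ hEτ hx hy -
    refine .seq (ok_getCell hEτ (hmem ▸ hA) hx hy ?_)
    refine .seq (ok_getCell (X := Y) (Y := X) (by simpa using hEτ) (hmem ▸ hA) (by simpa using hy)
      (by simpa using hx) ?_)
    have hsum : bit (D.Adj X Y) + bit (D.Adj Y X) ≤ bound n :=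
      (Nat.add_le_add (bit_le_one _) (bit_le_one _)).trans (by unfold bound; omega)
    rw [Set.forall_mem_insert]
    refine .of_wp ⟨by simpa using hsum,
      fun hnone => ⟨fun hXY => ?_, fun hXY => ⟨Nat.zero_le _, ?_⟩⟩, fun hsome => ?_⟩
    · obtain rfl : X = Y := by simpa [Test.eval, hx, hy, Fin.ext_iff] using hXY
      simp [wp, hmem, hflag, joined]
    · have hXY : X ≠ Y := by simpa [Test.eval, hx, hy, Fin.ext_iff] using hXY
      have hnone : ¬ D.Adj X Y ∧ ¬ D.Adj Y X := by simpa [Test.eval, hEτ.zero] using hnone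
      simp [hmem, joined, hXY, hnone, bit]
    · have hsome : D.Adj X Y ∨ D.Adj Y X := by
        simpa [Test.eval, hEτ.zero, ← or_iff_not_imp_left] using hsome
      simp [wp, hmem, hflag, joined, hsome]
  · rw [h.2]
    simp [joined, IsSemicomplete]

/-- Mark `(x, y)` and `(y, x)` if `(x, y)` directly forces a pair `(x, z)`. -/
def markLinkedRow : Stmt :=
  forLoop Reg.z Reg.size <|
    .seq (linkTest Reg.x Reg.y Reg.z) <| .ite (.eq Reg.link Reg.zero) .skip <|
      .seq (setCell .linked Reg.x Reg.y Reg.one) (setCell .linked Reg.y Reg.x Reg.one)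

/-- Mark the pairs that lie in implication classes with several elements. -/
def markLinked : Stmt := forPairs markLinkedRow

theorem ok_markLinkedRow {X Y : Fin n} {R : Fin n → Fin n → Prop} (hE : Env n σ)
    (hA : IsMatrix σ.mem .adj D.Adj) (hR : IsMatrix σ.mem .linked R) (hx : σ.reg Reg.x = X)
    (hy : σ.reg Reg.y = Y) :
    Ok (bound n) markLinkedRow σ fun t τ => t ≤ 110 * n + 3 ∧ AgreeOff n [.linked] σ.mem τ.mem ∧
      IsMatrix τ.mem .linked fun a b =>
        R a b ∨ (∃ z, Link D X Y z) ∧ (a = X ∧ b = Y ∨ a = Y ∧ b = X) := by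
  refine ok_forFin 107 (fun P τ => AgreeOff n [.linked] σ.mem τ.mem ∧
    IsMatrix τ.mem .linked fun a b =>
      R a b ∨ (∃ z ∈ P, Link D X Y z) ∧ (a = X ∧ b = Y ∨ a = Y ∧ b = X)) (fun _ _ _ h => h)
    (by simp [linkTest, detourTest, getCell, setCell, Stmt.writes]) hE
    ⟨.refl, by simpa using hR⟩ ?_ ?_
  · rintro P Z τ ⟨hoff, hmat⟩ hz hframe
    have hEτ : Env n τ := hE.frame hframe (by decide)
    rw [← hframe Reg.x (by decide)] at hx
    rw [← hframe Reg.y (by decide)] at hy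
    refine .seq ((ok_linkTest hEτ (hA.agreeOff hoff) hx hy hz).imp ?_)
    rintro t₁ τ₁ - hframe₁ ⟨ht₁, hmem₁, hlink⟩
    have hEτ₁ : Env n τ₁ := hEτ.frame hframe₁ (by decide)
    rw [← hframe₁ Reg.x (by decide)] at hx
    rw [← hframe₁ Reg.y (by decide)] at hy
    refine .ite (fun hnone => .skip ⟨by omega, hmem₁ ▸ hoff, hmem₁ ▸ hmat.congr fun a b => ?_⟩)
      fun hsome => ?_
    · have hnone : ¬ Link D X Y Z := hlink.1 (by simpa [Test.eval, hEτ₁.zero] using hnone)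
      simp only [Set.exists_mem_insert, hnone, false_or]
    have hsome : Link D X Y Z := by simpa [Test.eval, hEτ₁.zero, hlink] using hsome
    refine .seq (ok_setCell hEτ₁ hx hy ?_)
    refine ok_setCell (X := Y) (Y := X) (by simpa using hEτ₁) (by simpa using hy)
      (by simpa using hx) ⟨by omega, ?_⟩
    simp only [Store.setMem_mem, Store.setReg_mem, Store.setMem_reg, Store.setReg_reg, Reg.one,
      Reg.address, hEτ₁.one, hmem₁, Set.exists_mem_insert, hsome, true_or, true_and]
    refine ⟨(hoff.update (by decide) (index_lt X Y).le _).update (by decide) (index_lt Y X).le _,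
      ((hmat.update X Y).update Y X).congr fun a b => ?_⟩
    tauto
  · rintro t τ h - ht
    exact ⟨ht, by simpa using h⟩

theorem ok_markLinked (hE : Env n σ) (hA : IsMatrix σ.mem .adj D.Adj)
    (h0 : IsMatrix (n := n) σ.mem .linked fun _ _ => False) :
    Ok (bound n) markLinked σ fun t τ => t ≤ ((110 * n + 6) * n + 6) * n + 3 ∧
      AgreeOff n [.linked] σ.mem τ.mem ∧ IsMatrix τ.mem .linked (Linked D) := by
  refine ok_forPairs (110 * n + 3) (fun P τ => AgreeOff n [.linked] σ.mem τ.mem ∧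
    IsMatrix τ.mem .linked fun a b =>
      ∃ p ∈ P, (∃ z, Link D p.1 p.2 z) ∧ (a = p.1 ∧ b = p.2 ∨ a = p.2 ∧ b = p.1))
    (fun _ _ _ _ _ h => h) hE (by decide) ⟨.refl, by simpa using h0⟩ ?_ ?_
  · rintro P X Y τ ⟨hoff, hmat⟩ hEτ hx hy -
    refine (ok_markLinkedRow hEτ (hA.agreeOff hoff) hmat hx hy).imp fun t τ' _ _ h =>
      ⟨h.1, hoff.trans h.2.1, h.2.2.congr fun a b => ?_⟩
    rw [Set.exists_mem_insert, or_comm]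
  · rintro t τ ⟨hoff, hmat⟩ ht
    refine ⟨ht, hoff, hmat.congr fun a b => ⟨?_, ?_⟩⟩
    · rintro ⟨p, -, ⟨z, hlink⟩, ⟨rfl, rfl⟩ | ⟨rfl, rfl⟩⟩
      exacts [⟨z, .inl hlink⟩, ⟨z, .inr hlink⟩]
    · rintro ⟨z, hlink | hlink⟩
      exacts [⟨(a, b), trivial, ⟨z, hlink⟩, .inl ⟨rfl, rfl⟩⟩,
        ⟨(b, a), trivial, ⟨z, hlink⟩, .inr ⟨rfl, rfl⟩⟩]

end Preprocessing

/-! ### Reading the input -/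

section InputWord

variable {n : ℕ} {D : Digraph (Fin n)} {L : Fin n → List (Fin n)}

/-- The part of the input word that belongs to the vertex `x`. -/
def inputPart (L : Fin n → List (Fin n)) (x : Fin n) : List ℕ :=
  (L x).length :: (L x).map Fin.val

/-- The position of the part of the vertex `j` in the input word. -/
def inputOffset (L : Fin n → List (Fin n)) (j : ℕ) : ℕ :=
  1 + (((List.finRange n).take j).flatMap (inputPart L)).length

theorem inputOffset_zero : inputOffset L 0 = 1 := by simp [inputOffset]

theorem take_finRange_succ (x : Fin n) :
    (List.finRange n).take (x + 1) = (List.finRange n).take x ++ [x] := by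
  rw [List.take_succ_eq_append_getElem (by simp)]
  simp

theorem inputOffset_succ (x : Fin n) :
    inputOffset L (x + 1) = inputOffset L x + 1 + (L x).length := by
  simp only [inputOffset, take_finRange_succ, List.flatMap_append, List.flatMap_singleton,
    List.length_append, inputPart, List.length_cons, List.length_map]
  omega

theorem inputWord_getElem? {x : Fin n} {i : ℕ} (hi : i ≤ (L x).length) :
    (inputWord L)[inputOffset L x + i]? = (inputPart L x)[i]? := by
  have hsplit : inputWord L = (n :: ((List.finRange n).take x).flatMap (inputPart L)) ++
      (inputPart L x ++ ((List.finRange n).drop (x + 1)).flatMap (inputPart L)) := by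
    change n :: (List.finRange n).flatMap (inputPart L) = _
    conv_lhs => rw [← List.take_append_drop (x + 1) (List.finRange n), take_finRange_succ]
    simp
  have hlength : (n :: ((List.finRange n).take x).flatMap (inputPart L)).length =
      inputOffset L x := by
    rw [List.length_cons, inputOffset, add_comm]
  rw [hsplit, List.getElem?_append_right (by omega), hlength, Nat.add_sub_cancel_left,
    List.getElem?_append_left (by simpa [inputPart] using Nat.lt_succ_of_le hi)]

theorem inputWord_getD_length (x : Fin n) :
    (inputWord L).getD (inputOffset L x) 0 = (L x).length := by
  rw [List.getD_eq_getElem?_getD, ← add_zero (inputOffset L x), inputWord_getElem? (Nat.zero_le _)]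
  rfl

theorem inputWord_getD_entry {x : Fin n} {i : ℕ} (hi : i < (L x).length) :
    (inputWord L).getD (inputOffset L x + 1 + i) 0 = (L x)[i] := by
  rw [List.getD_eq_getElem?_getD, add_right_comm, add_assoc, inputWord_getElem? hi]
  simp [inputPart, hi]

theorem length_adjacencyList_lt (hL : IsAdjacencyLists D L) (hD : IsLoopless D) (x : Fin n) :
    (L x).length < n := by
  have hnodup : (x :: L x).Nodup :=
    List.nodup_cons.2 ⟨fun h => hD x (((hL x).2 x).1 h), (hL x).1⟩
  simpa using hnodup.length_le_card

theorem inputOffset_le (hL : IsAdjacencyLists D L) (hD : IsLoopless D) {j : ℕ} (hj : j ≤ n) :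
    inputOffset L j ≤ 1 + j * n := by
  induction j with
  | zero => simp [inputOffset_zero]
  | succ j ih =>
    have hsucc : inputOffset L (j + 1) = inputOffset L j + 1 + (L ⟨j, hj⟩).length :=
      inputOffset_succ ⟨j, hj⟩
    have hlength := length_adjacencyList_lt hL hD ⟨j, hj⟩
    have hle := ih (Nat.le_of_succ_le hj)
    rw [Nat.succ_mul]
    omega

theorem length_inputWord_le (hL : IsAdjacencyLists D L) (hD : IsLoopless D) :
    (inputWord L).length ≤ n * n + 1 := by
  have hlength : inputOffset L n = (inputWord L).length := by
    rw [inputOffset, List.take_of_length_le (by simp), inputWord, List.length_cons, add_comm]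
    rfl
  have hle := inputOffset_le hL hD le_rfl
  omega

theorem inputWord_getD_cell (hL : IsAdjacencyLists D L) (hD : IsLoopless D) {b : Block}
    (hb : b ≠ .input) (p : ℕ) : (inputWord L).getD (cell n b p) 0 = 0 := by
  have hindex : 1 ≤ b.index := by cases b <;> first | decide | exact absurd rfl hb
  have := Nat.mul_le_mul_right (n * n + 1) hindex
  refine List.getD_eq_default _ _ ((length_inputWord_le hL hD).trans ?_)
  unfold cell
  omega

theorem inputWord_getD_le (hL : IsAdjacencyLists D L) (hD : IsLoopless D) (i : ℕ) :
    (inputWord L).getD i 0 ≤ n := by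
  have hmem : ∀ a ∈ inputWord L, a ≤ n := by
    simp only [inputWord, List.mem_cons, List.mem_flatMap, List.mem_map]
    rintro a (rfl | ⟨x, -, rfl | ⟨y, -, rfl⟩⟩)
    exacts [le_rfl, (length_adjacencyList_lt hL hD x).le, y.2.le]
  rw [List.getD_eq_getElem?_getD]
  rcases h : (inputWord L)[i]? with _ | a
  exacts [Nat.zero_le n, hmem a (List.mem_of_getElem? h)]

end InputWord

section Input

variable {n : ℕ} {σ : Store}

/-- Set up the registers that are only read. -/
def initRegs : Stmt :=
  .seq (.load Reg.size Reg.zero) <| .seq (.const Reg.one 1) <|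
  .seq (.mul Block.adj.base Reg.size Reg.size) <|
  .seq (.add Block.adj.base Block.adj.base Reg.one) <|
  .seq (.add Block.collected.base Block.adj.base Block.adj.base) <|
  .seq (.add Block.linked.base Block.collected.base Block.adj.base) <|
  .seq (.add Block.first.base Block.linked.base Block.adj.base) <|
  .seq (.add Block.second.base Block.first.base Block.adj.base) <|
  .seq (.add Block.marks.base Block.second.base Block.adj.base) <|
  .add Block.order.base Block.marks.base Block.adj.base

theorem ok_initRegs (hreg : ∀ i, σ.reg i = 0) (hmem : σ.mem 0 = n) :
    Ok (bound n) initRegs σ fun t τ => t ≤ 30 ∧ τ.mem = σ.mem ∧ Env n τ := by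
  apply Ok.of_wp
  simp only [initRegs, wp, hreg, hmem, Store.setReg_reg, Store.setReg_mem, bound]
  simp only [Block.base, Reg.one, Reg.size, Nat.reduceEqDiff, if_true, if_false]
  refine ⟨by omega, by omega, by omega, by omega, by omega, by omega, by omega, by omega, by omega,
    by decide, trivial, ?_⟩
  constructor
  · simp [hreg]
  · simp
  · simp
  · rintro (_ | _) <;> simp [hreg] <;> omega

/-- Read the adjacency list of `x`: `reg limit` entries from address `reg scan`. -/
def readEntries : Stmt :=
  forLoop Reg.index Reg.limit <| .seq (.load Reg.entry Reg.scan) <|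
    .seq (.add Reg.scan Reg.scan Reg.one) (setCell .adj Reg.x Reg.entry Reg.one)

theorem ok_readEntries {X : Fin n} {l : List (Fin n)} {a : ℕ} {R : Fin n → Fin n → Prop}
    (hE : Env n σ) (hx : σ.reg Reg.x = X) (hscan : σ.reg Reg.scan = a)
    (hlimit : σ.reg Reg.limit = l.length) (hl : ∀ i (hi : i < l.length), σ.mem (a + i) = l[i])
    (ha : a + l.length ≤ n * n + 1) (hR : IsMatrix σ.mem .adj R) :
    Ok (bound n) readEntries σ fun t τ => t ≤ 20 * l.length + 3 ∧
      τ.reg Reg.scan = a + l.length ∧ AgreeOff n [.adj] σ.mem τ.mem ∧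
      IsMatrix τ.mem .adj fun x y => R x y ∨ x = X ∧ y ∈ l := by
  refine ok_forLoop l.length 17 (fun i τ => τ.reg Reg.scan = a + i ∧ AgreeOff n [.adj] σ.mem τ.mem ∧
    IsMatrix τ.mem .adj fun x y => R x y ∨ x = X ∧ y ∈ l.take i) (by decide) hE.one hlimit
    ⟨by simpa using hscan, .refl, by simpa using hR⟩ ?_ fun t τ h _ ht => ⟨ht, by simpa using h⟩
  rintro i hi τ ⟨hscan, hoff, hmat⟩ - hframe
  have hEτ : Env n τ := hE.frame hframe
  have hentry : τ.mem (a + i) = l[i] := by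
    rw [← cell_input (n := n) (p := a + i), hoff _ (by decide) _ (by omega), cell_input, hl i hi]
  refine .seq (.of_wp (.seq (.of_wp ⟨?_, ?_⟩)))
  · simp only [Store.setReg_reg, hscan, hEτ.one, bound, Reg.scan, Reg.entry, Reg.one,
      Nat.reduceEqDiff, ↓reduceIte, Order.add_one_le_iff]
    omega
  refine ok_setCell (X := X) (Y := l[i]) (by simpa using hEτ)
    (by simpa using (hframe Reg.x (by decide)).trans hx) (by simp [hscan, hentry])
    ⟨by omega, by simp [hscan, hEτ.one, add_assoc], ?_⟩
  simp only [Store.setMem_mem, Store.setReg_mem]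
  refine ⟨hoff.update (by decide) (index_lt ..).le _, ?_⟩
  simp only [Store.setReg_reg, Reg.one, Reg.scan, Reg.entry, hEτ.one]
  refine (hmat.update X l[i]).congr fun x y => ?_
  rw [List.take_succ_eq_append_getElem hi, List.mem_append, List.mem_singleton]
  tauto

/-- Read the part of the input that belongs to the vertex `x`. -/
def readVertex : Stmt :=
  .seq (.load Reg.limit Reg.scan) <| .seq (.add Reg.scan Reg.scan Reg.one) readEntries

theorem ok_readVertex {D : Digraph (Fin n)} {L : Fin n → List (Fin n)} {X : Fin n}
    {R : Fin n → Fin n → Prop} (hE : Env n σ) (hL : IsAdjacencyLists D L) (hD : IsLoopless D)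
    (hx : σ.reg Reg.x = X) (hscan : σ.reg Reg.scan = inputOffset L X)
    (hword : ∀ i ≤ n * n, σ.mem i = (inputWord L).getD i 0) (hR : IsMatrix σ.mem .adj R) :
    Ok (bound n) readVertex σ fun t τ => t ≤ 20 * n + 7 ∧
      τ.reg Reg.scan = inputOffset L (X + 1) ∧ AgreeOff n [.adj] σ.mem τ.mem ∧
      IsMatrix τ.mem .adj fun x y => R x y ∨ x = X ∧ D.Adj x y := by
  have hdeg := length_adjacencyList_lt hL hD X
  have hend : inputOffset L X + 1 + (L X).length ≤ n * n + 1 := by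
    have hle := inputOffset_le hL hD (Nat.succ_le_of_lt X.2)
    rw [inputOffset_succ] at hle
    exact hle.trans (by linarith [Nat.mul_le_mul_right n (Nat.succ_le_of_lt X.2)])
  refine .seq (.of_wp (.seq (.of_wp ⟨?_, ?_⟩)))
  · simp only [Store.setReg_reg, hscan, hE.one, bound, Reg.scan, Reg.limit, Reg.one,
      Nat.reduceEqDiff, ↓reduceIte, Order.add_one_le_iff]
    omega
  refine Ok.imp (ok_readEntries (X := X) (l := L X) (a := inputOffset L X + 1) ?_ ?_ ?_ ?_
    (fun i hi => ?_) hend hR) ?_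
  · simpa using hE
  · simpa using hx
  · simp [hscan, hE.one]
  · simpa [hscan, hword _ (show inputOffset L X ≤ n * n by omega)] using inputWord_getD_length X
  · simpa [hword _ (show inputOffset L X + 1 + i ≤ n * n by omega)] using inputWord_getD_entry hi
  · rintro t τ - - ⟨ht, hscan', hoff, hmat⟩
    refine ⟨by omega, by rw [hscan', inputOffset_succ], hoff, hmat.congr fun x y => ?_⟩
    rw [(hL X).2]
    exact or_congr_right (and_congr_right fun hxX => by rw [hxX])

/-- Convert the adjacency lists to an adjacency matrix. -/
def readInput : Stmt := .seq (.const Reg.scan 1) <| forLoop Reg.x Reg.size readVertex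

theorem ok_readInput {D : Digraph (Fin n)} {L : Fin n → List (Fin n)} (hE : Env n σ)
    (hL : IsAdjacencyLists D L) (hD : IsLoopless D)
    (hmem : ∀ i, σ.mem i = (inputWord L).getD i 0) :
    Ok (bound n) readInput σ fun t τ => t ≤ (23 * n + 20) * n + 10 ∧ IsMatrix τ.mem .adj D.Adj ∧
      AgreeOff n [.adj] σ.mem τ.mem := by
  refine .seq (.of_wp ⟨by unfold bound; omega, ?_⟩)
  refine ok_forLoop n (20 * n + 7) (fun j τ => τ.reg Reg.scan = inputOffset L j ∧
    AgreeOff n [.adj] σ.mem τ.mem ∧ IsMatrix (n := n) τ.mem .adj fun x y => x < j ∧ D.Adj x y)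
    (by decide) (by simpa using hE.one) (by simpa using hE.size)
    ⟨by simp [inputOffset_zero], .refl, fun x y => ?_⟩ ?_ fun t τ h _ ht => ?_
  · simpa [hmem, bit] using inputWord_getD_cell hL hD (by decide) _
  · rintro j hj τ ⟨hscan, hoff, hmat⟩ hx hframe
    obtain ⟨X, rfl⟩ : ∃ X : Fin n, (X : ℕ) = j := ⟨⟨j, hj⟩, rfl⟩
    refine (ok_readVertex (Env.frame (n := n) (by simpa using hE) hframe) hL hD hx hscan
      (fun i hi => ?_) hmat).imp ?_
    · rw [← hmem, ← cell_input (n := n) (p := i), hoff _ (by decide) _ hi]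
    · rintro t τ' - - ⟨ht, hscan', hoff', hmat'⟩
      refine ⟨ht, by simpa using hscan', hoff.trans hoff', hmat'.congr fun x y => ?_⟩
      rw [Nat.lt_succ_iff_lt_or_eq, ← Fin.ext_iff, or_and_right]
  · exact ⟨by linarith, h.2.2.congr fun x y => by simp, h.2.1⟩

end Input

/-! ### The queue of collected pairs -/

section Queue

variable {n : ℕ} {D : Digraph (Fin n)} {q q' : List (Fin n × Fin n)} {σ τ : Store}
  {X Y Z U V : Fin n}

/-- The relation that holds for the pairs in a list. -/
abbrev pairRel (q : List (Fin n × Fin n)) (x y : Fin n) : Prop := (x, y) ∈ q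

/-- The data of the main loop: the input matrix, the linked pairs, and the list `q` of the
collected pairs, both as a matrix and, in the order of their collection, as a queue. -/
structure Ready (D : Digraph (Fin n)) (σ : Store) (q : List (Fin n × Fin n)) : Prop where
  env : Env n σ
  adj : IsMatrix σ.mem .adj D.Adj
  linked : IsMatrix σ.mem .linked (Linked D)
  collected : IsMatrix σ.mem .collected (pairRel q)
  nodup : q.Nodup
  first : ∀ i (hi : i < q.length), σ.mem (cell n .first i) = q[i].1
  second : ∀ i (hi : i < q.length), σ.mem (cell n .second i) = q[i].2
  tail : σ.reg Reg.tail = q.length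

theorem Ready.length_le (h : Ready D σ q) : q.length ≤ n * n := by
  simpa using h.nodup.length_le_card

theorem Ready.frame (h : Ready D σ q) (hmem : τ.mem = σ.mem) {l : List ℕ}
    (hframe : ∀ r, r ∉ l → τ.reg r = σ.reg r)
    (hl : (∀ r ∈ l, Reg.address ≤ r) ∧ Reg.tail ∉ l := by decide) : Ready D τ q where
  env := h.env.frame hframe hl.1
  adj := hmem ▸ h.adj
  linked := hmem ▸ h.linked
  collected := hmem ▸ h.collected
  nodup := h.nodup
  first := hmem ▸ h.first
  second := hmem ▸ h.second
  tail := (hframe _ hl.2).trans h.tail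

theorem Ready.setReg (h : Ready D σ q) {r v : ℕ}
    (hr : Reg.address ≤ r ∧ Reg.tail ≠ r := by decide) : Ready D (σ.setReg r v) q :=
  h.frame rfl (l := [r]) (fun i hi => by rw [Store.setReg_reg, if_neg (by simpa using hi)])
    (by simpa using hr)

theorem Ready.append (h : Ready D σ q) (hnew : (X, Y) ∉ q) (hlt : q.length < n * n) (hE : Env n τ)
    (hmem : τ.mem = Function.update (Function.update
      (Function.update σ.mem (cell n .collected (X * n + Y)) 1) (cell n .first q.length) X)
      (cell n .second q.length) Y)
    (htail : τ.reg Reg.tail = q.length + 1) : Ready D τ (q ++ [(X, Y)]) := by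
  have hoff : AgreeOff n [.collected, .first, .second] σ.mem τ.mem :=
    hmem ▸ ((AgreeOff.refl.update (by decide) (index_lt X Y).le _).update (by decide) hlt.le
      _).update (by decide) hlt.le _
  have hentry : ∀ i < q.length + 1, i ≤ n * n := by omega
  refine ⟨hE, h.adj.agreeOff hoff, h.linked.agreeOff hoff, ?_, ?_, ?_, ?_, by simpa using htail⟩
  · rw [hmem]
    refine (((h.collected.update X Y).agreeOff (AgreeOff.refl.update (bs := [.first])
      (by decide) hlt.le _)).agreeOff (AgreeOff.refl.update (bs := [.second]) (by decide) hlt.le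
      _)).congr fun x y => ?_
    simp
  · exact List.concat_eq_append ▸ h.nodup.concat hnew
  all_goals
    intro i hi
    rw [List.length_append, List.length_singleton] at hi
    rw [hmem, update_cell hlt.le (hentry i hi), update_cell hlt.le (hentry i hi),
      update_cell (index_lt X Y).le (hentry i hi)]
    rcases Nat.lt_succ_iff_lt_or_eq.1 hi with hi | rfl
    · simp [hi, hi.ne, h.first, h.second]
    · simp

/-- Collect the pair in the registers `x` and `y`. -/
def push (x y : ℕ) : Stmt :=
  .seq (setCell .collected x y Reg.one) <| .seq (setAt .first Reg.tail x) <|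
  .seq (setAt .second Reg.tail y) (.add Reg.tail Reg.tail Reg.one)

theorem ok_push {x y : ℕ} (h : Ready D σ q) (hx : σ.reg x = X) (hy : σ.reg y = Y)
    (hnew : (X, Y) ∉ q) (hne : x ≠ Reg.address ∧ y ≠ Reg.address := by decide) :
    Ok (bound n) (push x y) σ fun t τ => t ≤ 20 ∧ Ready D τ (q ++ [(X, Y)]) := by
  have hlt : q.length < n * n := by
    simpa using (List.concat_eq_append ▸ h.nodup.concat hnew : (q ++ [(X, Y)]).Nodup).length_le_card
  have hone : σ.reg 3 = 1 := h.env.one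
  have htail : σ.reg 29 = q.length := h.tail
  have hbound : q.length + 1 ≤ bound n := by unfold bound; omega
  refine .seq (ok_setCell h.env hx hy ?_ ⟨hne.2, by decide⟩)
  refine .seq (ok_setAt (p := q.length) (by simpa using h.env) (by simpa using h.tail) hlt.le ?_
    hne.1)
  refine .seq (ok_setAt (p := q.length) (by simpa using h.env) (by simpa using h.tail) hlt.le ?_
    hne.2)
  refine .of_wp ⟨by simpa [hone, htail] using hbound, by omega, h.append hnew hlt
    (by simpa using h.env) ?_ (by simp [hone, htail])⟩
  simp only [Reg.address] at hne
  simp [hone, hx, hy, hne]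

/-- If the pairs in the registers `(x, y)` and `(x, z)` force each other, collect the pair in the
registers `u` and `v`. -/
def linkPush (x y z u v : ℕ) : Stmt :=
  .seq (linkTest x y z) <| .ite (.eq Reg.link Reg.zero) .skip <|
    .seq (getCell Reg.bit .collected u v) <| .ite (.eq Reg.bit Reg.zero) (push u v) .skip

theorem ok_linkPush {x y z u v : ℕ} (h : Ready D σ q) (hx : σ.reg x = X) (hy : σ.reg y = Y)
    (hz : σ.reg z = Z) (hu : σ.reg u = U) (hv : σ.reg v = V)
    (hregs : (Reg.x ≤ x ∧ Reg.x ≤ y ∧ Reg.x ≤ z) ∧ Reg.x ≤ u ∧ Reg.x ≤ v := by decide) :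
    Ok (bound n) (linkPush x y z u v) σ fun t τ => t ≤ 120 ∧ ∃ q', Ready D τ q' ∧ q <+: q' ∧
      (∀ p ∈ q', p ∈ q ∨ p = (U, V) ∧ Link D X Y Z) ∧ (Link D X Y Z → (U, V) ∈ q') := by
  have hkeep : ∀ {r}, Reg.x ≤ r → r ∉ (linkTest x y z).writes := fun hr hmem =>
    (mem_writes_linkTest hmem).2.not_ge hr
  obtain ⟨hxyz, hu_le, hv_le⟩ := hregs
  refine .seq ((ok_linkTest h.env h.adj hx hy hz hxyz).imp ?_)
  rintro t τ - hframe ⟨ht, hmem, hlink⟩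
  have hτ : Ready D τ q := h.frame hmem hframe
    ⟨fun r hr => (mem_writes_linkTest hr).1, hkeep (by decide)⟩
  rw [← hframe u (hkeep hu_le)] at hu
  rw [← hframe v (hkeep hv_le)] at hv
  refine .ite (fun hnone => .skip ?_) fun hsome => ?_
  · have hnone : ¬ Link D X Y Z := hlink.1 (by simpa [Test.eval, hτ.env.zero] using hnone)
    exact ⟨by omega, q, hτ, List.prefix_rfl, fun p hp => .inl hp, fun hl => absurd hl hnone⟩
  have hsome : Link D X Y Z := by simpa [Test.eval, hτ.env.zero, hlink] using hsome
  have hne : ∀ r < Reg.x, u ≠ r ∧ v ≠ r := by grind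
  refine .seq (ok_getCell hτ.env hτ.collected hu hv ?_ (hne _ (by decide)).2)
  refine .ite (fun hnew => ?_) fun hold => .skip ⟨by omega, q, hτ.setReg.setReg, List.prefix_rfl,
    fun p hp => .inl hp, fun _ => ?_⟩
  · have hnew : (U, V) ∉ q := by simpa [Test.eval, hτ.env.zero] using hnew
    refine Ok.imp (ok_push (X := U) (Y := V) hτ.setReg.setReg ?_ ?_ hnew ?_) ?_
    · simpa [hne] using hu
    · simpa [hne] using hv
    · exact hne _ (by decide)
    rintro t' ρ - - ⟨ht', hρ⟩
    refine ⟨by omega, _, hρ, List.prefix_append _ _, fun p hp => ?_, fun _ => by simp⟩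
    rw [List.mem_append, List.mem_singleton] at hp
    exact hp.imp_right fun hp => ⟨hp, hsome⟩
  · simpa [Test.eval, hτ.env.zero] using hold

/-- Everything that is directly forced by a pair in `l` is in `q`. -/
def Processed (D : Digraph (Fin n)) (l q : List (Fin n × Fin n)) : Prop :=
  ∀ p ∈ l, ∀ p', DirectlyForces D p p' → p' ∈ q

theorem Processed.mono {l : List (Fin n × Fin n)} (h : Processed D l q) (hq : q <+: q') :
    Processed D l q' :=
  fun p hp p' hforces => hq.subset (h p hp p' hforces)

theorem Processed.take_succ {i : ℕ} (h : Processed D (q.take i) q) (hi : i < q.length)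
    (hq : q <+: q') (hforced : ∀ p, DirectlyForces D q[i] p → p ∈ q') :
    Processed D (q'.take (i + 1)) q' := by
  obtain ⟨l, rfl⟩ := hq
  rw [List.take_append_of_le_length hi, List.take_succ_eq_append_getElem hi]
  refine List.forall_mem_append.2 ⟨h.mono (List.prefix_append _ _), ?_⟩
  simpa using hforced

theorem Processed.mem_of_sameClass (h : Processed D q q) {p p' : Fin n × Fin n}
    (hclass : SameClass D p p') (hp : p ∈ q) : p' ∈ q := by
  induction hclass with
  | single hforces => exact h _ hp _ hforces
  | tail _ hforces ih => exact h _ ih _ hforces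

/-- Collect all pairs that are directly forced by the entry number `reg head` of the queue. -/
def processEntry : Stmt :=
  .seq (getAt Reg.x .first Reg.head) <| .seq (getAt Reg.y .second Reg.head) <|
  .seq (forLoop Reg.z Reg.size (.seq (linkPush Reg.x Reg.y Reg.z Reg.x Reg.z)
    (linkPush Reg.y Reg.x Reg.z Reg.z Reg.y))) (.add Reg.head Reg.head Reg.one)

/-- A bound for the time of one pass through the loops over the queue. -/
def unitCost (n : ℕ) : ℕ := 1000 * (n + 1)

theorem ok_pushForced (h : Ready D σ q) (hx : σ.reg Reg.x = X) (hy : σ.reg Reg.y = Y)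
    (hXY : (X, Y) ∈ q) :
    Ok (bound n) (forLoop Reg.z Reg.size (.seq (linkPush Reg.x Reg.y Reg.z Reg.x Reg.z)
      (linkPush Reg.y Reg.x Reg.z Reg.z Reg.y))) σ fun t τ => t ≤ 253 * n + 3 ∧
      ∃ q', Ready D τ q' ∧ q <+: q' ∧ (∀ p ∈ q', p ∈ q ∨ DirectlyForces D (X, Y) p) ∧
        ∀ p, DirectlyForces D (X, Y) p → p ∈ q' := by
  refine ok_forFin 250 (fun P τ => ∃ q', Ready D τ q' ∧ q <+: q' ∧
    (∀ p ∈ q', p ∈ q ∨ DirectlyForces D (X, Y) p) ∧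
    ∀ z ∈ P, (Link D X Y z → (X, z) ∈ q') ∧ (Link D Y X z → (z, Y) ∈ q'))
    (fun P τ v ⟨q', hτ, hq'⟩ => ⟨q', hτ.setReg, hq'⟩) (by decide) h.env
    ⟨q, h, List.prefix_rfl, fun p hp => .inl hp, by simp⟩ ?_ ?_
  · rintro P Z τ ⟨q₁, hτ, hpre, hsub, hdone⟩ hz hframe
    rw [← hframe Reg.x (by decide)] at hx
    rw [← hframe Reg.y (by decide)] at hy
    refine .seq ((ok_linkPush hτ hx hy hz hx hz).imp ?_)
    rintro t₁ τ₁ - hframe₁ ⟨ht₁, q₂, hτ₁, hpre₁, hsub₁, hin₁⟩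
    rw [← hframe₁ Reg.x (by decide)] at hx
    rw [← hframe₁ Reg.y (by decide)] at hy
    rw [← hframe₁ Reg.z (by decide)] at hz
    refine (ok_linkPush hτ₁ hy hx hz hz hy).imp ?_
    rintro t₂ τ₂ - - ⟨ht₂, q₃, hτ₂, hpre₂, hsub₂, hin₂⟩
    refine ⟨by omega, q₃, hτ₂, hpre.trans (hpre₁.trans hpre₂), fun p hp => ?_, ?_⟩
    · rcases hsub₂ p hp with hp | ⟨rfl, hlink⟩
      · rcases hsub₁ p hp with hp | ⟨rfl, hlink⟩
        · exact hsub p hp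
        · exact .inr (directlyForces_iff.2 (.inr (.inl ⟨rfl, hlink⟩)))
      · exact .inr (directlyForces_iff.2 (.inr (.inr ⟨rfl, hlink⟩)))
    · refine Set.forall_mem_insert.2
        ⟨⟨fun hlink => hpre₂.subset (hin₁ hlink), hin₂⟩, fun z hz => ?_⟩
      exact ⟨fun hlink => hpre₂.subset (hpre₁.subset ((hdone z hz).1 hlink)),
        fun hlink => hpre₂.subset (hpre₁.subset ((hdone z hz).2 hlink))⟩
  · rintro t τ ⟨q', hτ, hpre, hsub, hdone⟩ - ht
    refine ⟨ht, q', hτ, hpre, hsub, fun ⟨x, y⟩ hforces => ?_⟩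
    rcases directlyForces_iff.1 hforces with ⟨heq, -⟩ | ⟨heq, hlink⟩ | ⟨heq, hlink⟩
    · exact heq ▸ hpre.subset hXY
    · obtain rfl : X = x := heq
      exact (hdone y trivial).1 hlink
    · obtain rfl : Y = y := heq
      exact (hdone x trivial).2 hlink

theorem ok_processEntry (h : Ready D σ q) (hlt : σ.reg Reg.head < q.length)
    (hprocessed : Processed D (q.take (σ.reg Reg.head)) q) :
    Ok (bound n) processEntry σ fun t τ => t + 1 ≤ unitCost n ∧ ∃ q', Ready D τ q' ∧ q <+: q' ∧
      τ.reg Reg.head = σ.reg Reg.head + 1 ∧ Processed D (q'.take (τ.reg Reg.head)) q' ∧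
      ∀ p ∈ q', p ∈ q ∨ DirectlyForces D q[σ.reg Reg.head] p := by
  have hlength := h.length_le
  have hfirst := h.first _ hlt
  have hsecond := h.second _ hlt
  refine .seq (ok_getAt h.env rfl (by omega) ?_)
  refine .seq (ok_getAt (p := σ.reg Reg.head) (by simpa using h.env) (by simp) (by omega) ?_)
  refine .seq ?_
  refine Ok.imp (ok_pushForced (X := q[σ.reg Reg.head].1) (Y := q[σ.reg Reg.head].2)
    h.setReg.setReg.setReg.setReg ?_ ?_ (List.getElem_mem hlt)) ?_
  · simpa using hfirst
  · simpa using hsecond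
  rintro t τ - hframe ⟨ht, q', hτ, hpre, hsub, hforced⟩
  have hhead : τ.reg Reg.head = σ.reg Reg.head := (hframe _ (by decide)).trans (by simp)
  refine .of_wp ⟨?_, by unfold unitCost; omega, q', hτ.setReg, hpre, ?_, ?_, hsub⟩
  · rw [hhead, hτ.env.one]
    unfold bound
    omega
  · rw [Store.setReg_reg, if_pos rfl, hhead, hτ.env.one]
  · rw [Store.setReg_reg, if_pos rfl, hhead, hτ.env.one]
    exact hprocessed.take_succ hlt hpre hforced

/-- Close the queue under direct forcing. -/
def closeQueue : Stmt := .loop (.lt Reg.head Reg.tail) processEntry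

theorem ok_closeQueue {s : Fin n × Fin n} (h : Ready D σ (q ++ [s]))
    (hhead : σ.reg Reg.head = q.length) (hprocessed : Processed D q q) (hs : s ∈ pairs D) :
    Ok (bound n) closeQueue σ fun t τ => ∃ q', Ready D τ q' ∧ q ++ [s] <+: q' ∧
      τ.reg Reg.head = q'.length ∧ Processed D q' q' ∧ (∀ p, p ∈ q' ↔ p ∈ q ∨ SameClass D s p) ∧
      unitCost n * q.length + t ≤ unitCost n * q'.length + 1 := by
  refine Ok.loop (fun τ => ∃ q', Ready D τ q' ∧ q ++ [s] <+: q' ∧ τ.reg Reg.head ≤ q'.length ∧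
    Processed D (q'.take (τ.reg Reg.head)) q' ∧ ∀ p ∈ q', p ∈ q ∨ SameClass D s p)
    (fun τ => unitCost n * τ.reg Reg.head) (unitCost n * (n * n)) ?_ ?_ ?_ ?_
  · rintro τ ⟨q', hτ, -, hle, -⟩
    exact Nat.mul_le_mul_left _ (hle.trans hτ.length_le)
  · rintro τ ⟨q₁, hτ, hpre, -, hprocessed₁, hsub⟩ hlt -
    rw [Test.eval, decide_eq_true_eq, hτ.tail] at hlt
    refine (ok_processEntry hτ hlt hprocessed₁).imp ?_
    rintro t τ' - - ⟨ht, q₂, hτ', hpre', hhead', hprocessed₂, hsub'⟩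
    have hle : τ'.reg Reg.head ≤ q₂.length := hhead' ▸ hlt.trans_le hpre'.length_le
    refine ⟨⟨q₂, hτ', hpre.trans hpre', hle, hprocessed₂, fun p hp => ?_⟩, ?_⟩
    · rcases hsub' p hp with hp | hforces
      · exact hsub p hp
      · exact (hsub _ (List.getElem_mem hlt)).imp (fun hmem => hprocessed _ hmem _ hforces)
          fun hclass => hclass.tail hforces
    · rw [hhead', Nat.mul_succ]
      omega
  · refine ⟨_, h, List.prefix_rfl, by simp [hhead], ?_, fun p hp => ?_⟩
    · rw [hhead, List.take_left]
      exact hprocessed.mono (List.prefix_append _ _)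
    · rw [List.mem_append, List.mem_singleton] at hp
      rcases hp with hp | rfl
      exacts [.inl hp, .inr (.refl hs)]
  · rintro t τ ⟨q', hτ, hpre, hle, hprocessed', hsub⟩ hge - ht
    rw [Test.eval, decide_eq_false_iff_not, hτ.tail] at hge
    have hhead' : τ.reg Reg.head = q'.length := by omega
    rw [hhead', List.take_length] at hprocessed'
    rw [hhead, hhead'] at ht
    refine ⟨q', hτ, hpre, hhead', hprocessed', fun p => ⟨hsub p, ?_⟩, ht⟩
    rintro (hp | hclass)
    · exact hpre.subset (by simp [hp])
    · exact hprocessed'.mem_of_sameClass hclass (hpre.subset (by simp))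

end Queue

/-! ### The search for the next class -/

section Search

variable {n : ℕ} {D : Digraph (Fin n)} {q q' : List (Fin n × Fin n)} {σ τ : Store}
  {P : Fin n → Fin n → Prop} {X Y U V : Fin n}

theorem Uncollected.of_prefix (h : Uncollected D (pairRel q') X Y) (hq : q <+: q') :
    Uncollected D (pairRel q) X Y where
  linked := h.linked
  not_forward := fun hmem => h.not_forward (hq.subset hmem)
  not_backward := fun hmem => h.not_backward (hq.subset hmem)

/-- `reg bit` becomes zero if and only if the pair in the registers `u` and `v` is not
uncollected. -/
def uncollectedTest (u v : ℕ) : Stmt :=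
  .seq (getCell Reg.bit .linked u v) <|
  .seq (getCell Reg.bit' .collected u v) <| .seq (.sub Reg.bit Reg.bit Reg.bit') <|
  .seq (getCell Reg.bit' .collected v u) (.sub Reg.bit Reg.bit Reg.bit')

theorem mem_writes_uncollectedTest {r u v : ℕ} (h : r ∈ (uncollectedTest u v).writes) :
    Reg.address ≤ r ∧ r < Reg.x := by
  simp only [uncollectedTest, getCell, Stmt.writes, List.cons_append, List.nil_append,
    List.mem_cons, List.not_mem_nil, or_false] at h
  have : r = Reg.address ∨ r = Reg.bit ∨ r = Reg.bit' := by tauto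
  rcases this with rfl | rfl | rfl <;> decide

theorem ok_uncollectedTest {u v : ℕ} (h : Ready D σ q) (hu : σ.reg u = U) (hv : σ.reg v = V)
    (hregs : Reg.x ≤ u ∧ Reg.x ≤ v) :
    Ok (bound n) (uncollectedTest u v) σ fun t τ => t ≤ 30 ∧ τ.mem = σ.mem ∧
      (τ.reg Reg.bit = 0 ↔ ¬ Uncollected D (pairRel q) U V) := by
  have hne : ∀ r < Reg.x, u ≠ r ∧ v ≠ r := by grind
  have hval : bit (Linked D U V) - bit (pairRel q U V) - bit (pairRel q V U) = 0 ↔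
      ¬ Uncollected D (pairRel q) U V := by
    have hiff : Uncollected D (pairRel q) U V ↔
        Linked D U V ∧ ¬ pairRel q U V ∧ ¬ pairRel q V U :=
      ⟨fun h => ⟨h.linked, h.not_forward, h.not_backward⟩, fun h => ⟨h.1, h.2.1, h.2.2⟩⟩
    rw [hiff]
    unfold bit
    split_ifs <;> simp_all
  refine .seq (ok_getCell h.env h.linked hu hv ?_ (hne _ (by decide)).2)
  refine .seq (ok_getCell (X := U) (Y := V) (by simpa using h.env) h.collected (by simp [hne, hu])
    (by simp [hne, hv]) ?_ (hne _ (by decide)).2)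
  refine .seq (.of_wp ?_)
  refine .seq (ok_getCell (X := V) (Y := U) (by simpa using h.env) h.collected (by simp [hne, hv])
    (by simp [hne, hu]) ?_ (hne _ (by decide)).1)
  exact .of_wp ⟨by omega, rfl, by simpa using hval⟩

/-- If the pair in the registers `u` and `v` is uncollected, note it as a seed. -/
def noteIfUncollected (u v : ℕ) : Stmt :=
  .seq (uncollectedTest u v) <| .ite (.eq Reg.bit Reg.zero) .skip <|
    .seq (.const Reg.found 1) <| .seq (.move Reg.seedX u) (.move Reg.seedY v)

/-- If a seed has been found, then it satisfies `P`. -/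
def Noted (P : Fin n → Fin n → Prop) (σ : Store) : Prop :=
  σ.reg Reg.found = 0 ∨
    σ.reg Reg.found = 1 ∧ ∃ x y : Fin n, σ.reg Reg.seedX = x ∧ σ.reg Reg.seedY = y ∧ P x y

theorem Noted.le_one (h : Noted P σ) : σ.reg Reg.found ≤ 1 := by
  rcases h with h | ⟨h, -⟩ <;> omega

theorem Noted.congr (h : Noted P σ) (hfound : τ.reg Reg.found = σ.reg Reg.found)
    (hX : τ.reg Reg.seedX = σ.reg Reg.seedX) (hY : τ.reg Reg.seedY = σ.reg Reg.seedY) :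
    Noted P τ := by
  unfold Noted
  rwa [hfound, hX, hY]

theorem Noted.setReg (h : Noted P σ) {r v : ℕ}
    (hr : Reg.found ≠ r ∧ Reg.seedX ≠ r ∧ Reg.seedY ≠ r := by decide) :
    Noted P (σ.setReg r v) :=
  h.congr ((Store.setReg_reg ..).trans (if_neg hr.1)) ((Store.setReg_reg ..).trans (if_neg hr.2.1))
    ((Store.setReg_reg ..).trans (if_neg hr.2.2))

theorem ok_noteIfUncollected {u v : ℕ} (h : Ready D σ q) (hu : σ.reg u = U) (hv : σ.reg v = V)
    (hN : Noted P σ) (hP : Uncollected D (pairRel q) U V → P U V)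
    (hregs : (Reg.x ≤ u ∧ u < Reg.found) ∧ Reg.x ≤ v ∧ v < Reg.found := by decide) :
    Ok (bound n) (noteIfUncollected u v) σ fun t τ => t ≤ 40 ∧ τ.mem = σ.mem ∧ Noted P τ ∧
      (τ.reg Reg.found = 0 → σ.reg Reg.found = 0 ∧ ¬ Uncollected D (pairRel q) U V) := by
  have hkeep : ∀ {r}, Reg.x ≤ r → r ∉ (uncollectedTest u v).writes := fun hr hmem =>
    (mem_writes_uncollectedTest hmem).2.not_ge hr
  have hne : ∀ r, Reg.found ≤ r → u ≠ r ∧ v ≠ r := by grind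
  refine .seq ((ok_uncollectedTest h hu hv ⟨hregs.1.1, hregs.2.1⟩).imp ?_)
  rintro t τ - hframe ⟨ht, hmem, hbit⟩
  have hτ : Ready D τ q := h.frame hmem hframe
    ⟨fun r hr => (mem_writes_uncollectedTest hr).1, hkeep (by decide)⟩
  have hfound : τ.reg Reg.found = σ.reg Reg.found := hframe _ (hkeep (by decide))
  rw [← hframe u (hkeep hregs.1.1)] at hu
  rw [← hframe v (hkeep hregs.2.1)] at hv
  refine .ite (fun hno => .skip ?_) fun hyes => ?_
  · have hno : ¬ Uncollected D (pairRel q) U V :=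
      hbit.1 (by simpa [Test.eval, hτ.env.zero] using hno)
    exact ⟨by omega, hmem, hN.congr hfound (hframe _ (hkeep (by decide)))
      (hframe _ (hkeep (by decide))), fun h0 => ⟨hfound ▸ h0, hno⟩⟩
  · have hyes : Uncollected D (pairRel q) U V := by
      simpa [Test.eval, hτ.env.zero, hbit] using hyes
    refine .of_wp ⟨?_, by omega, hmem, .inr ⟨by simp, U, V, ?_, ?_, hP hyes⟩, by simp⟩
    · unfold bound
      omega
    · simp [hne, hu]
    · simp [hne, hv]

/-- If the pair in the registers `a` and `b` is collected and the pair in the registers `u` and `v`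
is uncollected, note the latter as a seed. -/
def noteIfImplied (a b u v : ℕ) : Stmt :=
  .seq (getCell Reg.bit .collected a b) <|
    .ite (.eq Reg.bit Reg.zero) .skip (noteIfUncollected u v)

theorem ok_noteIfImplied {a b u v : ℕ} (h : Ready D σ q) (ha : σ.reg a = X) (hb : σ.reg b = Y)
    (hu : σ.reg u = U) (hv : σ.reg v = V) (hN : Noted P σ)
    (hP : (X, Y) ∈ q → Uncollected D (pairRel q) U V → P U V)
    (hregs : ((Reg.x ≤ u ∧ u < Reg.found) ∧ Reg.x ≤ v ∧ v < Reg.found) ∧ b ≠ Reg.address := by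
      decide) :
    Ok (bound n) (noteIfImplied a b u v) σ fun t τ => t ≤ 50 ∧ τ.mem = σ.mem ∧ Noted P τ ∧
      (τ.reg Reg.found = 0 → σ.reg Reg.found = 0 ∧
        ((X, Y) ∈ q → ¬ Uncollected D (pairRel q) U V)) := by
  have hne : ∀ r < Reg.x, u ≠ r ∧ v ≠ r := by grind
  refine .seq (ok_getCell h.env h.collected ha hb ?_ hregs.2)
  refine .ite (fun hno => .skip ⟨by omega, rfl, hN.setReg.setReg, fun hfound => ?_⟩) fun hyes => ?_
  · have hno : (X, Y) ∉ q := by simpa [Test.eval, h.env.zero] using hno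
    exact ⟨by simpa using hfound, fun hmem => absurd hmem hno⟩
  · have hyes : (X, Y) ∈ q := by simpa [Test.eval, h.env.zero] using hyes
    refine Ok.imp (ok_noteIfUncollected (U := U) (V := V) h.setReg.setReg ?_ ?_ hN.setReg.setReg
      (hP hyes) hregs.1) ?_
    · simp [hne, hu]
    · simp [hne, hv]
    rintro t τ - - ⟨ht, hmem, hNτ, hnone⟩
    exact ⟨by omega, hmem, hNτ, fun hfound => ⟨by simpa using (hnone hfound).1,
      fun _ => (hnone hfound).2⟩⟩

theorem ok_forNote {s : Stmt} {c : ℕ} {Bad : Fin n → Prop} (h : Ready D σ q) (hN : Noted P σ)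
    (hregs : (Reg.z ∉ s.writes ∧ Reg.size ∉ s.writes ∧ Reg.one ∉ s.writes) ∧
      (∀ r ∈ s.writes, Reg.address ≤ r) ∧ Reg.tail ∉ s.writes)
    (hstep : ∀ (Z : Fin n) τ, Ready D τ q → Noted P τ → τ.reg Reg.z = Z →
      (∀ r, r ∉ Reg.z :: s.writes → τ.reg r = σ.reg r) →
      Ok (bound n) s τ fun t τ' => t ≤ c ∧ τ'.mem = τ.mem ∧ Noted P τ' ∧
        (τ'.reg Reg.found = 0 → τ.reg Reg.found = 0 ∧ ¬ Bad Z)) :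
    Ok (bound n) (forLoop Reg.z Reg.size s) σ fun t τ => t ≤ (c + 3) * n + 3 ∧ τ.mem = σ.mem ∧
      Noted P τ ∧ (τ.reg Reg.found = 0 → ∀ z, ¬ Bad z) := by
  obtain ⟨⟨hz, hsize, hone⟩, haddress, htail⟩ := hregs
  refine ok_forFin c (fun S τ => τ.mem = σ.mem ∧ Noted P τ ∧
    (τ.reg Reg.found = 0 → ∀ z ∈ S, ¬ Bad z)) ?_ ⟨hz, hsize, hone, by decide, by decide⟩ h.env
    ⟨rfl, hN, by simp⟩ ?_ fun t τ ⟨hmem, hNτ, hnone⟩ _ ht =>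
      ⟨ht, hmem, hNτ, fun hfound z => hnone hfound z trivial⟩
  · exact fun S τ v ⟨hmem, hNτ, hnone⟩ => ⟨hmem, hNτ.setReg, by simpa using hnone⟩
  · rintro S Z τ ⟨hmem, hNτ, hnone⟩ hZ hframe
    have hτ : Ready D τ q := h.frame hmem hframe
      ⟨List.forall_mem_cons.2 ⟨by decide, haddress⟩, by simp [htail]⟩
    refine (hstep Z τ hτ hNτ hZ hframe).imp ?_
    rintro t τ' - - ⟨ht, hmem', hN', hnone'⟩
    refine ⟨ht, hmem'.trans hmem, hN', fun hfound => ?_⟩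
    obtain ⟨hfound, hZ⟩ := hnone' hfound
    exact Set.forall_mem_insert.2 ⟨hZ, hnone hfound⟩

/-- One pass of a search at position `reg pos`: if `s` finds no seed, go on to the next position,
otherwise halt. -/
def searchStep (pos : ℕ) (s : Stmt) : Stmt :=
  .seq s <| .ite (.eq Reg.found Reg.zero) (.add pos pos Reg.one) (.const Reg.limit 0)

/-- Search from position `reg pos` on, up to position `reg len`, until `s` finds a seed. -/
def searchLoop (pos len : ℕ) (s : Stmt) : Stmt :=
  .seq (.move Reg.limit len) (.loop (.lt pos Reg.limit) (searchStep pos s))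

theorem ok_searchStep {pos j N : ℕ} {s : Stmt} {Excluded : ℕ → Prop} (h : Ready D σ q)
    (hpos : σ.reg pos = j) (hj : j < N) (hN : N ≤ n * n) (hlimit : σ.reg Reg.limit = N)
    (hregs : (∀ r ∈ s.writes, Reg.address ≤ r ∧ r ≠ pos ∧ r ≠ Reg.tail ∧ r ≠ Reg.limit) ∧
      (pos = Reg.scan ∨ pos = Reg.row)) (hExcluded : Excluded j)
    (hs : Ok (bound n) s σ fun t τ => t + 4 ≤ unitCost n ∧ τ.mem = σ.mem ∧ Noted P τ ∧
      (τ.reg Reg.found = 0 → Excluded (j + 1))) :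
    Ok (bound n) (searchStep pos s) σ fun t τ => t + 1 ≤ unitCost n ∧ τ.mem = σ.mem ∧ Noted P τ ∧
      (τ.reg Reg.limit = if τ.reg Reg.found = 0 then N else 0) ∧
      τ.reg pos + τ.reg Reg.found = j + 1 ∧ Excluded (τ.reg pos) := by
  obtain ⟨hwrites, hpos_eq⟩ := hregs
  have hpos_ne : pos ≠ Reg.limit ∧ Reg.limit ≠ pos ∧ pos ≠ Reg.found ∧ Reg.found ≠ pos ∧
      Reg.seedX ≠ pos ∧ Reg.seedY ≠ pos := by rcases hpos_eq with rfl | rfl <;> decide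
  refine .seq (hs.imp ?_)
  rintro t τ - hframe ⟨ht, hmem, hNτ, hnext⟩
  have hτ : Ready D τ q := h.frame hmem hframe
    ⟨fun r hr => (hwrites r hr).1, fun hr => (hwrites _ hr).2.2.1 rfl⟩
  rw [← hframe pos fun hr => (hwrites _ hr).2.1 rfl] at hpos
  rw [← hframe Reg.limit fun hr => (hwrites _ hr).2.2.2 rfl] at hlimit
  refine .ite (fun hzero => ?_) fun hone => ?_
  · have hzero : τ.reg Reg.found = 0 := by simpa [Test.eval, hτ.env.zero] using hzero
    have hsum : τ.reg pos + τ.reg Reg.one = j + 1 := by rw [hpos, hτ.env.one]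
    refine .of_wp ⟨?_, by omega, hmem, hNτ.setReg hpos_ne.2.2.2, ?_, ?_, ?_⟩
    · unfold bound
      omega
    all_goals simp [hpos_ne, hsum, hzero, hlimit, hnext]
  · have hone : τ.reg Reg.found = 1 :=
      (hNτ.resolve_left (by simpa [Test.eval, hτ.env.zero] using hone)).1
    refine .of_wp ⟨Nat.zero_le _, by omega, hmem, hNτ.setReg, ?_, ?_, ?_⟩
    all_goals simp [hpos_ne, hone, hpos, hExcluded]

theorem ok_searchLoop {pos len N : ℕ} {s : Stmt} {Excluded : ℕ → Prop} (h : Ready D σ q)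
    (hfound : σ.reg Reg.found = 0) (hlen : σ.reg len = N) (hN : N ≤ n * n)
    (hpos : σ.reg pos ≤ N) (hExcluded : Excluded (σ.reg pos))
    (hregs : (∀ r ∈ s.writes, Reg.address ≤ r ∧ r ≠ pos ∧ r ≠ Reg.tail ∧ r ≠ Reg.limit) ∧
      (pos = Reg.scan ∨ pos = Reg.row))
    (hstep : ∀ τ, Ready D τ q → τ.reg pos < N → τ.reg Reg.found = 0 → Excluded (τ.reg pos) →
      Ok (bound n) s τ fun t τ' => t + 4 ≤ unitCost n ∧ τ'.mem = τ.mem ∧ Noted P τ' ∧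
        (τ'.reg Reg.found = 0 → Excluded (τ.reg pos + 1))) :
    Ok (bound n) (searchLoop pos len s) σ fun t τ => τ.mem = σ.mem ∧ τ.reg pos ≤ N ∧ Noted P τ ∧
      Excluded (τ.reg pos) ∧ (τ.reg Reg.found = 0 → τ.reg pos = N) ∧
      unitCost n * σ.reg pos + t ≤ unitCost n * (τ.reg pos + τ.reg Reg.found) + 3 := by
  have hpos_ne : pos ≠ Reg.limit := by rcases hregs.2 with rfl | rfl <;> decide
  have hframe_regs : (∀ r ∈ (searchStep pos s).writes, Reg.address ≤ r) ∧
      Reg.tail ∉ (searchStep pos s).writes := by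
    simp only [searchStep, Stmt.writes, List.mem_append, List.mem_singleton]
    grind
  have hstart : (σ.setReg Reg.limit (σ.reg len)).reg pos +
      (σ.setReg Reg.limit (σ.reg len)).reg Reg.found = σ.reg pos := by
    rw [Store.setReg_reg, if_neg hpos_ne, Store.setReg_reg, if_neg (by decide), hfound, add_zero]
  refine .seq (.of_wp ?_)
  refine Ok.loop (fun τ => τ.mem = σ.mem ∧ Noted P τ ∧
    (τ.reg Reg.limit = if τ.reg Reg.found = 0 then N else 0) ∧ τ.reg pos ≤ N ∧
    Excluded (τ.reg pos)) (fun τ => unitCost n * (τ.reg pos + τ.reg Reg.found))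
    (unitCost n * (n * n + 1)) ?_ ?_ ?_ ?_
  · rintro τ ⟨-, hNτ, -, hle, -⟩
    exact Nat.mul_le_mul_left _ (Nat.add_le_add (hle.trans hN) hNτ.le_one)
  · rintro τ ⟨hmem, -, hlimit, -, hExcludedτ⟩ hlt hframe
    rw [Test.eval, decide_eq_true_eq, hlimit] at hlt
    have hzero : τ.reg Reg.found = 0 := by
      by_contra hne
      rw [if_neg hne] at hlt
      exact absurd hlt (Nat.not_lt_zero _)
    rw [if_pos hzero] at hlt hlimit
    have hτ : Ready D τ q := h.setReg.frame hmem hframe hframe_regs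
    refine (ok_searchStep hτ rfl hlt hN hlimit hregs hExcludedτ
      (hstep τ hτ hlt hzero hExcludedτ)).imp ?_
    rintro t τ' - - ⟨ht, hmem', hN', hlimit', hpos', hExcluded'⟩
    refine ⟨⟨hmem'.trans hmem, hN', hlimit', by omega, hExcluded'⟩, ?_⟩
    rw [hpos', hzero, add_zero, Nat.mul_succ]
    omega
  · exact ⟨rfl, .inl (by simpa using hfound), by simp [hlen, hfound], by simpa [hpos_ne] using hpos,
      by simpa [hpos_ne] using hExcluded⟩
  · rintro t τ ⟨hmem, hNτ, hlimit, hle, hExcludedτ⟩ hge - ht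
    rw [Test.eval, decide_eq_false_iff_not, hlimit] at hge
    refine ⟨hmem, hle, hNτ, hExcludedτ, fun hzero => ?_, ?_⟩
    · rw [if_pos hzero] at hge
      omega
    · rw [hstart] at ht
      omega

/-- No two entries of `l` imply a pair that the list `q` leaves uncollected. -/
def Scanned (D : Digraph (Fin n)) (l q : List (Fin n × Fin n)) : Prop :=
  ∀ p ∈ l, ∀ p' ∈ l, p.2 = p'.1 → ¬ Uncollected D (pairRel q) p.1 p'.2

theorem Scanned.mono {l : List (Fin n × Fin n)} (h : Scanned D l q) (hq : q <+: q') :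
    Scanned D l q' :=
  fun p hp p' hp' hpp' hfree => h p hp p' hp' hpp' (hfree.of_prefix hq)

theorem Scanned.stable (h : Scanned D q q) : Stable D (pairRel q) :=
  fun x y z hopen => h (x, y) hopen.first (y, z) hopen.second rfl hopen.toUncollected

/-- Look for an uncollected pair that is implied by the entry number `reg scan` of the queue and
another entry. -/
def scanEntry : Stmt :=
  .seq (getAt Reg.x .first Reg.scan) <| .seq (getAt Reg.y .second Reg.scan) <|
  forLoop Reg.z Reg.size <| .seq (noteIfImplied Reg.y Reg.z Reg.x Reg.z)
    (noteIfImplied Reg.z Reg.x Reg.z Reg.y)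

theorem Scanned.take_succ {i : ℕ} (h : Scanned D (q.take i) q) (hi : i < q.length)
    (hfirst : ∀ z, (q[i].2, z) ∈ q → ¬ Uncollected D (pairRel q) q[i].1 z)
    (hsecond : ∀ z, (z, q[i].1) ∈ q → ¬ Uncollected D (pairRel q) z q[i].2) :
    Scanned D (q.take (i + 1)) q := by
  rw [List.take_succ_eq_append_getElem hi]
  intro p hp p' hp' heq
  rw [List.mem_append, List.mem_singleton] at hp hp'
  have hmem : ∀ {p}, p ∈ q.take i ∨ p = q[i] → p ∈ q := by
    rintro p (hp | rfl)
    exacts [List.mem_of_mem_take hp, List.getElem_mem hi]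
  obtain rfl | hp₁ := hp.symm
  · exact hfirst _ (heq ▸ hmem hp')
  obtain rfl | hp₂ := hp'.symm
  · exact hsecond _ (heq ▸ hmem hp)
  · exact h p hp₁ p' hp₂ heq

/-- The pair `(x, y)` may be used as the next seed. -/
def IsSeed (D : Digraph (Fin n)) (q : List (Fin n × Fin n)) (x y : Fin n) : Prop :=
  Uncollected D (pairRel q) x y ∧
    ((∃ z, (x, z) ∈ q ∧ (z, y) ∈ q) ∨ Stable D (pairRel q))

theorem ok_scanEntry (h : Ready D σ q) (hlt : σ.reg Reg.scan < q.length)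
    (hscanned : Scanned D (q.take (σ.reg Reg.scan)) q) (hfound : σ.reg Reg.found = 0) :
    Ok (bound n) scanEntry σ fun t τ => t + 4 ≤ unitCost n ∧ τ.mem = σ.mem ∧
      Noted (IsSeed D q) τ ∧
      (τ.reg Reg.found = 0 → Scanned D (q.take (σ.reg Reg.scan + 1)) q) := by
  set i := σ.reg Reg.scan with hi
  have hlength := h.length_le
  have hmem : (q[i].1, q[i].2) ∈ q := List.getElem_mem hlt
  have hfirst := h.first i hlt
  have hsecond := h.second i hlt
  refine .seq (ok_getAt h.env hi.symm (by omega) ?_)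
  refine .seq (ok_getAt (p := i) (by simpa using h.env) (by simp [hi]) (by omega) ?_)
  refine Ok.imp (ok_forNote (c := 110) (P := IsSeed D q)
    (Bad := fun z => (q[i].2, z) ∈ q ∧ Uncollected D (pairRel q) q[i].1 z ∨
      (z, q[i].1) ∈ q ∧ Uncollected D (pairRel q) z q[i].2)
    h.setReg.setReg.setReg.setReg (.inl (by simpa using hfound)) (by decide) ?_) ?_
  · rintro Z τ hτ hN hZ hframe
    have hX : τ.reg Reg.x = q[i].1 := (hframe _ (by decide)).trans (by simpa using hfirst)
    have hY : τ.reg Reg.y = q[i].2 := (hframe _ (by decide)).trans (by simpa using hsecond)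
    refine .seq ((ok_noteIfImplied hτ hY hZ hX hZ hN fun hYZ hfree =>
      ⟨hfree, .inl ⟨_, hmem, hYZ⟩⟩).imp ?_)
    rintro t₁ τ₁ - hframe₁ ⟨ht₁, hmem₁, hN₁, hnone₁⟩
    have hτ₁ : Ready D τ₁ q := hτ.frame hmem₁ hframe₁
    rw [← hframe₁ _ (by decide)] at hX hY hZ
    refine (ok_noteIfImplied hτ₁ hZ hX hZ hY hN₁ fun hZX hfree =>
      ⟨hfree, .inl ⟨_, hZX, hmem⟩⟩).imp ?_
    rintro t₂ τ₂ - - ⟨ht₂, hmem₂, hN₂, hnone₂⟩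
    refine ⟨by omega, hmem₂.trans hmem₁, hN₂, fun hzero => ?_⟩
    obtain ⟨hzero, hsecond⟩ := hnone₂ hzero
    obtain ⟨hzero, hfirst⟩ := hnone₁ hzero
    exact ⟨hzero, fun hbad => hbad.elim (fun h => hfirst h.1 h.2) fun h => hsecond h.1 h.2⟩
  · rintro t τ - - ⟨ht, hmem', hN, hnone⟩
    refine ⟨?_, hmem', hN, fun hzero => hscanned.take_succ hlt (fun z hz hfree => ?_)
      fun z hz hfree => ?_⟩
    · unfold unitCost
      omega
    · exact hnone hzero z (.inl ⟨hz, hfree⟩)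
    · exact hnone hzero z (.inr ⟨hz, hfree⟩)

/-- Look for an uncollected pair that is implied by two collected pairs. -/
def findImplied : Stmt := searchLoop Reg.scan Reg.tail scanEntry

/-- Look for an uncollected pair. -/
def findAny : Stmt :=
  searchLoop Reg.row Reg.size (forLoop Reg.z Reg.size (noteIfUncollected Reg.row Reg.z))

/-- No pair in the first `k` rows is uncollected. -/
def RowsCollected (D : Digraph (Fin n)) (q : List (Fin n × Fin n)) (k : ℕ) : Prop :=
  ∀ x y : Fin n, x < k → ¬ Uncollected D (pairRel q) x y

theorem RowsCollected.mono {k : ℕ} (h : RowsCollected D q k) (hq : q <+: q') :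
    RowsCollected D q' k :=
  fun x y hx hfree => h x y hx (hfree.of_prefix hq)

theorem ok_scanRow (h : Ready D σ q) (hlt : σ.reg Reg.row < n)
    (hrows : RowsCollected D q (σ.reg Reg.row)) (hfound : σ.reg Reg.found = 0)
    (hstable : Stable D (pairRel q)) :
    Ok (bound n) (forLoop Reg.z Reg.size (noteIfUncollected Reg.row Reg.z)) σ fun t τ =>
      t + 4 ≤ unitCost n ∧ τ.mem = σ.mem ∧ Noted (IsSeed D q) τ ∧
      (τ.reg Reg.found = 0 → RowsCollected D q (σ.reg Reg.row + 1)) := by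
  set X : Fin n := ⟨σ.reg Reg.row, hlt⟩
  refine (ok_forNote (c := 40) (P := IsSeed D q)
    (Bad := fun z => Uncollected D (pairRel q) X z) h (.inl hfound) (by decide) ?_).imp ?_
  · rintro Z τ hτ hN hZ hframe
    exact ok_noteIfUncollected (U := X) hτ (hframe Reg.row (by decide)) hZ hN
      fun hfree => ⟨hfree, .inr hstable⟩
  · rintro t τ - - ⟨ht, hmem, hN, hnone⟩
    refine ⟨?_, hmem, hN, fun hzero x y hx => ?_⟩
    · unfold unitCost
      omega
    rcases Nat.lt_succ_iff_lt_or_eq.1 hx with hx | hx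
    · exact hrows x y hx
    · obtain rfl : x = X := Fin.ext hx
      exact hnone hzero y

/-- The positions of the two searches, and what they have excluded. -/
structure SearchState (D : Digraph (Fin n)) (q : List (Fin n × Fin n)) (σ : Store) : Prop where
  scan_le : σ.reg Reg.scan ≤ q.length
  row_le : σ.reg Reg.row ≤ n
  scanned : Scanned D (q.take (σ.reg Reg.scan)) q
  rows : RowsCollected D q (σ.reg Reg.row)

theorem SearchState.mono (h : SearchState D q σ) (hq : q <+: q') : SearchState D q' σ where
  scan_le := h.scan_le.trans hq.length_le
  row_le := h.row_le
  scanned := by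
    obtain ⟨l, rfl⟩ := hq
    rw [List.take_append_of_le_length h.scan_le]
    exact h.scanned.mono (List.prefix_append _ _)
  rows := h.rows.mono hq

/-- Choose the seed of the next implication class. -/
def search : Stmt :=
  .seq (.const Reg.found 0) <| .seq findImplied <|
    .ite (.eq Reg.found Reg.zero) findAny .skip

theorem ok_search (h : Ready D σ q) (hstate : SearchState D q σ) :
    Ok (bound n) search σ fun t τ => τ.mem = σ.mem ∧ SearchState D q τ ∧ Noted (IsSeed D q) τ ∧
      (τ.reg Reg.found = 0 → ∀ x y, ¬ Uncollected D (pairRel q) x y) ∧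
      unitCost n * (σ.reg Reg.scan + σ.reg Reg.row) + t ≤
        unitCost n * (τ.reg Reg.scan + τ.reg Reg.row + 1) + 20 := by
  refine .seq (.of_wp ⟨Nat.zero_le _, ?_⟩)
  refine .seq ?_
  refine Ok.imp (ok_searchLoop (P := IsSeed D q) (Excluded := fun i => Scanned D (q.take i) q)
    h.setReg (by simp) (N := q.length) (by simpa using h.tail) h.length_le
    (by simpa using hstate.scan_le) (by simpa using hstate.scanned) (by decide)
    fun τ hτ hlt hfound hscanned => ok_scanEntry hτ hlt hscanned hfound) ?_
  rintro t τ - hframe ⟨hmem, hle, hN, hscanned, hcomplete, ht⟩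
  have hτ : Ready D τ q := h.setReg.frame hmem hframe
  have hrow : τ.reg Reg.row = σ.reg Reg.row := (hframe _ (by decide)).trans (by simp)
  have hrow_le := hrow ▸ hstate.row_le
  have hrows := hrow ▸ hstate.rows
  rw [Store.setReg_reg, if_neg (by decide)] at ht
  rw [← hrow]
  refine .ite (fun hzero => ?_) fun hone => ?_
  · have hzero : τ.reg Reg.found = 0 := by simpa [Test.eval, hτ.env.zero] using hzero
    have hstable : Stable D (pairRel q) := by
      rw [hcomplete hzero, List.take_length] at hscanned
      exact hscanned.stable
    refine (ok_searchLoop (P := IsSeed D q) hτ hzero hτ.env.size (Nat.le_mul_self n) hrow_le hrows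
      (by decide) fun ρ hρ hlt hfound hrows => ok_scanRow hρ hlt hrows hfound hstable).imp ?_
    rintro t' τ' - hframe' ⟨hmem', hle', hN', hrows', hcomplete', ht'⟩
    have hscan : τ'.reg Reg.scan = τ.reg Reg.scan := hframe' _ (by decide)
    have hfound := Nat.mul_le_mul_left (unitCost n) hN'.le_one
    refine ⟨hmem'.trans hmem, ⟨hscan ▸ hle, hle', hscan ▸ hscanned, hrows'⟩, hN',
      fun hzero' x y => hrows' x y (hcomplete' hzero' ▸ x.2), ?_⟩
    rw [hzero] at ht
    simp only [Nat.mul_add, hscan] at *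
    omega
  · have hone : τ.reg Reg.found ≠ 0 := by simpa [Test.eval, hτ.env.zero] using hone
    have hfound := Nat.mul_le_mul_left (unitCost n) hN.le_one
    refine .skip ⟨hmem, ⟨hle, hrow_le, hscanned, hrows⟩, hN, fun hzero => absurd hzero hone, ?_⟩
    simp only [Nat.mul_add] at *
    omega

end Search

/-! ### The main loop -/

section MainLoop

variable {n : ℕ} {D : Digraph (Fin n)} {q : List (Fin n × Fin n)} {σ : Store}

/-- The set of collected pairs, read off from the memory. -/
def heldPairs (n : ℕ) (σ : Store) (x y : Fin n) : Prop := σ.mem (cell n .collected (x * n + y)) ≠ 0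

theorem Ready.heldPairs_eq (h : Ready D σ q) : heldPairs n σ = pairRel q := by
  ext x y
  rw [heldPairs, h.collected x y, ne_eq, bit_eq_zero, not_not]

/-- Collect the class of the seed, and choose the next seed. -/
def collectClass : Stmt := .seq (push Reg.seedX Reg.seedY) (.seq closeQueue search)

/-- The invariant of the main loop: `q` lists the pairs of the classes collected so far, and either
the next seed has been noted, or no pair is left. -/
structure MainInvariant (D : Digraph (Fin n)) (q : List (Fin n × Fin n)) (σ : Store) : Prop where
  ready : Ready D σ q
  head : σ.reg Reg.head = q.length
  processed : Processed D q q
  search : SearchState D q σ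
  noted : Noted (IsSeed D q) σ
  exhausted : σ.reg Reg.found = 0 → ∀ x y, ¬ Uncollected D (pairRel q) x y

/-- The amount of work done so far, for the amortized analysis of the main loop: its four counters
never decrease and are bounded by the number of pairs of vertices. -/
def work (n : ℕ) (σ : Store) : ℕ :=
  unitCost n * (σ.reg Reg.head + σ.reg Reg.scan + σ.reg Reg.row + 2 * σ.reg Reg.tail)

theorem MainInvariant.work_le (h : MainInvariant D q σ) :
    work n σ ≤ unitCost n * (4 * (n * n) + n) := by
  have hlength := h.ready.length_le
  have hscan := h.search.scan_le
  have hrow := h.search.row_le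
  refine Nat.mul_le_mul_left _ ?_
  rw [h.head, h.ready.tail]
  omega

theorem ok_collectClass (h : MainInvariant D q σ) (hfound : σ.reg Reg.found ≠ 0) :
    Ok (bound n) collectClass σ fun t τ => (∃ q', MainInvariant D q' τ) ∧
      CollectStep D (heldPairs n σ) (heldPairs n τ) ∧ work n σ + t + 1 ≤ work n τ := by
  obtain ⟨-, X, Y, hX, hY, hnew, hseed⟩ := h.noted.resolve_left hfound
  refine .seq ((ok_push h.ready hX hY hnew.not_forward).imp ?_)
  rintro t₁ τ₁ - hframe₁ ⟨ht₁, hτ₁⟩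
  refine .seq ((ok_closeQueue hτ₁ ((hframe₁ _ (by decide)).trans h.head) h.processed
    hnew.linked.mem_pairs).imp ?_)
  rintro t₂ τ₂ - hframe₂ ⟨q', hτ₂, hpre, hhead₂, hprocessed, hmem, ht₂⟩
  have hpre' : q <+: q' := (List.prefix_append _ _).trans hpre
  have hscan : τ₂.reg Reg.scan = σ.reg Reg.scan :=
    (hframe₂ _ (by decide)).trans (hframe₁ _ (by decide))
  have hrow : τ₂.reg Reg.row = σ.reg Reg.row :=
    (hframe₂ _ (by decide)).trans (hframe₁ _ (by decide))
  have hstate := h.search.mono hpre'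
  refine (ok_search hτ₂ ⟨hscan ▸ hstate.scan_le, hrow ▸ hstate.row_le, hscan ▸ hstate.scanned,
    hrow ▸ hstate.rows⟩).imp ?_
  rintro t₃ τ₃ - hframe₃ ⟨hmem₃, hstate₃, hnoted, hexhausted, ht₃⟩
  have hτ₃ : Ready D τ₃ q' := hτ₂.frame hmem₃ hframe₃
  have hhead₃ : τ₃.reg Reg.head = q'.length := (hframe₃ _ (by decide)).trans hhead₂
  refine ⟨⟨q', hτ₃, hhead₃, hprocessed, hstate₃, hnoted, hexhausted⟩, ?_, ?_⟩
  · rw [h.ready.heldPairs_eq, hτ₃.heldPairs_eq]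
    exact ⟨(X, Y), hnew, hseed, funext₂ fun x y => propext (hmem (x, y))⟩
  · have hlength : q.length + 1 ≤ q'.length := by simpa using hpre.length_le
    have hunits := Nat.mul_le_mul_left (unitCost n) hlength
    have hunit : 1000 ≤ unitCost n := by unfold unitCost; omega
    simp only [work, hhead₃, hτ₃.tail, h.head, h.ready.tail]
    rw [hscan, hrow] at ht₃
    simp only [Nat.mul_add, Nat.mul_left_comm _ 2] at *
    omega

/-- Choose the first seed. -/
def startMain : Stmt :=
  .seq (.const Reg.head 0) <| .seq (.const Reg.scan 0) <| .seq (.const Reg.row 0) <|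
    .seq (.const Reg.tail 0) search

theorem ok_startMain (hE : Env n σ) (hA : IsMatrix σ.mem .adj D.Adj)
    (hlinked : IsMatrix σ.mem .linked (Linked D))
    (hcollected : IsMatrix σ.mem .collected fun _ _ : Fin n => False) :
    Ok (bound n) startMain σ fun t τ => MainInvariant D [] τ ∧ t ≤ unitCost n * (n + 1) + 30 := by
  refine .seq (.of_wp ⟨Nat.zero_le _, ?_⟩)
  refine .seq (.of_wp ⟨Nat.zero_le _, ?_⟩)
  refine .seq (.of_wp ⟨Nat.zero_le _, ?_⟩)
  refine .seq (.of_wp ⟨Nat.zero_le _, ?_⟩)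
  have hready : Ready D ((((σ.setReg Reg.head 0).setReg Reg.scan 0).setReg Reg.row 0).setReg
      Reg.tail 0) [] := by
    exact ⟨by simpa using hE, hA, hlinked, hcollected.congr fun x y => by simp, List.nodup_nil,
      by simp, by simp, by simp⟩
  refine Ok.imp (ok_search hready ⟨by simp, by simp, by simp [Scanned], by simp [RowsCollected]⟩) ?_
  rintro t τ - hframe ⟨hmem, hstate, hnoted, hexhausted, ht⟩
  refine ⟨⟨hready.frame hmem hframe, (hframe _ (by decide)).trans (by simp), by simp [Processed],
    hstate, hnoted, hexhausted⟩, ?_⟩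
  have hscan : τ.reg Reg.scan = 0 := Nat.le_zero.1 hstate.scan_le
  have hunits : unitCost n * (τ.reg Reg.scan + τ.reg Reg.row + 1) ≤ unitCost n * (n + 1) :=
    Nat.mul_le_mul_left _ (by rw [hscan]; have := hstate.row_le; omega)
  change unitCost n * 0 + t ≤ _ at ht
  omega

end MainLoop

/-! ### Topological sorting -/

section InitialPart

variable {V : Type*} {T : V → V → Prop} {l : List V} {v : V}

/-- `v` may follow the vertices in `l` in a vertex ordering that extends `T`. -/
structure IsMinimalOutside (T : V → V → Prop) (l : List V) (v : V) : Prop where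
  not_mem : v ∉ l
  minimal : ∀ u, u ∉ l → ¬ T u v

/-- `l` is an initial part of a vertex ordering that extends `T`. -/
structure IsInitialPart (T : V → V → Prop) (l : List V) : Prop where
  nodup : l.Nodup
  sorted : l.Pairwise fun a b => ¬ T b a
  lower : ∀ x, ∀ y ∈ l, T x y → x ∈ l

theorem IsInitialPart.nil : IsInitialPart T [] := ⟨.nil, .nil, by simp⟩

theorem IsInitialPart.append (h : IsInitialPart T l) (hT : ¬ T v v)
    (hv : IsMinimalOutside T l v) : IsInitialPart T (l ++ [v]) where
  nodup := List.concat_eq_append ▸ h.nodup.concat hv.not_mem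
  sorted := by
    simp only [List.pairwise_append, List.pairwise_singleton, List.mem_singleton, forall_eq,
      true_and]
    exact ⟨h.sorted, fun a ha hva => hv.not_mem (h.lower v a ha hva)⟩
  lower x y hy hxy := by
    rw [List.mem_append, List.mem_singleton] at hy ⊢
    rcases hy with hy | rfl
    · exact .inl (h.lower x y hy hxy)
    · exact .inl (by_contra fun hx => hv.minimal x hx hxy)

theorem Acyclic.exists_isMinimalOutside [Finite V] (hT : Acyclic T) (hl : ∃ v, v ∉ l) :
    ∃ v, IsMinimalOutside T l v := by
  have : IsTrans V (Relation.TransGen T) := ⟨fun _ _ _ => Relation.TransGen.trans⟩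
  have : Std.Irrefl (Relation.TransGen T) := ⟨hT⟩
  obtain ⟨v, hv, hmin⟩ :=
    (Finite.wellFounded_of_trans_of_irrefl (Relation.TransGen T)).has_min {v | v ∉ l} hl
  exact ⟨v, hv, fun u hu huv => hmin u hu (.single huv)⟩

theorem IsInitialPart.exists_perm {n : ℕ} {T : Fin n → Fin n → Prop} {l : List (Fin n)}
    (h : IsInitialPart T l) (hT : ∀ x, ¬ T x x) (hl : l.length = n) :
    ∃ p : Equiv.Perm (Fin n), (∀ i : Fin n, p i = l[i]) ∧ ∀ x y, T x y → listingOrder p x y := by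
  have hinj : Function.Injective fun i : Fin n => l[i] := fun i j hij =>
    Fin.ext (h.nodup.getElem_inj_iff.1 hij)
  let p := Equiv.ofBijective _ (Finite.injective_iff_bijective.1 hinj)
  have hp (x : Fin n) : l[(p.symm x : ℕ)] = x := p.apply_symm_apply x
  refine ⟨p, fun i => rfl, fun x y hxy => ?_⟩
  by_contra hle
  rcases (not_lt.1 hle).lt_or_eq with hlt | heq
  · refine List.pairwise_iff_getElem.1 h.sorted (p.symm y) (p.symm x) (by omega) (by omega) hlt ?_
    rwa [hp, hp]
  · exact hT x (p.symm.injective heq ▸ hxy)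

end InitialPart

section Output

variable {n : ℕ} {T : Fin n → Fin n → Prop} {l : List (Fin n)} {v : Fin n} {σ : Store}

theorem val_le_sq (v : Fin n) : (v : ℕ) ≤ n * n := v.2.le.trans (Nat.le_mul_self n)

/-- `reg flag := 1` if some pair is collected together with its inverse, and `reg flag := 0`
otherwise. -/
def conflictTest : Stmt :=
  .seq (.const Reg.flag 0) <| forPairs <|
    .seq (getCell Reg.bit .collected Reg.x Reg.y) <|
    .seq (getCell Reg.bit' .collected Reg.y Reg.x) <| .seq (.mul Reg.bit Reg.bit Reg.bit') <|
    .ite (.eq Reg.bit Reg.zero) .skip (.const Reg.flag 1)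

theorem ok_conflictTest (hE : Env n σ) (hT : IsMatrix σ.mem .collected T) :
    Ok (bound n) conflictTest σ fun t τ => t ≤ (33 * n + 6) * n + 5 ∧ τ.mem = σ.mem ∧
      τ.reg Reg.flag = bit (∃ x y, T x y ∧ T y x) := by
  let conflict : Fin n × Fin n → Prop := fun p => T p.1 p.2 ∧ T p.2 p.1
  refine .seq (.of_wp ⟨Nat.zero_le _, ?_⟩)
  refine ok_forPairs 30 (fun P τ => τ.mem = σ.mem ∧ τ.reg Reg.flag = bit (∃ p ∈ P, conflict p)) ?_
    (by simpa using hE) (by decide) ⟨rfl, by simp [bit]⟩ ?_ fun t τ h ht => ⟨by linarith, h.1, ?_⟩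
  · rintro P τ r v (rfl | rfl) ⟨hmem, hflag⟩ <;> exact ⟨hmem, by simpa using hflag⟩
  · rintro P X Y τ ⟨hmem, hflag⟩ hEτ hx hy -
    refine .seq (ok_getCell hEτ (hmem ▸ hT) hx hy ?_)
    refine .seq (ok_getCell (X := Y) (Y := X) (by simpa using hEτ) (hmem ▸ hT) (by simpa using hy)
      (by simpa using hx) ?_)
    have hprod : bit (T X Y) * bit (T Y X) ≤ bound n := by
      rw [bit_mul_bit]
      exact (bit_le_one _).trans (by unfold bound; omega)
    have hinsert : (∃ p ∈ insert (X, Y) P, conflict p) ↔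
        (T X Y ∧ T Y X) ∨ ∃ p ∈ P, conflict p := by
      simp only [Set.mem_insert_iff, exists_eq_or_imp, conflict]
    rw [hinsert]
    refine .of_wp ⟨by simpa using hprod, fun hnone => ?_, fun hsome => ⟨by unfold bound; omega, ?_⟩⟩
    · have hnone : ¬ (T X Y ∧ T Y X) := by simpa [Test.eval, hEτ.zero, imp_iff_not_or] using hnone
      rw [or_iff_right hnone]
      simp [wp, hmem, hflag]
    · have hsome : T X Y ∧ T Y X := by simpa [Test.eval, hEτ.zero] using hsome
      simp [hmem, hsome, bit]
  · rw [h.2]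
    simp [conflict]

/-- The vertices in `l` are marked. -/
def Marks (m : ℕ → ℕ) (l : List (Fin n)) : Prop := ∀ v : Fin n, m (cell n .marks v) = bit (v ∈ l)

/-- `reg minimal := 1` if no unmarked vertex precedes the vertex in the register `y`, and
`reg minimal := 0` otherwise. -/
def minimalTest : Stmt :=
  .seq (.const Reg.minimal 1) <| forLoop Reg.z Reg.size <|
    .seq (getAt Reg.bit .marks Reg.z) <| .seq (getCell Reg.bit' .collected Reg.z Reg.y) <|
    .ite (.eq Reg.bit Reg.zero) (.ite (.eq Reg.bit' Reg.zero) .skip (.const Reg.minimal 0)) .skip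

theorem ok_minimalTest (hE : Env n σ) (hT : IsMatrix σ.mem .collected T) (hl : Marks σ.mem l)
    (hv : σ.reg Reg.y = v) :
    Ok (bound n) minimalTest σ fun t τ => t ≤ 23 * n + 5 ∧ τ.mem = σ.mem ∧
      τ.reg Reg.minimal = bit (∀ u, u ∉ l → ¬ T u v) := by
  refine .seq (.of_wp ⟨by unfold bound; omega, ?_⟩)
  refine ok_forFin 20 (fun P τ => τ.mem = σ.mem ∧
      τ.reg Reg.minimal = bit (∀ u ∈ P, u ∉ l → ¬ T u v)) (fun P τ w h => ⟨h.1, by simpa using h.2⟩)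
    (by decide) (by simpa using hE) ⟨rfl, by simp [bit]⟩ ?_
    fun t τ h _ ht => ⟨by omega, h.1, by simpa using h.2⟩
  rintro P U τ ⟨hmem, hminimal⟩ hu hframe
  have hEτ : Env n τ := Env.frame (by simpa using hE) hframe (by decide)
  have hy : τ.reg Reg.y = v := (hframe _ (by decide)).trans (by simpa using hv)
  have hmark : τ.mem (cell n .marks U) = bit (U ∈ l) := by rw [hmem, hl U]
  refine .seq (ok_getAt hEτ hu (val_le_sq U) ?_)
  refine .seq (ok_getCell (X := U) (Y := v) (by simpa using hEτ) (hmem ▸ hT) (by simpa using hu)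
    (by simpa using hy) ?_)
  rw [Set.forall_mem_insert, hmark]
  refine .of_wp ⟨fun hunmarked => ⟨fun hnot => ?_, fun hprec => ⟨Nat.zero_le _, ?_⟩⟩,
    fun hmarked => ?_⟩
  · have hnot : ¬ T U v := by simpa [Test.eval, hEτ.zero] using hnot
    simp [wp, hmem, hminimal, hnot]
  · have hunmarked : U ∉ l := by simpa [Test.eval, hEτ.zero] using hunmarked
    have hprec : T U v := by simpa [Test.eval, hEτ.zero] using hprec
    simp [hmem, hunmarked, hprec, bit]
  · have hmarked : U ∈ l := by simpa [Test.eval, hEτ.zero] using hmarked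
    simp [wp, hmem, hminimal, hmarked]

/-- Select a vertex that is minimal among the unmarked vertices. -/
def selectMinimal : Stmt :=
  forLoop Reg.y Reg.size <| .seq (getAt Reg.bit .marks Reg.y) <|
    .ite (.eq Reg.bit Reg.zero)
      (.seq minimalTest (.ite (.eq Reg.minimal Reg.one) (.move Reg.vertex Reg.y) .skip)) .skip

theorem ok_selectMinimal (hE : Env n σ) (hT : IsMatrix σ.mem .collected T) (hl : Marks σ.mem l)
    (hex : ∃ v, IsMinimalOutside T l v) :
    Ok (bound n) selectMinimal σ fun t τ => t ≤ (23 * n + 20) * n + 3 ∧ τ.mem = σ.mem ∧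
      ∃ v : Fin n, τ.reg Reg.vertex = v ∧ IsMinimalOutside T l v := by
  refine ok_forFin (23 * n + 17) (fun P τ => τ.mem = σ.mem ∧
      ((∃ v : Fin n, τ.reg Reg.vertex = v ∧ IsMinimalOutside T l v) ∨
        ∀ v ∈ P, ¬ IsMinimalOutside T l v)) (fun P τ w h => by simpa using h)
    (by decide) hE ⟨rfl, .inr (by simp)⟩ ?_ fun t τ h _ ht => ⟨by linarith, h.1, ?_⟩
  · rintro P X τ ⟨hmem, hselected⟩ hy hframe
    have hEτ : Env n τ := hE.frame hframe (by decide)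
    have hmark : τ.mem (cell n .marks X) = bit (X ∈ l) := by rw [hmem, hl X]
    have hskip (hX : ¬ IsMinimalOutside T l X) :
        (∃ v : Fin n, τ.reg Reg.vertex = v ∧ IsMinimalOutside T l v) ∨
          ∀ v ∈ insert X P, ¬ IsMinimalOutside T l v :=
      hselected.imp_right fun h => Set.forall_mem_insert.2 ⟨hX, h⟩
    refine .seq (ok_getAt hEτ hy (val_le_sq X) ?_)
    rw [hmark]
    refine .ite (fun hunmarked => ?_) fun hmarked => ?_
    · have hunmarked : X ∉ l := by simpa [Test.eval, hEτ.zero] using hunmarked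
      refine .seq ?_
      refine Ok.imp (ok_minimalTest (v := X) (by simpa using hEτ) (hmem ▸ hT) (hmem ▸ hl)
        (by simpa using hy)) ?_
      rintro t τ' - hframe' ⟨ht, hmem', hminimal⟩
      have hone : τ'.reg Reg.one = 1 := (hframe' _ (by decide)).trans (by simpa using hEτ.one)
      have hX : τ'.reg Reg.y = X := (hframe' _ (by decide)).trans (by simpa using hy)
      have hvertex : τ'.reg Reg.vertex = τ.reg Reg.vertex := (hframe' _ (by decide)).trans (by simp)
      refine .ite (fun hyes => .of_wp ?_) fun hno => .skip ⟨by omega, hmem'.trans hmem, ?_⟩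
      · rw [Test.eval, hminimal, hone, decide_eq_true_eq, bit_eq_one] at hyes
        exact ⟨by omega, hmem'.trans hmem, .inl ⟨X, by simpa using hX, hunmarked, hyes⟩⟩
      · rw [Test.eval, hminimal, hone, decide_eq_false_iff_not, bit_eq_one] at hno
        exact hvertex ▸ hskip fun h => hno h.minimal
    · have hmarked : X ∈ l := by simpa [Test.eval, hEτ.zero] using hmarked
      exact .skip ⟨by omega, hmem, by simpa using hskip fun h => h.not_mem hmarked⟩
  · exact h.2.resolve_right fun hnone => hex.elim fun v => hnone v trivial

/-- The data of the topological sort: the vertices in `l` have been written and marked. -/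
structure SortState (T : Fin n → Fin n → Prop) (l : List (Fin n)) (m : ℕ → ℕ) : Prop where
  collected : IsMatrix m .collected T
  initial : IsInitialPart T l
  marks : Marks m l
  order : ∀ i (hi : i < l.length), m (cell n .order i) = l[i]

theorem SortState.append {m : ℕ → ℕ} (h : SortState T l m) (hT : ¬ T v v)
    (hv : IsMinimalOutside T l v) (hlt : l.length < n) :
    SortState T (l ++ [v]) (Function.update (Function.update m (cell n .order l.length) v)
      (cell n .marks v) 1) := by
  have hentry : ∀ i ≤ n, i ≤ n * n := fun i hi => hi.trans (Nat.le_mul_self n)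
  refine ⟨?_, h.initial.append hT hv, fun u => ?_, fun i hi => ?_⟩
  · exact h.collected.agreeOff ((AgreeOff.refl (bs := [.order, .marks])).update
      (by decide) (hentry _ hlt.le) _ |>.update (by decide) (val_le_sq v) _)
  · rw [update_cell (val_le_sq v) (val_le_sq u), update_cell (hentry _ hlt.le) (val_le_sq u),
      h.marks u]
    by_cases huv : u = v <;> simp [huv, bit, Fin.val_inj]
  · rw [List.length_append, List.length_singleton] at hi
    rw [update_cell (val_le_sq v) (hentry _ (by omega)),
      update_cell (hentry _ hlt.le) (hentry _ (by omega))]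
    rcases Nat.lt_succ_iff_lt_or_eq.1 hi with hi | rfl
    · simp [hi, hi.ne, h.order]
    · simp

/-- Write a vertex ordering that extends the set of collected pairs. -/
def topologicalSort : Stmt :=
  .seq (forLoop Reg.x Reg.size (setAt .marks Reg.x Reg.zero)) <| forLoop Reg.x Reg.size <|
    .seq selectMinimal <| .seq (setAt .order Reg.x Reg.vertex) (setAt .marks Reg.vertex Reg.one)

theorem ok_clearMarks (hE : Env n σ) (hT : IsMatrix σ.mem .collected T) :
    Ok (bound n) (forLoop Reg.x Reg.size (setAt .marks Reg.x Reg.zero)) σ fun t τ =>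
      t ≤ 6 * n + 3 ∧ SortState T [] τ.mem := by
  refine ok_forFin 3 (fun P τ => IsMatrix τ.mem .collected T ∧
    ∀ v ∈ P, τ.mem (cell n .marks v) = 0) (fun _ _ _ h => h) (by decide) hE ⟨hT, by simp⟩ ?_
    fun t τ h _ ht => ⟨by omega, h.1, .nil, fun v => by simp [h.2 v trivial, bit], by simp⟩
  rintro P X τ ⟨hmat, hzero⟩ hx hframe
  have hEτ : Env n τ := hE.frame hframe (by decide)
  refine ok_setAt hEτ hx (val_le_sq X) ⟨le_rfl, hmat.agreeOff
    ((AgreeOff.refl (bs := [.marks])).update (by decide) (val_le_sq X) _), fun v hv => ?_⟩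
  simp only [Store.setReg_mem, Store.setMem_mem]
  rw [update_cell (val_le_sq X) (val_le_sq v), hEτ.zero]
  split_ifs with heq
  · rfl
  · exact hzero v (hv.resolve_left fun hvX => heq ⟨rfl, congrArg _ hvX⟩)

theorem ok_topologicalSort (hE : Env n σ) (hcollected : IsMatrix σ.mem .collected T)
    (hT : Acyclic T) :
    Ok (bound n) topologicalSort σ fun t τ => t ≤ ((23 * n + 20) * n + 23) * n + 7 ∧
      ∃ p : Equiv.Perm (Fin n), (∀ i : Fin n, τ.mem (cell n .order i) = p i) ∧
        ∀ x y, T x y → listingOrder p x y := by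
  have hirrefl (x : Fin n) : ¬ T x x := fun h => hT x (.single h)
  refine .seq ((ok_clearMarks hE hcollected).imp ?_)
  rintro t₀ σ₀ - hframe₀ ⟨ht₀, hσ₀⟩
  have hE₀ : Env n σ₀ := hE.frame hframe₀ (by decide)
  refine ok_forLoop n ((23 * n + 20) * n + 14) (fun i τ => ∃ l, SortState T l τ.mem ∧ l.length = i)
    (by decide) hE₀.one hE₀.size ⟨[], hσ₀, rfl⟩ ?_ ?_
  · rintro i hi τ ⟨l, hτ, rfl⟩ hx hframe
    have hEτ : Env n τ := hE₀.frame hframe (by decide)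
    have hrest : ∃ v, v ∉ l := by
      obtain ⟨v, -, hv⟩ := Finset.exists_mem_notMem_of_card_lt_card
        (s := l.toFinset) (t := Finset.univ) (by simpa using l.toFinset_card_le.trans_lt hi)
      exact ⟨v, by simpa using hv⟩
    refine .seq ((ok_selectMinimal hEτ hτ.collected hτ.marks
      (hT.exists_isMinimalOutside hrest)).imp ?_)
    rintro t₁ τ₁ - hframe₁ ⟨ht₁, hmem₁, v, hvertex, hv⟩
    have hE₁ : Env n τ₁ := hEτ.frame hframe₁ (by decide)
    refine .seq (ok_setAt hE₁ ((hframe₁ _ (by decide)).trans hx) (val_le_sq ⟨_, hi⟩) ?_)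
    refine ok_setAt (p := v) (by simpa using hE₁) (by simpa using hvertex) (val_le_sq v)
      ⟨by omega, l ++ [v], ?_, by simp⟩
    have hone : τ₁.reg 3 = 1 := hE₁.one
    have hvertex : τ₁.reg 35 = v := hvertex
    simpa [hmem₁, hone, hvertex] using hτ.append (hirrefl v) hv hi
  · rintro t τ ⟨l, hτ, hlength⟩ - ht
    obtain ⟨p, hp, hpT⟩ := hτ.initial.exists_perm hirrefl hlength
    refine ⟨by linarith, p, fun i => ?_, hpT⟩
    rw [hτ.order i (by omega), hp i]
    rfl

end Output

/-! ### The program -/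

section Program

variable {n : ℕ} {D : Digraph (Fin n)} {L : Fin n → List (Fin n)} {σ : Store}

/-- Read the input and test whether the digraph is semicomplete. -/
def prologue : Stmt := .seq initRegs (.seq readInput semicompleteTest)

/-- What is known before the main loop is prepared. -/
structure Loaded (D : Digraph (Fin n)) (σ : Store) : Prop where
  env : Env n σ
  adj : IsMatrix σ.mem .adj D.Adj
  linked : IsMatrix σ.mem .linked fun _ _ : Fin n => False
  collected : IsMatrix σ.mem .collected fun _ _ : Fin n => False

theorem isMatrix_inputWord (hL : IsAdjacencyLists D L) (hD : IsLoopless D) {b : Block}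
    (hb : b ≠ .input) :
    IsMatrix (n := n) (fun i => (inputWord L).getD i 0) b fun _ _ => False :=
  fun _ _ => (inputWord_getD_cell hL hD hb _).trans (by simp [bit])

theorem ok_prologue (hL : IsAdjacencyLists D L) (hD : IsLoopless D) :
    Ok (bound n) prologue ⟨fun _ => 0, fun i => (inputWord L).getD i 0⟩ fun t τ =>
      t ≤ (56 * n + 26) * n + 50 ∧ Loaded D τ ∧ τ.reg Reg.flag = bit (IsSemicomplete D) := by
  refine .seq ((ok_initRegs (n := n) (fun _ => rfl) (by simp [inputWord])).imp ?_)
  rintro t₁ τ₁ - - ⟨ht₁, hmem₁, hE₁⟩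
  refine .seq ((ok_readInput hE₁ hL hD fun i => by rw [hmem₁]).imp ?_)
  rintro t₂ τ₂ - hframe₂ ⟨ht₂, hA, hoff⟩
  rw [hmem₁] at hoff
  refine (ok_semicompleteTest (hE₁.frame hframe₂) hA).imp ?_
  rintro t₃ τ₃ - hframe₃ ⟨ht₃, hmem₃, hflag⟩
  refine ⟨by linarith, ⟨(hE₁.frame hframe₂).frame hframe₃, ?_, ?_, ?_⟩, hflag⟩ <;> rw [hmem₃]
  exacts [hA, (isMatrix_inputWord hL hD (by decide)).agreeOff hoff,
    (isMatrix_inputWord hL hD (by decide)).agreeOff hoff]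

/-- Prepare the main loop. -/
def prepareMain : Stmt := .seq markLinked startMain

theorem ok_prepareMain (h : Loaded D σ) :
    Ok (bound n) prepareMain σ fun t τ => MainInvariant D [] τ ∧
      t ≤ ((110 * n + 6) * n + 6) * n + unitCost n * (n + 1) + 34 := by
  refine .seq ((ok_markLinked h.env h.adj h.linked).imp ?_)
  rintro t₁ τ₁ - hframe₁ ⟨ht₁, hoff, hlinked⟩
  refine (ok_startMain (h.env.frame hframe₁) (h.adj.agreeOff hoff) hlinked
    (h.collected.agreeOff hoff)).imp ?_
  rintro t τ - - ⟨hτ, ht⟩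
  exact ⟨hτ, by omega⟩

/-- Answer no if some pair has been collected together with its inverse; otherwise write an
ordering that extends the set of collected pairs and answer yes. -/
def epilogue : Stmt :=
  .seq conflictTest <| .ite (.eq Reg.flag Reg.one) .skip <|
    .seq topologicalSort (.const Reg.answer 1)

theorem ok_epilogue {T : Fin n → Fin n → Prop} (hE : Env n σ) (hM : IsMatrix σ.mem .collected T)
    (hT : (¬ ∃ x y, T x y ∧ T y x) → Acyclic T) :
    Ok (bound n) epilogue σ fun t τ => t ≤ ((23 * n + 53) * n + 29) * n + 20 ∧
      (((∃ x y, T x y ∧ T y x) ∧ AnswersNo τ) ∨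
        ((¬ ∃ x y, T x y ∧ T y x) ∧ AnswersYes τ ∧ ∃ p : Equiv.Perm (Fin n),
          ReturnsOrdering τ p ∧ ∀ x y, T x y → listingOrder p x y)) := by
  refine .seq ((ok_conflictTest hE hM).imp ?_)
  rintro t₁ τ₁ - hframe₁ ⟨ht₁, hmem₁, hflag⟩
  have hE₁ : Env n τ₁ := hE.frame hframe₁
  refine .ite (fun hyes => ?_) fun hno => ?_
  · rw [Test.eval, hflag, hE₁.one, decide_eq_true_eq, bit_eq_one] at hyes
    exact .skip ⟨by ring_nf at ht₁ ⊢; omega, .inl ⟨hyes, hE₁.answer⟩⟩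
  · rw [Test.eval, hflag, hE₁.one, decide_eq_false_iff_not, bit_eq_one] at hno
    refine .seq ((ok_topologicalSort hE₁ (hmem₁ ▸ hM) (hT hno)).imp ?_)
    rintro t₂ τ₂ - hframe₂ ⟨ht₂, p, hp, hpT⟩
    have hbase : (τ₂.setReg Reg.answer 1).reg 1 = 7 * (n * n + 1) :=
      (hE₁.frame hframe₂).base .order
    refine .of_wp ⟨by unfold bound; omega, by linarith, .inr ⟨hno, by simp [AnswersYes], p,
      fun i => ?_, hpT⟩⟩
    rw [hbase]
    exact hp i

/-- The loop that collects the implication classes. -/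
def mainLoop : Stmt := .loop (.lt Reg.zero Reg.found) collectClass

/-- The recognition program. -/
def program : Stmt :=
  .seq prologue <| .ite (.eq Reg.flag Reg.one) (.seq prepareMain (.seq mainLoop epilogue)) .skip

theorem bounded_initial (hL : IsAdjacencyLists D L) (hD : IsLoopless D) (P : Stmt) :
    (initial P (inputWord L)).store.Bounded (bound n) := by
  refine ⟨fun _ => Nat.zero_le _, fun i => (inputWord_getD_le hL hD i).trans ?_⟩
  have := Nat.le_mul_self n
  unfold bound
  omega

theorem sq_le_cube (n : ℕ) : n ^ 2 ≤ n ^ 3 := by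
  rcases n.eq_zero_or_pos with rfl | hn
  exacts [le_rfl, Nat.pow_le_pow_right hn (by decide)]

theorem exists_reaches_of_not_isSemicomplete (hL : IsAdjacencyLists D L) (hD : IsLoopless D)
    (hS : ¬ IsSemicomplete D) :
    ∃ N τ, Reaches (bound n) (initial program (inputWord L)) N ⟨[], τ⟩ ∧
      N ≤ 20000 * (n ^ 3 + 1) ∧ AnswersNo τ := by
  have hok : Ok (bound n) program (initial program (inputWord L)).store fun t τ =>
      t ≤ (56 * n + 26) * n + 60 ∧ AnswersNo τ := by
    refine .seq ((ok_prologue hL hD).imp ?_)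
    rintro t₁ τ₁ - - ⟨ht₁, hτ₁, hflag⟩
    refine .ite (fun hyes => absurd ?_ hS) fun _ => .skip ⟨by omega, hτ₁.env.answer⟩
    rwa [Test.eval, hflag, hτ₁.env.one, decide_eq_true_eq, bit_eq_one] at hyes
  obtain ⟨N, τ, ⟨hN, hτ⟩, hexec⟩ := hok (bounded_initial hL hD program)
  refine ⟨N, τ, hexec [], ?_, hτ⟩
  nlinarith [sq_le_cube n, Nat.le_self_pow (n := 3) (by decide) n]

theorem exists_reaches_mainLoop (hL : IsAdjacencyLists D L) (hD : IsLoopless D)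
    (hS : IsSemicomplete D) :
    ∃ t τ, Reaches (bound n) (initial program (inputWord L)) t ⟨[mainLoop, epilogue], τ⟩ ∧
      MainInvariant D [] τ ∧
      t ≤ ((110 * n + 6) * n + 6) * n + unitCost n * (n + 1) + (56 * n + 26) * n + 90 := by
  have hσ := bounded_initial hL hD program
  obtain ⟨t₁, σ₁, ⟨ht₁, hσ₁, hflag⟩, hexec₁⟩ := ok_prologue hL hD hσ
  obtain ⟨t₂, σ₂, ⟨hσ₂, ht₂⟩, hexec₂⟩ := ok_prepareMain hσ₁ hexec₁.bounded
  have hbranch : step ⟨[.ite (.eq Reg.flag Reg.one) (.seq prepareMain (.seq mainLoop epilogue))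
      .skip], σ₁⟩ = ⟨[.seq prepareMain (.seq mainLoop epilogue)], σ₁⟩ := by
    rw [step, if_pos (by simpa [Test.eval, hσ₁.env.one] using hflag.trans (bit_eq_one.2 hS))]
  refine ⟨_, σ₂, (Reaches.of_step hσ rfl hσ).trans <| (hexec₁ _).trans <|
    (Reaches.of_step hexec₁.bounded hbranch hexec₁.bounded).trans <|
    (Reaches.of_step hexec₁.bounded rfl hexec₁.bounded).trans <| (hexec₂ _).trans <|
    .of_step hexec₂.bounded rfl hexec₂.bounded, hσ₂, ?_⟩
  omega

theorem MainInvariant.collected_of_linked {q : List (Fin n × Fin n)} (h : MainInvariant D q σ)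
    (hexit : Test.eval σ (.lt Reg.zero Reg.found) = false) (x y : Fin n) (hl : Linked D x y) :
    heldPairs n σ x y ∨ heldPairs n σ y x := by
  have hfound : σ.reg Reg.found = 0 := by simpa [Test.eval, h.ready.env.zero] using hexit
  rw [h.ready.heldPairs_eq]
  by_contra hnone
  rw [not_or] at hnone
  exact h.exhausted hfound x y ⟨hl, hnone.1, hnone.2⟩

theorem exists_loopTrace_mainLoop (hS : IsSemicomplete D) (h : MainInvariant D [] σ)
    (hσ : σ.Bounded (bound n)) :
    ∃ (m : ℕ) (ss : ℕ → Store) (time : ℕ → ℕ), ss 0 = σ ∧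
      LoopTrace (bound n) (.lt Reg.zero Reg.found) collectClass m ss time ∧
      time m ≤ unitCost n * (4 * (n * n) + n) ∧ Env n (ss m) ∧
      IsMatrix (ss m).mem .collected (heldPairs n (ss m)) ∧
      IsLoopExecution D m (fun i => stateOf D (heldPairs n (ss i))) ∧
      LoopInvariant D (heldPairs n (ss m)) ∧
      ∀ x y, Linked D x y → heldPairs n (ss m) x y ∨ heldPairs n (ss m) y x := by
  obtain ⟨m, ss, time, rfl, htrace, hsteps, ⟨q, hq⟩, hle⟩ := exists_loopTrace
    (b := .lt Reg.zero Reg.found) (s := collectClass) (fun τ => ∃ q, MainInvariant D q τ) (work n)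
    (fun τ τ' => CollectStep D (heldPairs n τ) (heldPairs n τ'))
    (unitCost n * (4 * (n * n) + n)) (fun τ ⟨q, hq⟩ => hq.work_le)
    (fun τ ⟨q, hq⟩ hb => ok_collectClass hq (by
      simpa [Test.eval, hq.ready.env.zero, Nat.pos_iff_ne_zero] using hb)) hσ ⟨[], h⟩
  have hmax := hq.collected_of_linked htrace.exit
  have hinit : heldPairs n (ss 0) = fun _ _ => False := by
    rw [h.ready.heldPairs_eq]
    ext x y
    simp [pairRel]
  exact ⟨m, ss, time, rfl, htrace, (Nat.le_add_left _ _).trans (hle.trans hq.work_le),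
    hq.ready.env, hq.ready.heldPairs_eq ▸ hq.ready.collected,
    isLoopExecution_of_collectStep (S := fun i => heldPairs n (ss i)) hS hinit hsteps hmax,
    loopInvariant_of_collectStep (S := fun i => heldPairs n (ss i)) hS hinit hsteps le_rfl, hmax⟩

theorem isStrictTotalOrder_listingOrder (p : Equiv.Perm (Fin n)) :
    IsStrictTotalOrder (Fin n) (listingOrder p) :=
  RelEmbedding.isStrictTotalOrder (s := (· < ·)) ⟨p.symm.toEmbedding, Iff.rfl⟩

theorem exists_reaches_of_isSemicomplete (hL : IsAdjacencyLists D L) (hD : IsLoopless D)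
    (hS : IsSemicomplete D) :
    ∃ N τ, Reaches (bound n) (initial program (inputWord L)) N ⟨[], τ⟩ ∧
      N ≤ 20000 * (n ^ 3 + 1) ∧
      CarriesOut program (inputWord L) N (cell n .collected 0) D ∧
      (AnswersYes τ → ∃ p : Equiv.Perm (Fin n), ReturnsOrdering τ p ∧
        IsComparabilityOrdering D (listingOrder p)) := by
  obtain ⟨t₀, σ, hstart, hσ, ht₀⟩ := exists_reaches_mainLoop hL hD hS
  obtain ⟨m, ss, time, rfl, htrace, htime, hE, hM, hexecution, hinv, hmax⟩ :=
    exists_loopTrace_mainLoop hS hσ hstart.bounded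
  have hconflict := hinv.conflict_iff hD hmax
  obtain ⟨t₁, τ, ⟨ht₁, hout⟩, hepilogue⟩ := ok_epilogue hE hM
    (fun h => hinv.acyclic (not_firstTest_iff.1 (hconflict.not.1 h))) htrace.bounded
  rw [hconflict] at hout
  have hfinal := (hstart.trans (htrace.exec _)).trans (hepilogue [])
  have hrun : run program (inputWord L) _ = ⟨[], τ⟩ := hfinal.1
  refine ⟨_, τ, hfinal, ?_, ?_, fun hyes => ?_⟩
  · unfold unitCost at ht₀ htime
    nlinarith [sq_le_cube n, Nat.le_self_pow (n := 3) (by decide) n]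
  · rw [CarriesOut, hrun]
    refine hout.imp_right fun ⟨hfirst, hyes, p, hp, hpT⟩ => ⟨hfirst, hyes, m, _,
      fun i => t₀ + time i, hexecution, fun i hi => Nat.add_lt_add_left (htrace.time_lt i hi) _,
      by dsimp only; omega, fun i hi x y => ?_, p, hp, hpT⟩
    have hheld : run program (inputWord L) (t₀ + time i) = ⟨[mainLoop, epilogue], ss i⟩ :=
      (hstart.trans (htrace.reaches i hi _)).1
    rw [hheld]
    exact Iff.rfl
  · obtain ⟨-, hno⟩ | ⟨-, -, p, hp, hpT⟩ := hout
    · exact absurd (hno.symm.trans hyes) (by decide)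
    · exact ⟨p, hp, isComparabilityOrdering_of_extends hinv.toForcingClosed
        (isStrictTotalOrder_listingOrder p) hpT hmax⟩

theorem CarriesOut.answersYes {P : Stmt} {w : List ℕ} {N b : ℕ} (h : CarriesOut P w N b D)
    (hD : IsLoopless D) (hC : IsComparability D) : AnswersYes (run P w N).store :=
  h.elim (fun h => absurd h.1 (not_firstTest_iff.2 (hC.noSelfInverse hD))) fun h => h.2.1

theorem CarriesOut.answersYes_or_answersNo {P : Stmt} {w : List ℕ} {N b : ℕ}
    (h : CarriesOut P w N b D) : AnswersYes (run P w N).store ∨ AnswersNo (run P w N).store :=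
  h.elim (fun h => .inr h.2) fun h => .inl h.2.1

theorem bound_le_pow (n : ℕ) : bound n ≤ (n + 2) ^ 5 :=
  calc bound n ≤ (n + 2) ^ 3 * (n + 2) ^ 2 :=
        Nat.mul_le_mul (Nat.pow_le_pow_left (Nat.le_add_left 2 n) 3) (by nlinarith)
    _ = (n + 2) ^ 5 := (pow_add ..).symm

end Program

end ComparabilityDigraph

open RAM

/-- There is one program that, on every loopless digraph with `n` vertices given by adjacency
lists, halts within `O(n³)` steps, with all numbers of `O(log n)` bits; on semicomplete digraphs
it carries out the algorithm, and an ordering that it returns is a comparability ordering; and it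
decides whether the input is a semicomplete comparability digraph. -/
theorem mainTheorem8 :
    ∃ (P : RAM.Stmt) (base : ℕ → ℕ) (a c : ℕ),
      ∀ (n : ℕ) (D : Digraph (Fin n)) (L : Fin n → List (Fin n)),
        IsLoopless D → IsAdjacencyLists D L →
        ∃ N : ℕ, N ≤ a * (n ^ 3 + 1) ∧
          (RAM.run P (inputWord L) N).Halted ∧
          (∀ t i : ℕ, (RAM.run P (inputWord L) t).store.reg i ≤ (n + 2) ^ c ∧
            (RAM.run P (inputWord L) t).store.mem i ≤ (n + 2) ^ c) ∧
          (IsSemicomplete D →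
            CarriesOut P (inputWord L) N (base n) D ∧
            (AnswersYes (RAM.run P (inputWord L) N).store →
              ∃ p : Equiv.Perm (Fin n), ReturnsOrdering (RAM.run P (inputWord L) N).store p ∧
                IsComparabilityOrdering D (listingOrder p))) ∧
          ((IsSemicomplete D ∧ IsComparability D) →
            AnswersYes (RAM.run P (inputWord L) N).store) ∧
          (¬ (IsSemicomplete D ∧ IsComparability D) →
            AnswersNo (RAM.run P (inputWord L) N).store) := by
  refine ⟨program, fun n => cell n .collected 0, 20000, 5, fun n D L hD hL => ?_⟩
  have hsmall {N τ} (h : Reaches (bound n) (initial program (inputWord L)) N ⟨[], τ⟩) (t i : ℕ) :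
      (run program (inputWord L) t).store.reg i ≤ (n + 2) ^ 5 ∧
        (run program (inputWord L) t).store.mem i ≤ (n + 2) ^ 5 :=
    have ht := h.bounded_of_halted rfl t
    ⟨(ht.1 i).trans (bound_le_pow n), (ht.2 i).trans (bound_le_pow n)⟩
  by_cases hS : IsSemicomplete D
  · obtain ⟨N, τ, hreach, hN, hcarries, hordering⟩ := exists_reaches_of_isSemicomplete hL hD hS
    have hrun : run program (inputWord L) N = ⟨[], τ⟩ := hreach.1
    refine ⟨N, hN, hrun ▸ rfl, hsmall hreach, fun _ => ⟨hcarries, hrun ▸ hordering⟩,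
      fun h => hcarries.answersYes hD h.2, fun h => ?_⟩
    refine hcarries.answersYes_or_answersNo.resolve_left fun hyes => h ⟨hS, ?_⟩
    obtain ⟨p, -, hp⟩ := hordering (by rwa [hrun] at hyes)
    exact ⟨_, hp⟩
  · obtain ⟨N, τ, hreach, hN, hno⟩ := exists_reaches_of_not_isSemicomplete hL hD hS
    have hrun : run program (inputWord L) N = ⟨[], τ⟩ := hreach.1
    exact ⟨N, hN, hrun ▸ rfl, hsmall hreach, fun h => absurd h hS, fun h => absurd h.1 hS,
      fun _ => hrun ▸ hno⟩
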